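/- Conventions. Let $G$ be a group. An alphabet for $G$ is a finite set $A$ of letters with a map $A\to G$ whose image is closed under inverses and generates $G$; let $\pi\colon A^*\to G$ be the induced monoid homomorphism. For a language $L\subseteq A^*$ and $g\in G$ let $L_g$ be the set of all padded pairs $(u,v)$ (the shorter word is filled up at its end with a padding symbol and the two words are read in parallel) with $u,v\in L$ and $\pi(u)g=\pi(v)$. An automatic structure on $G$ is a pair $(L,A)$ such that $L$ is regular, $\pi(L)=G$, and $L_1$ and all $L_{\pi(a)}$, $a\in A$, are regular; it is given explicitly by finite state automata $M$, $M_=$, $M_a$ ($a\in A$) recognizing $L$, $L_1$ and $L_{\pi(a)}$ respectively. It is a structure with uniqueness if every $g\in G$ is represented by exactly one word of $L$. A subgroup $H\le G$ is rational for $(L,A)$ if $\pi^{-1}(H)\cap L$ is a regular language. Proposition 2. There is a uniform partial algorithm (a partial recursive function) which, given a finite presentation $G=\langle x_1,\dots,x_n\mid r_1,\dots,r_m\rangle$ and finitely many words $v_1,\dots,v_t$ in the letters $x_1^{\pm1},\dots,x_n^{\pm1}$, generating the subgroup $H=\langle\overline{v_1},\dots,\overline{v_t}\rangle$ of $G$,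 behaves as follows. (a) If $H$ is rational for some automatic structure on $G$ (over any alphabet), the algorithm eventually stops and outputs finite state automata $M,M_=,M_{x_1},M_{x_1^{-1}},\dots,M_{x_n},M_{x_n^{-1}}$ forming an automatic structure with uniqueness for $G$ over the alphabet $A=\{x_1^{\pm1},\dots,x_n^{\pm1}\}$, with $L=L(M)$, together with a finite state automaton $M_H$ such that $L(M_H)=\pi^{-1}(H)\cap L$. (b) If there is no automatic structure on $G$ for which $H$ is rational, the algorithm runs forever. -/

import Mathlib

set_option synthInstance.maxSize 2000
set_option synthInstance.maxHeartbeats 200000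

/-! ### Words, padded pairs and automatic structures -/

/-- The element of `G` represented by the word `w`, for letters interpreted by `val`; this is the
natural monoid homomorphism `π : A* → G`. -/
def wordVal {α G : Type*} [Group G] (val : α → G) (w : List α) : G := (w.map val).prod

/-- The padded pair of two words: the words are read in parallel, letter by letter, and the
shorter one is filled up at its end with the padding symbol `none`. -/
def padPair {α : Type*} (u v : List α) : List (Option α × Option α) :=
  List.zipWithAll Prod.mk u v

/-- The language of all padded pairs `(u, v)` with `u, v ∈ L` and `π(u) · g = π(v)`. -/
def multiplierLanguage {α G : Type*} [Group G] (val : α → G) (L : Language α) (g : G) :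
    Language (Option α × Option α) :=
  {z | ∃ u ∈ L, ∃ v ∈ L, wordVal val u * g = wordVal val v ∧ z = padPair u v}

/-- The full preimage `L ∩ π⁻¹(H)` of a subgroup `H` in a language `L`. -/
def subgroupLanguage {α G : Type*} [Group G] (val : α → G) (L : Language α) (H : Subgroup G) :
    Language α :=
  {w | w ∈ L ∧ wordVal val w ∈ H}

/-- `L` is the language of an automatic structure on `G` over the finite alphabet `α`, whose letters
stand for elements of `G` through `val`: the letters form a set closed under inverses, `L` is
regular and maps onto `G` (so the letters generate `G`), and the equality and the multiplication by
each letter are recognized on padded pairs of words of `L` by finite state automata. -/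
structure IsAutomaticStructure {α G : Type*} [Finite α] [Group G] (val : α → G)
    (L : Language α) : Prop where
  inv_closed : ∀ a, ∃ b, val b = (val a)⁻¹
  regular : L.IsRegular
  surjective : ∀ g : G, ∃ w ∈ L, wordVal val w = g
  regular_eq : (multiplierLanguage val L 1).IsRegular
  regular_mul : ∀ a, (multiplierLanguage val L (val a)).IsRegular

/-- `H` is rational with respect to some automatic structure on `G`, over some finite alphabet. -/
def IsRationalForSomeAutomaticStructure {G : Type*} [Group G] (H : Subgroup G) : Prop :=
  ∃ (k : ℕ) (val : Fin k → G) (L : Language (Fin k)),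
    IsAutomaticStructure val L ∧ (subgroupLanguage val L H).IsRegular

/-! ### Finite presentations -/

/-- The letters `x_i` (`(i, true)`) and `x_i⁻¹` (`(i, false)`), as in `FreeGroup (Fin n)`. -/
abbrev Letter (n : ℕ) : Type := Fin n × Bool

/-- The group `⟨x_1, …, x_n | r_1, …, r_m⟩`, the relators being given by words. -/
abbrev PresGroup (n : ℕ) (R : List (List (Letter n))) : Type :=
  PresentedGroup {r : FreeGroup (Fin n) | ∃ w ∈ R, r = FreeGroup.mk w}

/-- The element of the presented group that a letter stands for. -/
def letterVal (n : ℕ) (R : List (List (Letter n))) (a : Letter n) : PresGroup n R :=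
  if a.2 then PresentedGroup.of a.1 else (PresentedGroup.of a.1)⁻¹

/-- The subgroup generated by the elements represented by the words `v_1, …, v_t`. -/
def genSubgroup (n : ℕ) (R V : List (List (Letter n))) : Subgroup (PresGroup n R) :=
  Subgroup.closure {g | ∃ v ∈ V, g = wordVal (letterVal n R) v}

/-! ### Inputs and outputs of the algorithm

They are finite data of a fixed type, independent of the number of generators: the letter
`x_i^{±1}` is written as the pair of the number `i` and a sign. -/

/-- The written form of a letter. -/
abbrev LetterCode : Type := ℕ × Bool

/-- The written form of a letter of the padded pair alphabet. -/
abbrev PairCode : Type := Option LetterCode × Option LetterCode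

def codeLetter {n : ℕ} (a : Letter n) : LetterCode := (a.1.val, a.2)

def codePair {n : ℕ} (p : Option (Letter n) × Option (Letter n)) : PairCode :=
  (p.1.map codeLetter, p.2.map codeLetter)

/-- An input: the number of generators, the relators, and the words generating the subgroup. -/
abbrev AlgInput : Type := ℕ × List (List LetterCode) × List (List LetterCode)

def codeInput (n : ℕ) (R V : List (List (Letter n))) : AlgInput :=
  (n, R.map (List.map codeLetter), V.map (List.map codeLetter))

/-- A finite state automaton written out explicitly: `(k, s, F, T)` has the `k + 1` states
`0, …, k`, the initial state `s`, the list `F` of accept states and the transition table `T`. -/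
abbrev AutomatonCode (α : Type) : Type := ℕ × ℕ × List ℕ × List ((ℕ × α) × ℕ)

/-- The deterministic automaton that is written out. So that every code is meaningful, states are
read modulo `k + 1`, the first matching entry of the table counts, and transitions missing from the
table lead to the state `0`. -/
def AutomatonCode.toDFA {α : Type} [DecidableEq α] (c : AutomatonCode α) :
    DFA α (Fin (c.1 + 1)) where
  step p a :=
    Fin.ofNat (c.1 + 1) (((c.2.2.2.find? fun t => decide (t.1 = (p.val, a))).map Prod.snd).getD 0)
  start := Fin.ofNat (c.1 + 1) c.2.1
  accept := {p | p.val ∈ c.2.2.1}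

/-- The language over the letters `x_1^{±1}, …, x_n^{±1}` accepted by a written out automaton. -/
def wordLanguage (n : ℕ) (c : AutomatonCode LetterCode) : Language (Letter n) :=
  (c.toDFA.comap codeLetter).accepts

/-- The language over the padded pair alphabet accepted by a written out automaton. -/
def pairLanguage (n : ℕ) (c : AutomatonCode PairCode) :
    Language (Option (Letter n) × Option (Letter n)) :=
  (c.toDFA.comap codePair).accepts

/-- An output: the automaton `M`, the automaton `M_=`, the list of the pairs
`(M_{x_i}, M_{x_i⁻¹})`, and the automaton `M_H`. -/
abbrev AlgOutput : Type :=
  AutomatonCode LetterCode × AutomatonCode PairCode ×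
    List (AutomatonCode PairCode × AutomatonCode PairCode) × AutomatonCode LetterCode

/-- The automata `(M, M_=, M_{x_1}, …, M_{x_n⁻¹})` form an automatic structure with uniqueness, over
the letters `x_1^{±1}, …, x_n^{±1}`, for the presented group. -/
structure IsAutomaticStructureWithUniqueness (n : ℕ) (R : List (List (Letter n)))
    (M : AutomatonCode LetterCode) (Meq : AutomatonCode PairCode)
    (Mx : List (AutomatonCode PairCode × AutomatonCode PairCode)) : Prop where
  existsUnique : ∀ g : PresGroup n R,
    ∃! w : List (Letter n), w ∈ wordLanguage n M ∧ wordVal (letterVal n R) w = g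
  lang_eq : pairLanguage n Meq = multiplierLanguage (letterVal n R) (wordLanguage n M) 1
  length_eq : Mx.length = n
  lang_mul : ∀ i : Fin n,
    pairLanguage n (Mx[i.val]'(length_eq.symm ▸ i.isLt)).1 =
        multiplierLanguage (letterVal n R) (wordLanguage n M) (letterVal n R (i, true)) ∧
      pairLanguage n (Mx[i.val]'(length_eq.symm ▸ i.isLt)).2 =
        multiplierLanguage (letterVal n R) (wordLanguage n M) (letterVal n R (i, false))

/-- The output demanded: an automatic structure with uniqueness for the presented group, and an
automaton `M_H` with `L(M_H) = π⁻¹(H) ∩ L(M)` for the subgroup `H` generated by the words `V`. -/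
def IsCorrectOutput (n : ℕ) (R V : List (List (Letter n))) (o : AlgOutput) : Prop :=
  IsAutomaticStructureWithUniqueness n R o.1 o.2.1 o.2.2.1 ∧
    wordLanguage n o.2.2.2 =
      subgroupLanguage (letterVal n R) (wordLanguage n o.1) (genSubgroup n R V)

/-!
Correctness of an output quantifies over all elements of a group whose word problem is not known to be
solvable, hence it cannot be tested directly. It does follow from a certificate whose validity is
semidecidable (`semiDec_exists_certified`), and the algorithm searches through all pairs of an output
and a certificate.

*The certificate.* Let `L`, `X a` and `L_H` be the languages of the automata `M`, `M_a`, `M_H` of an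
output. Statements about all words that are tracked by automata are decided by running the automata
in parallel (`ParallelRun.semiDec_forall_code`), and that `(u, v) ∈ X a` implies `π(u) a = π(v)`, or
that `w ∈ L_H` implies `π(w) ∈ H`, is certified by labels in the group, given as words, at the states
of the automaton (`IsLabelling`). Such conditions make every `X a` a total relation on `L`, inverse
to `X a⁻¹`, along which the relators act trivially, hence the group acts on `L` through the relations
`X a`. A word `w₀ ∈ L` for `1` and an automaton `Y` which contains all pairs `(p, w₀ · p)` and no
pair `(u, v)` with `u ∈ L` and `u ≠ v` show that `w₀ · u = u` for `u ∈ L`, so that words of `L` for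
the same element are equal. Then `X a` is the whole multiplier language, and `L_H` is all of
`L ∩ π⁻¹(H)` since it contains `w₀` and is preserved by the generators of `H`
(`Certified.isCorrectOutput`).

*Completeness.* Suppose that `H` is rational for an automatic structure over some alphabet. Words of
its language that represent elements at bounded distance fellow travel
(`IsAutomaticStructure.fellowTraveller`), and conversely the multiplier languages of a regular language
with this property are regular (`FellowTraveller.isRegular`). The words over `x_i^{±1}` that follow
the words of the given language within bounded distance at `ℓ` times their speed form a regular
language with the fellow traveller property (`shadowLanguage`). Since every letter has to be replaced
by a word of the same even length, the image of a word may have the wrong parity; this error of one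
letter is carried along and corrected at the end (`exists_shadow`). Among the words for one element the
least one, in the order of the numbers that the words denote, is selected by an automaton
(`exists_unique_representatives`). Finally, `Y` is regular since a prefix of a word of the language
can be completed by one of finitely many words (`isRegular_orbitLanguage`).

If there is no such automatic structure, then the search does not end, because a correct output is
itself an automatic structure for which `H` is rational (`IsCorrectOutput.isRational`).
-/

/-! ### Semidecidable predicates -/

/-- A predicate is semidecidable if it is the projection of a primitive recursive one. -/
def SemiDec {α : Type*} [Primcodable α] (p : α → Prop) : Prop :=
  ∃ q : α × ℕ → Prop, PrimrecPred q ∧ ∀ a, p a ↔ ∃ m, q (a, m)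

theorem PrimrecPred.ball {α β : Type*} [Primcodable α] [Primcodable β] {p : α × β → Prop}
    (hp : PrimrecPred p) {l : α → List β} (hl : Primrec l) :
    PrimrecPred fun a => ∀ b ∈ l a, p (a, b) := by
  have h : PrimrecRel fun (b : β) (a : α) => p (a, b) :=
    hp.comp (Primrec.snd.pair Primrec.fst)
  exact h.forall_mem_list.comp hl Primrec.id

theorem PrimrecPred.bex {α β : Type*} [Primcodable α] [Primcodable β] {p : α × β → Prop}
    (hp : PrimrecPred p) {l : α → List β} (hl : Primrec l) :
    PrimrecPred fun a => ∃ b ∈ l a, p (a, b) := by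
  have h : PrimrecRel fun (b : β) (a : α) => p (a, b) :=
    hp.comp (Primrec.snd.pair Primrec.fst)
  exact h.exists_mem_list.comp hl Primrec.id

namespace SemiDec

variable {α β : Type*} [Primcodable α] [Primcodable β]

theorem of_iff {p q : α → Prop} (hp : SemiDec p) (h : ∀ a, q a ↔ p a) : SemiDec q := by
  rwa [show q = p from funext fun a => propext (h a)]

theorem of_primrecPred {p : α → Prop} (hp : PrimrecPred p) : SemiDec p :=
  ⟨fun x => p x.1, hp.comp Primrec.fst, fun a => by simp⟩

theorem comp {p : β → Prop} (hp : SemiDec p) {f : α → β} (hf : Primrec f) :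
    SemiDec fun a => p (f a) := by
  obtain ⟨q, hq, h⟩ := hp
  exact ⟨fun x => q (f x.1, x.2), hq.comp ((hf.comp Primrec.fst).pair Primrec.snd),
    fun a => h (f a)⟩

theorem and {p q : α → Prop} (hp : SemiDec p) (hq : SemiDec q) :
    SemiDec fun a => p a ∧ q a := by
  obtain ⟨p', hp', h⟩ := hp
  obtain ⟨q', hq', k⟩ := hq
  refine ⟨fun x => p' (x.1, x.2.unpair.1) ∧ q' (x.1, x.2.unpair.2), ?_, fun a => ?_⟩
  · have u : Primrec fun x : α × ℕ => x.2.unpair := Primrec.unpair.comp Primrec.snd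
    exact (hp'.comp (Primrec.fst.pair (Primrec.fst.comp u))).and
      (hq'.comp (Primrec.fst.pair (Primrec.snd.comp u)))
  · simp only [h, k]
    constructor
    · rintro ⟨⟨m, hm⟩, l, hl⟩
      exact ⟨Nat.pair m l, by simpa using ⟨hm, hl⟩⟩
    · rintro ⟨m, hm, hl⟩
      exact ⟨⟨_, hm⟩, _, hl⟩

theorem or {p q : α → Prop} (hp : SemiDec p) (hq : SemiDec q) :
    SemiDec fun a => p a ∨ q a := by
  obtain ⟨p', hp', h⟩ := hp
  obtain ⟨q', hq', k⟩ := hq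
  refine ⟨fun x => p' x ∨ q' x, hp'.or hq', fun a => ?_⟩
  simp only [h, k, exists_or]

theorem ex {p : α × β → Prop} (hp : SemiDec p) : SemiDec fun a => ∃ b, p (a, b) := by
  obtain ⟨q, hq, h⟩ := hp
  refine ⟨fun x => ∃ b ∈ (Encodable.decode (α := β) x.2.unpair.1).toList,
    q ((x.1, b), x.2.unpair.2), ?_, fun a => ?_⟩
  · have u : Primrec fun x : α × ℕ => x.2.unpair := Primrec.unpair.comp Primrec.snd
    refine PrimrecPred.bex (p := fun y : (α × ℕ) × β => q ((y.1.1, y.2), y.1.2.unpair.2)) ?_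
      (Primrec.optionToList.comp (Primrec.decode.comp (Primrec.fst.comp u)))
    exact hq.comp (((Primrec.fst.comp Primrec.fst).pair Primrec.snd).pair
      (Primrec.snd.comp (u.comp Primrec.fst)))
  · constructor
    · rintro ⟨b, hb⟩
      obtain ⟨m, hm⟩ := (h _).1 hb
      exact ⟨Nat.pair (Encodable.encode b) m, b, by simpa using hm⟩
    · rintro ⟨m, b, -, hb⟩
      exact ⟨b, (h _).2 ⟨_, hb⟩⟩

theorem bex {p : α × β → Prop} (hp : SemiDec p) {l : α → List β} (hl : Primrec l) :
    SemiDec fun a => ∃ b ∈ l a, p (a, b) := by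
  refine SemiDec.ex (p := fun x : α × β => x.2 ∈ l x.1 ∧ p x) (SemiDec.and ?_ hp)
  refine (of_primrecPred ((Primrec.eq.comp (Primrec.snd.comp Primrec.fst) Primrec.snd).bex
    (p := fun y : (α × β) × β => y.1.2 = y.2) (hl.comp Primrec.fst))).of_iff fun a => ?_
  simp

theorem ball {p : α × β → Prop} (hp : SemiDec p) {l : α → List β} (hl : Primrec l) :
    SemiDec fun a => ∀ b ∈ l a, p (a, b) := by
  obtain ⟨q, hq, h⟩ := hp
  have key : SemiDec fun a => ∃ ms : List ℕ, ∀ b ∈ l a, ∃ m ∈ ms, q ((a, b), m) := by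
    refine SemiDec.ex (p := fun x : α × List ℕ => ∀ b ∈ l x.1, ∃ m ∈ x.2, q ((x.1, b), m))
      (of_primrecPred ?_)
    refine PrimrecPred.ball (p := fun y : (α × List ℕ) × β => ∃ m ∈ y.1.2, q ((y.1.1, y.2), m))
      ?_ (hl.comp Primrec.fst)
    refine PrimrecPred.bex (p := fun y : ((α × List ℕ) × β) × ℕ => q ((y.1.1.1, y.1.2), y.2)) ?_
      (Primrec.snd.comp Primrec.fst)
    exact hq.comp (((Primrec.fst.comp (Primrec.fst.comp Primrec.fst)).pair
      (Primrec.snd.comp Primrec.fst)).pair Primrec.snd)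
  refine key.of_iff fun a => ⟨fun H => ?_, fun ⟨ms, H⟩ b hb => ?_⟩
  · choose! f hf using fun b hb => (h _).1 (H b hb)
    exact ⟨(l a).map f, fun b hb => ⟨f b, List.mem_map_of_mem hb, hf b hb⟩⟩
  · obtain ⟨m, -, hm⟩ := H b hb
    exact (h _).2 ⟨m, hm⟩

variable {γ σ : Type*} [Primcodable γ] [Primcodable σ]

/-- The existence of a finite set of states with a start state, all of whose states are
acceptable, and which for each of its states and each letter contains a successor. -/
theorem invariant {start ok : α × σ → Prop} {trans : α × σ × γ × σ → Prop} {letters : α → List γ}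
    (hstart : SemiDec start) (hok : SemiDec ok) (htrans : SemiDec trans)
    (hletters : Primrec letters) :
    SemiDec fun a => ∃ C : List σ, (∃ s ∈ C, start (a, s)) ∧
      ∀ s ∈ C, ok (a, s) ∧ ∀ c ∈ letters a, ∃ s' ∈ C, trans (a, s, c, s') := by
  refine SemiDec.ex (p := fun x : α × List σ => (∃ s ∈ x.2, start (x.1, s)) ∧
    ∀ s ∈ x.2, ok (x.1, s) ∧ ∀ c ∈ letters x.1, ∃ s' ∈ x.2, trans (x.1, s, c, s')) ?_
  refine SemiDec.and ?_ ?_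
  · exact SemiDec.bex (p := fun y : (α × List σ) × σ => start (y.1.1, y.2))
      (hstart.comp ((Primrec.fst.comp Primrec.fst).pair Primrec.snd)) Primrec.snd
  · refine SemiDec.ball (p := fun y : (α × List σ) × σ => ok (y.1.1, y.2) ∧
      ∀ c ∈ letters y.1.1, ∃ s' ∈ y.1.2, trans (y.1.1, y.2, c, s')) (SemiDec.and ?_ ?_) Primrec.snd
    · exact hok.comp ((Primrec.fst.comp Primrec.fst).pair Primrec.snd)
    · refine SemiDec.ball (p := fun z : ((α × List σ) × σ) × γ =>
        ∃ s' ∈ z.1.1.2, trans (z.1.1.1, z.1.2, z.2, s')) ?_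
        (hletters.comp (Primrec.fst.comp Primrec.fst))
      refine SemiDec.bex (p := fun z : (((α × List σ) × σ) × γ) × σ =>
        trans (z.1.1.1.1, z.1.1.2, z.1.2, z.2)) ?_
        (Primrec.snd.comp (Primrec.fst.comp Primrec.fst))
      have h1 : Primrec fun z : (((α × List σ) × σ) × γ) × σ => z.1.1 :=
        Primrec.fst.comp Primrec.fst
      exact htrans.comp ((Primrec.fst.comp (Primrec.fst.comp h1)).pair
        ((Primrec.snd.comp h1).pair ((Primrec.snd.comp Primrec.fst).pair Primrec.snd)))

/-- A property of all words that depends only on the state reached by a finite automaton is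
semidecidable: a certificate is a finite set of states that contains the initial one and is closed
under transitions. -/
theorem forall_words {start : α → σ} {step : α × σ × γ → σ} {ok : α × σ → Prop}
    {letters : α → List γ} (hstart : Primrec start) (hstep : Primrec step) (hok : SemiDec ok)
    (hletters : Primrec letters)
    (hfin : ∀ a, ∃ S : Set σ, S.Finite ∧ start a ∈ S ∧
      ∀ s ∈ S, ∀ c ∈ letters a, step (a, s, c) ∈ S) :
    SemiDec fun a => ∀ z : List γ, (∀ c ∈ z, c ∈ letters a) →
      ok (a, z.foldl (fun s c => step (a, s, c)) (start a)) := by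
  have key := SemiDec.invariant (start := fun x : α × σ => x.2 = start x.1) (ok := ok)
    (trans := fun x : α × σ × γ × σ => x.2.2.2 = step (x.1, x.2.1, x.2.2.1))
    (of_primrecPred (Primrec.eq.comp Primrec.snd (hstart.comp Primrec.fst))) hok
    (of_primrecPred (Primrec.eq.comp
      (Primrec.snd.comp (Primrec.snd.comp Primrec.snd))
      (hstep.comp (Primrec.fst.pair ((Primrec.fst.comp Primrec.snd).pair
        (Primrec.fst.comp (Primrec.snd.comp Primrec.snd))))))) hletters
  refine key.of_iff fun a => ⟨fun H => ?_, ?_⟩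
  · obtain ⟨S, hS, h0, hcl⟩ := hfin a
    have hT : {s | ∃ z : List γ, (∀ c ∈ z, c ∈ letters a) ∧
        s = z.foldl (fun s c => step (a, s, c)) (start a)} ⊆ S := by
      rintro s ⟨z, hz, rfl⟩
      induction z using List.reverseRecOn with
      | nil => exact h0
      | append_singleton z c ih =>
        rw [List.foldl_append]
        exact hcl _ (ih fun d hd => hz d (by simp [hd])) c (hz c (by simp))
    refine ⟨(hS.subset hT).toFinset.toList, ⟨start a, ?_, rfl⟩, fun s hs => ?_⟩
    · simpa using ⟨[], by simp⟩
    · simp only [Finset.mem_toList, Set.Finite.mem_toFinset] at hs ⊢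
      obtain ⟨z, hz, rfl⟩ := hs
      refine ⟨H z hz, fun c hc => ⟨_, ⟨z ++ [c], ?_, ?_⟩, rfl⟩⟩
      · intro d hd
        rcases List.mem_append.1 hd with hd | hd
        · exact hz d hd
        · rw [List.mem_singleton.1 hd]
          exact hc
      · rw [List.foldl_append]
        rfl
  · rintro ⟨C, ⟨s, hs, e : s = start a⟩, hC⟩ z hz
    subst e
    suffices z.foldl (fun s c => step (a, s, c)) (start a) ∈ C from (hC _ this).1
    induction z using List.reverseRecOn with
    | nil => exact hs
    | append_singleton z c ih =>
      rw [List.foldl_append]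
      obtain ⟨s', hs', e⟩ := (hC _ (ih fun d hd => hz d (by simp [hd]))).2 c (hz c (by simp))
      simp only at e
      simpa [← e] using hs'

/-- Unbounded search for a witness of a semidecidable relation. -/
theorem exists_partrec_choice {p : α × β → Prop} (hp : SemiDec p) :
    ∃ f : α →. β, Partrec f ∧ (∀ a, ∀ b ∈ f a, p (a, b)) ∧ ∀ a, (∃ b, p (a, b)) → (f a).Dom := by
  obtain ⟨q, hq, h⟩ := hp
  classical
  let g : α → ℕ → Option β := fun a m =>
    (Encodable.decode (α := β) m.unpair.1).bind fun b =>
      if q ((a, b), m.unpair.2) then some b else none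
  have hg : Primrec₂ g := by
    have u : Primrec fun x : α × ℕ => x.2.unpair := Primrec.unpair.comp Primrec.snd
    refine Primrec.option_bind (Primrec.decode.comp (Primrec.fst.comp u)) ?_
    refine Primrec.ite ?_ (Primrec.option_some.comp Primrec.snd) (Primrec.const none)
    exact hq.comp (((Primrec.fst.comp Primrec.fst).pair Primrec.snd).pair
      (Primrec.snd.comp (u.comp Primrec.fst)))
  refine ⟨fun a => Nat.rfindOpt (g a), Partrec.rfindOpt hg.to_comp, fun a b hb => ?_, ?_⟩
  · obtain ⟨m, hm⟩ := Nat.rfindOpt_spec hb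
    simp only [g, Option.mem_def, Option.bind_eq_some_iff] at hm
    obtain ⟨b', -, hb'⟩ := hm
    split_ifs at hb' with hq'
    · cases hb'
      exact (h _).2 ⟨_, hq'⟩
  · rintro a ⟨b, hb⟩
    obtain ⟨m, hm⟩ := (h _).1 hb
    refine Nat.rfindOpt_dom.2 ⟨Nat.pair (Encodable.encode b) m, b, ?_⟩
    simp [g, hm]

end SemiDec

/-! ### Running coded automata -/

namespace AutomatonCode

section Start

variable {α : Type}

/-- The initial state of a coded automaton, as a natural number. -/
def startNat (c : AutomatonCode α) : ℕ := c.2.1 % (c.1 + 1)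

/-- Whether a coded automaton accepts a state. -/
def acceptsState (c : AutomatonCode α) (p : ℕ) : Bool := decide (p ∈ c.2.2.1)

theorem startNat_lt (c : AutomatonCode α) : c.startNat < c.1 + 1 :=
  Nat.mod_lt _ (Nat.succ_pos _)

theorem primrec_startNat [Primcodable α] : Primrec (startNat : AutomatonCode α → ℕ) :=
  Primrec.nat_mod.comp (Primrec.fst.comp Primrec.snd) (Primrec.succ.comp Primrec.fst)

theorem primrec_acceptsState [Primcodable α] {β : Type*} [Primcodable β]
    {c : β → AutomatonCode α} {p : β → ℕ} (hc : Primrec c) (hp : Primrec p) :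
    Primrec fun x => (c x).acceptsState (p x) := by
  suffices Primrec fun x : AutomatonCode α × ℕ => x.1.acceptsState x.2 from
    this.comp (hc.pair hp)
  have h : PrimrecPred fun x : AutomatonCode α × ℕ => ∃ q ∈ x.1.2.2.1, q = x.2 :=
    PrimrecPred.bex (p := fun y : (AutomatonCode α × ℕ) × ℕ => y.2 = y.1.2)
      (Primrec.eq.comp Primrec.snd (Primrec.snd.comp Primrec.fst))
      (Primrec.fst.comp (Primrec.snd.comp (Primrec.snd.comp Primrec.fst)))
  classical
  exact h.decide.of_eq fun x => by simp [acceptsState]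

end Start

section Run

variable {α : Type} [DecidableEq α]

/-- The transition function of a coded automaton, on states written as natural numbers. -/
def stepNat (c : AutomatonCode α) (p : ℕ) (a : α) : ℕ :=
  (((c.2.2.2.find? fun t => decide (t.1 = (p, a))).map Prod.snd).getD 0) % (c.1 + 1)

/-- The state, as a natural number, that a coded automaton reaches on a word. -/
def run (c : AutomatonCode α) (w : List α) : ℕ := w.foldl c.stepNat c.startNat

theorem stepNat_lt (c : AutomatonCode α) (p : ℕ) (a : α) : c.stepNat p a < c.1 + 1 :=
  Nat.mod_lt _ (Nat.succ_pos _)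

theorem run_append_singleton (c : AutomatonCode α) (w : List α) (a : α) :
    c.run (w ++ [a]) = c.stepNat (c.run w) a := by
  simp [run]

theorem run_lt (c : AutomatonCode α) (w : List α) : c.run w < c.1 + 1 := by
  induction w using List.reverseRecOn with
  | nil => exact c.startNat_lt
  | append_singleton w a _ => rw [run_append_singleton]; exact c.stepNat_lt _ _

theorem _root_.List.find?_map_snd_eq_lookup {κ β : Type*} [DecidableEq κ] (l : List (κ × β))
    (k : κ) : (l.find? fun t => decide (t.1 = k)).map Prod.snd = l.lookup k := by
  induction l with
  | nil => rfl
  | cons t l ih =>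
    obtain ⟨k', b⟩ := t
    by_cases h : k' = k
    · subst h; simp
    · rw [List.find?_cons_of_neg (by simpa using h), ih, List.lookup_cons]
      simp [beq_eq_false_iff_ne.2 (Ne.symm h)]

theorem val_toDFA_step (c : AutomatonCode α) (p : Fin (c.1 + 1)) (a : α) :
    (c.toDFA.step p a).val = c.stepNat p.val a := by
  rfl

theorem val_toDFA_eval (c : AutomatonCode α) (w : List α) : (c.toDFA.eval w).val = c.run w := by
  induction w using List.reverseRecOn with
  | nil => rfl
  | append_singleton w a ih =>
    rw [DFA.eval_append_singleton, val_toDFA_step, ih, run_append_singleton]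

theorem mem_comap_accepts {β : Type} (f : β → α) (c : AutomatonCode α) (w : List β) :
    w ∈ (c.toDFA.comap f).accepts ↔ c.acceptsState (c.run (w.map f)) = true := by
  rw [DFA.accepts_comap]
  change w.map f ∈ c.toDFA.accepts ↔ _
  rw [DFA.mem_accepts, acceptsState, decide_eq_true_iff, ← val_toDFA_eval]
  rfl

/-- Every regular language over a finite alphabet is the language of a coded automaton. -/
theorem exists_accepts_eq {β : Type} [Finite β] {f : β → α} (hf : Function.Injective f)
    {L : Language β} (hL : L.IsRegular) :
    ∃ c : AutomatonCode α, (c.toDFA.comap f).accepts = L := by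
  obtain ⟨σ, _, M, rfl⟩ := hL
  classical
  have := Fintype.ofFinite β
  obtain ⟨k, hk⟩ : ∃ k, Fintype.card σ = k + 1 :=
    Nat.exists_eq_succ_of_ne_zero (Fintype.card_pos_iff.2 ⟨M.start⟩).ne'
  let e : σ ≃ Fin (k + 1) := Fintype.equivFinOfCardEq hk
  let entry : σ × β → (ℕ × α) × ℕ := fun x => (((e x.1).val, f x.2), (e (M.step x.1 x.2)).val)
  let c : AutomatonCode α := (k, (e M.start).val,
    ((Finset.univ.filter (· ∈ M.accept)).toList.map fun p => (e p).val),
    Finset.univ.toList.map entry)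
  refine ⟨c, ?_⟩
  have hlook : ∀ p b, (c.2.2.2.find? fun t => decide (t.1 = ((e p).val, f b))).map Prod.snd =
      some (e (M.step p b)).val := by
    intro p b
    have hm : ∃ t, c.2.2.2.find? (fun t => decide (t.1 = ((e p).val, f b))) = some t := by
      rw [← Option.isSome_iff_exists, List.find?_isSome]
      exact ⟨entry (p, b), by simp [c], by simp [entry]⟩
    obtain ⟨t, ht⟩ := hm
    have h1 := List.find?_some ht
    have h2 := List.mem_of_find?_eq_some ht
    simp only [c, List.mem_map] at h2
    obtain ⟨⟨p', b'⟩, -, rfl⟩ := h2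
    simp only [entry, decide_eq_true_eq, Prod.mk.injEq] at h1
    have hp : p' = p := e.injective (Fin.ext h1.1)
    have hb : b' = b := hf h1.2
    subst hp hb
    simp [ht, entry]
  have hrun : ∀ w : List β, c.run (w.map f) = (e (M.eval w)).val := by
    intro w
    induction w using List.reverseRecOn with
    | nil => exact Nat.mod_eq_of_lt (e M.start).isLt
    | append_singleton w b ih =>
      rw [List.map_append, List.map_singleton, run_append_singleton, ih, stepNat, hlook,
        DFA.eval_append_singleton]
      exact Nat.mod_eq_of_lt (e _).isLt
  ext w
  rw [mem_comap_accepts, hrun, DFA.mem_accepts, acceptsState, decide_eq_true_iff]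
  simp only [c, List.mem_map, Finset.mem_toList, Finset.mem_filter, Finset.mem_univ, true_and]
  exact ⟨fun ⟨p, hp, h⟩ => e.injective (Fin.ext h) ▸ hp, fun h => ⟨_, h, rfl⟩⟩

theorem primrec_stepNat [Primcodable α] {β : Type*} [Primcodable β] {c : β → AutomatonCode α}
    {p : β → ℕ} {a : β → α} (hc : Primrec c) (hp : Primrec p) (ha : Primrec a) :
    Primrec fun x => (c x).stepNat (p x) (a x) := by
  suffices Primrec fun x : AutomatonCode α × ℕ × α => x.1.stepNat x.2.1 x.2.2 from
    this.comp (hc.pair (hp.pair ha))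
  have htab : Primrec fun x : AutomatonCode α × ℕ × α => x.1.2.2.2 :=
    Primrec.snd.comp (Primrec.snd.comp (Primrec.snd.comp Primrec.fst))
  have hlook : Primrec fun x : AutomatonCode α × ℕ × α =>
      (x.1.2.2.2.find? fun t => decide (t.1 = x.2)).map Prod.snd :=
    (Primrec.listLookup.comp Primrec.snd htab).of_eq fun x =>
      (List.find?_map_snd_eq_lookup _ _).symm
  exact Primrec.nat_mod.comp (Primrec.option_getD.comp hlook (Primrec.const 0))
    (Primrec.succ.comp (Primrec.fst.comp Primrec.fst))

end Run

attribute [irreducible] stepNat startNat acceptsState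

end AutomatonCode

theorem mem_wordLanguage {n : ℕ} {c : AutomatonCode LetterCode} {w : List (Letter n)} :
    w ∈ wordLanguage n c ↔ c.acceptsState (c.run (w.map codeLetter)) = true :=
  c.mem_comap_accepts codeLetter w

theorem mem_pairLanguage {n : ℕ} {c : AutomatonCode PairCode}
    {z : List (Option (Letter n) × Option (Letter n))} :
    z ∈ pairLanguage n c ↔ c.acceptsState (c.run (z.map codePair)) = true :=
  c.mem_comap_accepts codePair z

theorem codeLetter_injective (n : ℕ) : Function.Injective (codeLetter (n := n)) := by
  rintro ⟨i, s⟩ ⟨j, t⟩ h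
  simp only [codeLetter, Prod.mk.injEq] at h
  exact Prod.ext (Fin.ext h.1) h.2

theorem codePair_injective (n : ℕ) : Function.Injective (codePair (n := n)) := by
  rintro ⟨a, b⟩ ⟨a', b'⟩ h
  simp only [codePair, Prod.mk.injEq] at h
  exact Prod.ext (Option.map_injective (codeLetter_injective n) h.1)
    (Option.map_injective (codeLetter_injective n) h.2)

theorem isRegular_wordLanguage (n : ℕ) (c : AutomatonCode LetterCode) :
    (wordLanguage n c).IsRegular :=
  ⟨_, inferInstance, _, rfl⟩

theorem isRegular_pairLanguage (n : ℕ) (c : AutomatonCode PairCode) :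
    (pairLanguage n c).IsRegular :=
  ⟨_, inferInstance, _, rfl⟩

/-! ### The letters as lists -/

/-- The codes of the letters `x_1^{±1}, …, x_n^{±1}`. -/
def letterCodes (n : ℕ) : List LetterCode :=
  (List.range n).flatMap fun i => [(i, true), (i, false)]

/-- The codes of the letters and the padding symbol. -/
def optionCodes (n : ℕ) : List (Option LetterCode) :=
  none :: (letterCodes n).map some

/-- The codes of the letters of the padded pair alphabet. -/
def pairCodes (n : ℕ) : List PairCode :=
  (optionCodes n).flatMap fun a => (optionCodes n).map fun b => (a, b)

theorem mem_letterCodes {n : ℕ} {c : LetterCode} :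
    c ∈ letterCodes n ↔ ∃ a : Letter n, codeLetter a = c := by
  obtain ⟨i, s⟩ := c
  simp only [letterCodes, List.mem_flatMap, List.mem_range, codeLetter]
  constructor
  · rintro ⟨j, hj, h⟩
    have : i = j := by
      simp only [List.mem_cons, Prod.mk.injEq, List.not_mem_nil, or_false] at h
      omega
    subst this
    exact ⟨(⟨i, hj⟩, s), rfl⟩
  · rintro ⟨⟨j, t⟩, h⟩
    simp only [Prod.mk.injEq] at h
    exact ⟨i, h.1 ▸ j.isLt, by cases s <;> simp⟩

theorem mem_optionCodes {n : ℕ} {c : Option LetterCode} :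
    c ∈ optionCodes n ↔ ∃ a : Option (Letter n), a.map codeLetter = c := by
  cases c with
  | none => simp [optionCodes]
  | some c =>
    simp only [optionCodes, List.mem_cons, reduceCtorEq, List.mem_map, Option.some.injEq,
      exists_eq_right, false_or, mem_letterCodes]
    constructor
    · rintro ⟨a, rfl⟩
      exact ⟨some a, rfl⟩
    · rintro ⟨_ | a, h⟩
      · simp at h
      · exact ⟨a, by simpa using h⟩

theorem mem_pairCodes {n : ℕ} {c : PairCode} :
    c ∈ pairCodes n ↔ ∃ a, codePair (n := n) a = c := by
  obtain ⟨c, d⟩ := c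
  simp only [pairCodes, List.mem_flatMap, List.mem_map, mem_optionCodes, codePair]
  constructor
  · rintro ⟨_, ⟨a, rfl⟩, _, ⟨b, rfl⟩, h⟩
    exact ⟨(a, b), by simpa using h⟩
  · rintro ⟨⟨a, b⟩, h⟩
    simp only [Prod.mk.injEq] at h
    exact ⟨_, ⟨a, rfl⟩, _, ⟨b, rfl⟩, by simp [h]⟩

/-- A list of codes from a given list comes from a list of coded objects. -/
theorem forall_mem_iff_exists_map {α β : Type*} {f : β → α} {l : List α}
    (hl : ∀ c, c ∈ l ↔ ∃ a, f a = c) {z : List α} :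
    (∀ c ∈ z, c ∈ l) ↔ ∃ w : List β, w.map f = z := by
  constructor
  · intro h
    induction z with
    | nil => exact ⟨[], rfl⟩
    | cons c z ih =>
      obtain ⟨a, ha⟩ := (hl c).1 (h c (by simp))
      obtain ⟨w, hw⟩ := ih fun d hd => h d (by simp [hd])
      exact ⟨a :: w, by simp [ha, hw]⟩
  · rintro ⟨w, rfl⟩ c hc
    obtain ⟨a, -, rfl⟩ := List.mem_map.1 hc
    exact (hl _).2 ⟨a, rfl⟩

theorem primrec_letterCodes : Primrec letterCodes := by
  refine Primrec.list_flatMap Primrec.list_range (Primrec.list_cons.comp₂ ?_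
    (Primrec.list_cons.comp₂ ?_ (Primrec.const []).to₂))
  · exact (Primrec.snd.pair (Primrec.const true)).to₂
  · exact (Primrec.snd.pair (Primrec.const false)).to₂

theorem primrec_optionCodes : Primrec optionCodes :=
  Primrec.list_cons.comp (Primrec.const none)
    (Primrec.list_map primrec_letterCodes (Primrec.option_some.comp Primrec.snd).to₂)

theorem primrec_pairCodes : Primrec pairCodes := by
  have h : Primrec fun x : ℕ × Option LetterCode =>
      (optionCodes x.1).map fun b => (x.2, b) :=
    Primrec.list_map (primrec_optionCodes.comp Primrec.fst)
      ((Primrec.snd.comp Primrec.fst).pair Primrec.snd).to₂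
  exact Primrec.list_flatMap primrec_optionCodes h.to₂

/-! ### The membership problem for a finitely generated subgroup -/

/-- `InsertionMove T V u w`: the word `w` arises from `u` by inserting a word of `T` anywhere or a
word of `V` at the end. -/
def InsertionMove {α : Type*} (T V : Set (List α)) (u w : List α) : Prop :=
  ∃ x r y, u = x ++ y ∧ w = x ++ r ++ y ∧ (r ∈ T ∨ (y = [] ∧ r ∈ V))

/-- Two words are linked if they are joined by a chain of insertions and deletions of words of `T`
anywhere and of words of `V` at the end. -/
def Linked {α : Type*} (T V : Set (List α)) : List α → List α → Prop :=
  Relation.ReflTransGen fun u w => InsertionMove T V u w ∨ InsertionMove T V w u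

namespace Linked

variable {α : Type*} {T V : Set (List α)}

theorem refl (u : List α) : Linked T V u u := Relation.ReflTransGen.refl

theorem trans {u v w : List α} (h : Linked T V u v) (h' : Linked T V v w) : Linked T V u w :=
  Relation.ReflTransGen.trans h h'

theorem symm {u v : List α} (h : Linked T V u v) : Linked T V v u := by
  induction h with
  | refl => exact refl _
  | tail _ hs ih => exact .head hs.symm ih

theorem lift {β : Type*} {T' V' : Set (List β)} (f : List α → List β)
    (hf : ∀ u w, InsertionMove T V u w → InsertionMove T' V' (f u) (f w)) {u w : List α}
    (h : Linked T V u w) : Linked T' V' (f u) (f w) := by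
  induction h with
  | refl => exact refl _
  | tail _ hs ih => exact ih.tail (hs.imp (hf _ _) (hf _ _))

theorem insert {r : List α} (hr : r ∈ T) (x y : List α) :
    Linked T V (x ++ y) (x ++ r ++ y) :=
  .single (.inl ⟨x, r, y, rfl, rfl, .inl hr⟩)

theorem append_right_of_mem {r : List α} (hr : r ∈ V) (x : List α) : Linked T V x (x ++ r) :=
  .single (.inl ⟨x, r, [], by simp, by simp, .inr ⟨rfl, hr⟩⟩)

theorem context {u w : List α} (h : Linked T ∅ u w) (x y : List α) :
    Linked T ∅ (x ++ u ++ y) (x ++ w ++ y) := by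
  have key : ∀ u w, InsertionMove T ∅ u w → InsertionMove T ∅ (x ++ u ++ y) (x ++ w ++ y) := by
    rintro _ _ ⟨a, r, b, rfl, rfl, hr⟩
    refine ⟨x ++ a, r, b ++ y, by simp, by simp, .inl ?_⟩
    simpa using hr
  exact h.lift (fun v => x ++ v ++ y) key

theorem append {u u' w w' : List α} (h : Linked T ∅ u u') (h' : Linked T ∅ w w') :
    Linked T ∅ (u ++ w) (u' ++ w') := by
  have h1 := h.context [] w
  have h2 := h'.context u' []
  simp only [List.nil_append, List.append_nil] at h1 h2
  exact h1.trans h2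

theorem mono {u w : List α} (h : Linked T ∅ u w) : Linked T V u w := by
  have key : ∀ u w, InsertionMove T ∅ u w → InsertionMove T V u w := by
    rintro _ _ ⟨a, r, b, rfl, rfl, hr⟩
    exact ⟨a, r, b, rfl, rfl, .inl (by simpa using hr)⟩
  exact h.lift id key

theorem map_iff {β : Type*} {f : α → β} (hf : Function.Injective f) {u w : List α} :
    Linked (List.map f '' T) (List.map f '' V) (u.map f) (w.map f) ↔ Linked T V u w := by
  have hmap : Function.Injective (List.map f) := List.map_injective_iff.2 hf
  have down : ∀ u z, InsertionMove (List.map f '' T) (List.map f '' V) (u.map f) z →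
      ∃ w, w.map f = z ∧ InsertionMove T V u w := by
    rintro u _ ⟨x, r, y, hu, rfl, hr⟩
    obtain ⟨x, y, rfl, rfl, rfl⟩ := List.map_eq_append_iff.1 hu
    rcases hr with ⟨r, hr, rfl⟩ | ⟨hy, r, hr, rfl⟩
    · exact ⟨x ++ r ++ y, by simp, x, r, y, rfl, rfl, .inl hr⟩
    · exact ⟨x ++ r ++ y, by simp, x, r, y, rfl, rfl, .inr ⟨by simpa using hy, hr⟩⟩
  have up : ∀ u z, InsertionMove (List.map f '' T) (List.map f '' V) z (u.map f) →
      ∃ w, w.map f = z ∧ InsertionMove T V w u := by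
    rintro u _ ⟨x, r, y, rfl, hu, hr⟩
    obtain ⟨x, y, rfl, h, rfl⟩ := List.map_eq_append_iff.1 hu
    obtain ⟨x, s, rfl, rfl, rfl⟩ := List.map_eq_append_iff.1 h
    rcases hr with ⟨r, hr, e⟩ | ⟨hy, r, hr, e⟩
    · exact ⟨x ++ y, by simp, x, s, y, rfl, rfl, .inl (hmap e ▸ hr)⟩
    · exact ⟨x ++ y, by simp, x, s, y, rfl, rfl, .inr ⟨by simpa using hy, hmap e ▸ hr⟩⟩
  constructor
  · intro h
    suffices ∀ z, Linked (List.map f '' T) (List.map f '' V) (u.map f) z →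
        ∃ w, w.map f = z ∧ Linked T V u w by
      obtain ⟨w', hw', h'⟩ := this _ h
      rwa [← hmap hw']
    intro z hz
    induction hz with
    | refl => exact ⟨u, rfl, refl u⟩
    | tail _ hstep ih =>
      obtain ⟨v, rfl, hv⟩ := ih
      rcases hstep with hs | hs
      · obtain ⟨w, rfl, hw⟩ := down _ _ hs
        exact ⟨w, rfl, hv.tail (.inl hw)⟩
      · obtain ⟨w, rfl, hw⟩ := up _ _ hs
        exact ⟨w, rfl, hv.tail (.inr hw)⟩
  · intro h
    have key : ∀ u w, InsertionMove T V u w →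
        InsertionMove (List.map f '' T) (List.map f '' V) (u.map f) (w.map f) := by
      rintro _ _ ⟨a, r, b, rfl, rfl, hr⟩
      refine ⟨a.map f, r.map f, b.map f, by simp, by simp, ?_⟩
      rcases hr with hr | ⟨rfl, hr⟩
      · exact .inl ⟨r, hr, rfl⟩
      · exact .inr ⟨rfl, r, hr, rfl⟩
    exact h.lift _ key

end Linked

section WordVal

variable {α G : Type*} [Group G] (val : α → G)

@[simp] theorem wordVal_nil : wordVal val [] = 1 := rfl

@[simp] theorem wordVal_cons (a : α) (w : List α) :
    wordVal val (a :: w) = val a * wordVal val w := by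
  simp [wordVal]

@[simp] theorem wordVal_append (u w : List α) :
    wordVal val (u ++ w) = wordVal val u * wordVal val w := by
  simp [wordVal]

end WordVal

section Presentation

variable {n : ℕ} {R V : List (List (Letter n))}

/-- The relators together with the words `x x⁻¹`. -/
def relatorWords (n : ℕ) (R : List (List (Letter n))) : Set (List (Letter n)) :=
  {r | r ∈ R ∨ ∃ a : Letter n, r = [a, (a.1, !a.2)]}

theorem letterVal_not (a : Letter n) : letterVal n R (a.1, !a.2) = (letterVal n R a)⁻¹ := by
  obtain ⟨i, _ | _⟩ := a <;> simp [letterVal]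

theorem wordVal_eq_mk (w : List (Letter n)) :
    wordVal (letterVal n R) w = PresentedGroup.mk _ (FreeGroup.mk w) := by
  induction w with
  | nil => simp [← FreeGroup.one_eq_mk]
  | cons a w ih =>
    rw [wordVal_cons, ih, show a :: w = [a] ++ w from rfl, ← FreeGroup.mul_mk, map_mul]
    congr 1
    obtain ⟨i, _ | _⟩ := a
    · rw [show (FreeGroup.mk [(i, false)]) = (FreeGroup.of i)⁻¹ from rfl, map_inv]
      rfl
    · rfl

theorem wordVal_invRev (w : List (Letter n)) :
    wordVal (letterVal n R) (FreeGroup.invRev w) = (wordVal (letterVal n R) w)⁻¹ := by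
  rw [wordVal_eq_mk, wordVal_eq_mk, ← map_inv, FreeGroup.inv_mk]

theorem wordVal_surjective (g : PresGroup n R) : ∃ w, wordVal (letterVal n R) w = g := by
  obtain ⟨x, rfl⟩ := PresentedGroup.mk_surjective _ g
  exact ⟨x.toWord, by rw [wordVal_eq_mk, FreeGroup.mk_toWord]⟩

theorem wordVal_relator {r : List (Letter n)} (hr : r ∈ relatorWords n R) :
    wordVal (letterVal n R) r = 1 := by
  rcases hr with hr | ⟨a, rfl⟩
  · rw [wordVal_eq_mk]
    exact PresentedGroup.mk_eq_one_iff.2 (Subgroup.subset_normalClosure ⟨r, hr, rfl⟩)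
  · simp [letterVal_not]

theorem linked_invRev_append (w : List (Letter n)) :
    Linked (relatorWords n R) ∅ (FreeGroup.invRev w ++ w) [] := by
  induction w with
  | nil => exact Linked.refl _
  | cons a w ih =>
    have h := Linked.insert (T := relatorWords n R) (V := ∅) (r := [(a.1, !a.2), a])
      (.inr ⟨(a.1, !a.2), by simp⟩) (FreeGroup.invRev w) w
    have e : FreeGroup.invRev (a :: w) ++ a :: w =
        FreeGroup.invRev w ++ [(a.1, !a.2), a] ++ w := by
      simp [FreeGroup.invRev]
    rw [e]
    exact h.symm.trans ih

theorem linked_append_invRev (w : List (Letter n)) :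
    Linked (relatorWords n R) ∅ (w ++ FreeGroup.invRev w) [] := by
  have h := linked_invRev_append (R := R) (FreeGroup.invRev w)
  rwa [FreeGroup.invRev_invRev] at h

theorem linked_of_mk_eq {u w : List (Letter n)} (h : FreeGroup.mk u = FreeGroup.mk w) :
    Linked (relatorWords n R) ∅ u w := by
  have key : ∀ u w : List (Letter n), FreeGroup.Red u w → Linked (relatorWords n R) ∅ u w := by
    intro u w hr
    induction hr with
    | refl => exact Linked.refl _
    | tail _ hs ih =>
    refine ih.tail ?_
    obtain @⟨x, y, i, b⟩ := hs
    exact .inr ⟨x, [(i, b), (i, !b)], y, rfl, by simp, .inl (.inr ⟨(i, b), rfl⟩)⟩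
  obtain ⟨v, hu, hw⟩ := FreeGroup.Red.exact.1 h
  exact (key _ _ hu).trans (key _ _ hw).symm

theorem linked_nil_of_mem_normalClosure {x : FreeGroup (Fin n)}
    (hx : x ∈ Subgroup.normalClosure {r : FreeGroup (Fin n) | ∃ w ∈ R, r = FreeGroup.mk w})
    {w : List (Letter n)} (hw : FreeGroup.mk w = x) : Linked (relatorWords n R) ∅ w [] := by
  let N : Subgroup (FreeGroup (Fin n)) :=
    { carrier := {g | ∀ w : List (Letter n), FreeGroup.mk w = g →
        Linked (relatorWords n R) ∅ w []}
      one_mem' := fun w hw => linked_of_mk_eq (by rw [hw, FreeGroup.one_eq_mk])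
      mul_mem' := by
        intro g h hg hh w hw
        have e : FreeGroup.mk w = FreeGroup.mk (g.toWord ++ h.toWord) := by
          rw [hw, ← FreeGroup.mul_mk, FreeGroup.mk_toWord, FreeGroup.mk_toWord]
        exact (linked_of_mk_eq e).trans
          ((hg _ FreeGroup.mk_toWord).append (hh _ FreeGroup.mk_toWord))
      inv_mem' := by
        intro g hg w hw
        have h1 := hg (FreeGroup.invRev w) (by rw [← FreeGroup.inv_mk, hw, inv_inv])
        exact (h1.symm.append (Linked.refl w)).trans (linked_invRev_append w) }
  have hN : N.Normal := by
    refine ⟨fun g hg c w hw => ?_⟩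
    have e : FreeGroup.mk w =
        FreeGroup.mk (c.toWord ++ g.toWord ++ FreeGroup.invRev c.toWord) := by
      rw [hw, ← FreeGroup.mul_mk, ← FreeGroup.mul_mk, ← FreeGroup.inv_mk, FreeGroup.mk_toWord,
        FreeGroup.mk_toWord]
    refine (linked_of_mk_eq e).trans (((hg _ FreeGroup.mk_toWord).context _ _).trans ?_)
    simpa using linked_append_invRev c.toWord
  have hle : Subgroup.normalClosure {r : FreeGroup (Fin n) | ∃ w ∈ R, r = FreeGroup.mk w} ≤ N := by
    refine Subgroup.normalClosure_le_normal ?_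
    rintro _ ⟨r, hr, rfl⟩ w hw
    exact (linked_of_mk_eq hw).trans (by simpa using (Linked.insert (.inl hr) [] []).symm)
  exact hle hx w hw

/-- Words with the same value are joined by insertions and deletions of relators and of words
`x x⁻¹`. -/
theorem linked_of_wordVal_eq {u w : List (Letter n)}
    (h : wordVal (letterVal n R) u = wordVal (letterVal n R) w) :
    Linked (relatorWords n R) ∅ u w := by
  have h1 : Linked (relatorWords n R) ∅ (u ++ FreeGroup.invRev w) [] := by
    refine linked_nil_of_mem_normalClosure ?_ rfl
    apply PresentedGroup.mk_eq_one_iff.1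
    rw [← wordVal_eq_mk, wordVal_append, wordVal_invRev, h, mul_inv_cancel]
  have h2 := ((Linked.refl u).append (linked_invRev_append (R := R) w)).symm
  simp only [List.append_nil, ← List.append_assoc] at h2
  exact h2.trans (by simpa using h1.append (Linked.refl w))

theorem linked_iff {u w : List (Letter n)} :
    Linked (relatorWords n R) {v | v ∈ V} u w ↔
      (wordVal (letterVal n R) u)⁻¹ * wordVal (letterVal n R) w ∈ genSubgroup n R V := by
  constructor
  · intro h
    induction h with
    | refl => simp [one_mem]
    | @tail v w _ hstep ih =>
      have key : ∀ v w, InsertionMove (relatorWords n R) {v | v ∈ V} v w →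
          (wordVal (letterVal n R) v)⁻¹ * wordVal (letterVal n R) w ∈ genSubgroup n R V := by
        rintro _ _ ⟨x, r, y, rfl, rfl, hr | ⟨rfl, hr⟩⟩
        · simp [wordVal_relator hr, one_mem]
        · have h : wordVal (letterVal n R) r ∈ genSubgroup n R V :=
            Subgroup.subset_closure ⟨r, hr, rfl⟩
          simpa using h
      have h2 : (wordVal (letterVal n R) v)⁻¹ * wordVal (letterVal n R) w ∈
          genSubgroup n R V := by
        rcases hstep with h | h
        · exact key _ _ h
        · simpa using inv_mem (key _ _ h)
      simpa [mul_assoc] using mul_mem ih h2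
  · suffices ∀ g ∈ genSubgroup n R V, ∀ u w, (wordVal (letterVal n R) u)⁻¹ *
        wordVal (letterVal n R) w = g → Linked (relatorWords n R) {v | v ∈ V} u w from
      fun h => this _ h u w rfl
    intro g hg
    induction hg using Subgroup.closure_induction with
    | mem g hg =>
      obtain ⟨v, hv, rfl⟩ := hg
      intro u w h
      refine (Linked.append_right_of_mem (show v ∈ {v | v ∈ V} from hv) u).trans
        (linked_of_wordVal_eq ?_).mono
      rw [wordVal_append, ← h]
      group
    | one =>
      intro u w h
      exact (linked_of_wordVal_eq (inv_mul_eq_one.1 h)).mono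
    | mul g h _ _ ihg ihh =>
      intro u w e
      obtain ⟨v, hv⟩ := wordVal_surjective (wordVal (letterVal n R) u * g)
      refine (ihg u v (by rw [hv]; group)).trans (ihh v w ?_)
      rw [hv, mul_inv_rev, mul_assoc, e]
      group
    | inv g _ ih =>
      intro u w e
      exact (ih w u (by rw [← inv_inj, ← e]; group)).symm

end Presentation

/-- A certificate for the reachability of a state is a list of successive states. -/
theorem SemiDec.reflTransGen {α σ : Type*} [Primcodable α] [Primcodable σ]
    {p : α × σ × σ → Prop} (hp : SemiDec p) :
    SemiDec fun x : α × σ × σ =>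
      Relation.ReflTransGen (fun s t => p (x.1, s, t)) x.2.1 x.2.2 := by
  have key : SemiDec fun x : α × σ × σ => ∃ lk : List σ × ℕ,
      (lk.1[0]? = some x.2.1 ∧ lk.1[lk.2]? = some x.2.2) ∧ ∀ i ∈ List.range lk.2,
        ∃ st : σ × σ, (lk.1[i]? = some st.1 ∧ lk.1[i + 1]? = some st.2) ∧ p (x.1, st) := by
    refine SemiDec.ex (p := fun y : (α × σ × σ) × List σ × ℕ =>
      (y.2.1[0]? = some y.1.2.1 ∧ y.2.1[y.2.2]? = some y.1.2.2) ∧ ∀ i ∈ List.range y.2.2,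
        ∃ st : σ × σ, (y.2.1[i]? = some st.1 ∧ y.2.1[i + 1]? = some st.2) ∧ p (y.1.1, st)) ?_
    have hl : Primrec fun y : (α × σ × σ) × List σ × ℕ => y.2.1 := Primrec.fst.comp Primrec.snd
    refine SemiDec.and (of_primrecPred (PrimrecPred.and ?_ ?_)) ?_
    · exact Primrec.eq.comp (Primrec.list_getElem?.comp hl (Primrec.const 0))
        (Primrec.option_some.comp (Primrec.fst.comp (Primrec.snd.comp Primrec.fst)))
    · exact Primrec.eq.comp (Primrec.list_getElem?.comp hl (Primrec.snd.comp Primrec.snd))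
        (Primrec.option_some.comp (Primrec.snd.comp (Primrec.snd.comp Primrec.fst)))
    · refine SemiDec.ball (p := fun y : ((α × σ × σ) × List σ × ℕ) × ℕ =>
        ∃ st : σ × σ, (y.1.2.1[y.2]? = some st.1 ∧ y.1.2.1[y.2 + 1]? = some st.2) ∧
          p (y.1.1.1, st)) ?_ (Primrec.list_range.comp (Primrec.snd.comp Primrec.snd))
      refine SemiDec.ex (p := fun y : (((α × σ × σ) × List σ × ℕ) × ℕ) × σ × σ =>
        (y.1.1.2.1[y.1.2]? = some y.2.1 ∧ y.1.1.2.1[y.1.2 + 1]? = some y.2.2) ∧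
          p (y.1.1.1.1, y.2)) ?_
      have hl' : Primrec fun y : (((α × σ × σ) × List σ × ℕ) × ℕ) × σ × σ => y.1.1.2.1 :=
        hl.comp (Primrec.fst.comp Primrec.fst)
      have hi : Primrec fun y : (((α × σ × σ) × List σ × ℕ) × ℕ) × σ × σ => y.1.2 :=
        Primrec.snd.comp Primrec.fst
      refine SemiDec.and (of_primrecPred (PrimrecPred.and ?_ ?_)) ?_
      · exact Primrec.eq.comp (Primrec.list_getElem?.comp hl' hi)
          (Primrec.option_some.comp (Primrec.fst.comp Primrec.snd))
      · exact Primrec.eq.comp (Primrec.list_getElem?.comp hl' (Primrec.succ.comp hi))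
          (Primrec.option_some.comp (Primrec.snd.comp Primrec.snd))
      · exact hp.comp ((Primrec.fst.comp (Primrec.fst.comp (Primrec.fst.comp Primrec.fst))).pair
          Primrec.snd)
  refine key.of_iff fun x => ⟨fun h => ?_, ?_⟩
  · obtain ⟨a, s, t⟩ := x
    simp only at h ⊢
    induction h with
    | refl => exact ⟨([s], 0), by simp⟩
    | @tail t u _ hp ih =>
      obtain ⟨⟨l, k⟩, ⟨h0, hk⟩, hl⟩ := ih
      simp only at h0 hk hl
      have hlen : k < l.length := (List.getElem?_eq_some_iff.1 hk).1
      have ht : (l.take (k + 1)).length = k + 1 := by simp; omega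
      refine ⟨(l.take (k + 1) ++ [u], k + 1), ⟨?_, ?_⟩, fun i hi => ?_⟩
      · simp only
        rw [List.getElem?_append_left (by omega)]
        simpa using h0
      · simp only
        rw [List.getElem?_append_right (by omega)]
        simp [ht]
      · rw [List.mem_range] at hi
        simp only at hi ⊢
        rcases Nat.lt_succ_iff_lt_or_eq.1 hi with hi' | rfl
        · obtain ⟨st, ⟨e1, e2⟩, hst⟩ := hl i (List.mem_range.2 hi')
          refine ⟨st, ⟨?_, ?_⟩, hst⟩
          · rw [List.getElem?_append_left (by omega), List.getElem?_take_of_lt (by omega), e1]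
          · rw [List.getElem?_append_left (by omega), List.getElem?_take_of_lt (by omega), e2]
        · refine ⟨(t, u), ⟨?_, ?_⟩, hp⟩
          · rw [List.getElem?_append_left (by omega), List.getElem?_take_of_lt (by omega), hk]
          · rw [List.getElem?_append_right (by omega)]
            simp [ht]
  · rintro ⟨⟨l, k⟩, ⟨h0, hk⟩, hl⟩
    simp only at h0 hk hl
    have : ∀ j ≤ k, ∀ t, l[j]? = some t →
        Relation.ReflTransGen (fun s t => p (x.1, s, t)) x.2.1 t := by
      intro j
      induction j with
      | zero =>
        intro _ t ht
        rw [h0, Option.some.injEq] at ht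
        exact ht ▸ .refl
      | succ j ih =>
        intro hj t ht
        obtain ⟨⟨s, t'⟩, ⟨e1, e2⟩, hst⟩ := hl j (List.mem_range.2 hj)
        simp only at e1 e2
        rw [e2, Option.some.injEq] at ht
        subst ht
        exact (ih (by omega) s e1).tail hst
    exact this k le_rfl _ hk

/-- The codes of the words `x x⁻¹` and of the relators. -/
def relatorCodes (n : ℕ) (R : List (List LetterCode)) : Set (List LetterCode) :=
  {r | r ∈ R ∨ ∃ c ∈ letterCodes n, r = [c, (c.1, !c.2)]}

/-- The subgroup membership problem on the level of codes. -/
def MemCode (x : AlgInput × List LetterCode) : Prop :=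
  Linked (relatorCodes x.1.1 x.1.2.1) {v | v ∈ x.1.2.2} [] x.2

theorem primrec_codeInv : Primrec fun c : LetterCode => (c.1, !c.2) :=
  Primrec.fst.pair (Primrec.not.comp Primrec.snd)

theorem primrec_invRev : Primrec (FreeGroup.invRev : List LetterCode → List LetterCode) :=
  Primrec.list_reverse.comp (Primrec.list_map Primrec.id (primrec_codeInv.comp Primrec.snd).to₂)

theorem semiDec_memCode : SemiDec MemCode := by
  have hrel : SemiDec fun y : AlgInput × List LetterCode =>
      y.2 ∈ relatorCodes y.1.1 y.1.2.1 := by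
    refine SemiDec.or ?_ ?_
    · refine SemiDec.of_iff (SemiDec.bex
        (p := fun z : (AlgInput × List LetterCode) × List LetterCode => z.1.2 = z.2)
        (l := fun y => y.1.2.1) ?_ ?_) fun y => ?_
      · exact SemiDec.of_primrecPred (Primrec.eq.comp (Primrec.snd.comp Primrec.fst) Primrec.snd)
      · exact Primrec.fst.comp (Primrec.snd.comp Primrec.fst)
      · simp
    · refine SemiDec.bex (p := fun z : (AlgInput × List LetterCode) × LetterCode =>
        z.1.2 = [z.2, (z.2.1, !z.2.2)]) (l := fun y => letterCodes y.1.1) ?_ ?_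
      · exact SemiDec.of_primrecPred (Primrec.eq.comp (Primrec.snd.comp Primrec.fst)
          (Primrec.list_cons.comp Primrec.snd (Primrec.list_cons.comp
            (primrec_codeInv.comp Primrec.snd) (Primrec.const []))))
      · exact primrec_letterCodes.comp (Primrec.fst.comp Primrec.fst)
  have hmem : SemiDec fun y : AlgInput × List LetterCode => y.2 ∈ y.1.2.2 := by
    refine SemiDec.of_iff (SemiDec.bex
      (p := fun z : (AlgInput × List LetterCode) × List LetterCode => z.1.2 = z.2)
      (l := fun y => y.1.2.2) ?_ ?_) fun y => ?_
    · exact SemiDec.of_primrecPred (Primrec.eq.comp (Primrec.snd.comp Primrec.fst) Primrec.snd)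
    · exact Primrec.snd.comp (Primrec.snd.comp Primrec.fst)
    · simp
  have hmove : SemiDec fun y : AlgInput × List LetterCode × List LetterCode =>
      InsertionMove (relatorCodes y.1.1 y.1.2.1) {v | v ∈ y.1.2.2} y.2.1 y.2.2 := by
    have : SemiDec fun y : AlgInput × List LetterCode × List LetterCode =>
        ∃ t : List LetterCode × List LetterCode × List LetterCode,
          (y.2.1 = t.1 ++ t.2.2 ∧ y.2.2 = t.1 ++ t.2.1 ++ t.2.2) ∧
          (t.2.1 ∈ relatorCodes y.1.1 y.1.2.1 ∨ (t.2.2 = [] ∧ t.2.1 ∈ y.1.2.2)) := by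
      refine SemiDec.ex (p := fun z : (AlgInput × List LetterCode × List LetterCode) ×
        (List LetterCode × List LetterCode × List LetterCode) =>
          (z.1.2.1 = z.2.1 ++ z.2.2.2 ∧ z.1.2.2 = z.2.1 ++ z.2.2.1 ++ z.2.2.2) ∧
          (z.2.2.1 ∈ relatorCodes z.1.1.1 z.1.1.2.1 ∨ (z.2.2.2 = [] ∧ z.2.2.1 ∈ z.1.1.2.2))) ?_
      have hx : Primrec fun z : (AlgInput × List LetterCode × List LetterCode) ×
        (List LetterCode × List LetterCode × List LetterCode) => z.2.1 :=
        Primrec.fst.comp Primrec.snd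
      have hr : Primrec fun z : (AlgInput × List LetterCode × List LetterCode) ×
        (List LetterCode × List LetterCode × List LetterCode) => z.2.2.1 :=
        Primrec.fst.comp (Primrec.snd.comp Primrec.snd)
      have hy : Primrec fun z : (AlgInput × List LetterCode × List LetterCode) ×
        (List LetterCode × List LetterCode × List LetterCode) => z.2.2.2 :=
        Primrec.snd.comp (Primrec.snd.comp Primrec.snd)
      refine SemiDec.and (SemiDec.of_primrecPred (PrimrecPred.and ?_ ?_)) (SemiDec.or ?_ ?_)
      · exact Primrec.eq.comp (Primrec.fst.comp (Primrec.snd.comp Primrec.fst))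
          (Primrec.list_append.comp hx hy)
      · exact Primrec.eq.comp (Primrec.snd.comp (Primrec.snd.comp Primrec.fst))
          (Primrec.list_append.comp (Primrec.list_append.comp hx hr) hy)
      · exact hrel.comp ((Primrec.fst.comp Primrec.fst).pair hr)
      · exact (SemiDec.of_primrecPred (Primrec.eq.comp hy (Primrec.const []))).and
          (hmem.comp ((Primrec.fst.comp Primrec.fst).pair hr))
    refine this.of_iff fun y => ⟨?_, ?_⟩
    · rintro ⟨x, r, z, h1, h2, h3⟩
      exact ⟨(x, r, z), ⟨h1, h2⟩, h3⟩
    · rintro ⟨t, ⟨h1, h2⟩, h3⟩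
      exact ⟨_, _, _, h1, h2, h3⟩
  have hstep : SemiDec fun y : AlgInput × List LetterCode × List LetterCode =>
      InsertionMove (relatorCodes y.1.1 y.1.2.1) {v | v ∈ y.1.2.2} y.2.1 y.2.2 ∨
      InsertionMove (relatorCodes y.1.1 y.1.2.1) {v | v ∈ y.1.2.2} y.2.2 y.2.1 :=
    hmove.or (hmove.comp (Primrec.fst.pair
      ((Primrec.snd.comp Primrec.snd).pair (Primrec.fst.comp Primrec.snd))))
  exact hstep.reflTransGen.comp (Primrec.fst.pair ((Primrec.const []).pair Primrec.snd))

section CodeVal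

variable {n : ℕ} {R V : List (List (Letter n))}

/-- The element that the code of a letter stands for; codes of no letter stand for `1`. -/
def codeVal (n : ℕ) (R : List (List (Letter n))) (c : LetterCode) : PresGroup n R :=
  if h : c.1 < n then letterVal n R (⟨c.1, h⟩, c.2) else 1

@[simp] theorem codeVal_codeLetter (a : Letter n) :
    codeVal n R (codeLetter a) = letterVal n R a := by
  simp [codeVal, codeLetter]

@[simp] theorem wordVal_map_codeLetter (w : List (Letter n)) :
    wordVal (codeVal n R) (w.map codeLetter) = wordVal (letterVal n R) w := by
  induction w with
  | nil => rfl
  | cons a w ih => simp [ih]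

@[simp] theorem wordVal_codeVal_invRev (w : List LetterCode) :
    wordVal (codeVal n R) (FreeGroup.invRev w) = (wordVal (codeVal n R) w)⁻¹ := by
  have h1 : ∀ c : LetterCode, codeVal n R (c.1, !c.2) = (codeVal n R c)⁻¹ := by
    intro c
    unfold codeVal
    split_ifs with h
    · exact letterVal_not (R := R) (⟨c.1, h⟩, c.2)
    · simp
  induction w with
  | nil => simp
  | cons c w ih =>
    rw [show FreeGroup.invRev (c :: w) = FreeGroup.invRev w ++ [(c.1, !c.2)] by
      simp [FreeGroup.invRev]]
    simp [ih, h1]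

theorem image_relatorWords :
    List.map codeLetter '' relatorWords n R = relatorCodes n (R.map (List.map codeLetter)) := by
  ext r
  simp only [relatorWords, relatorCodes, Set.mem_image, Set.mem_ofPred_eq, List.mem_map]
  constructor
  · rintro ⟨r, hr | ⟨a, rfl⟩, rfl⟩
    · exact .inl ⟨r, hr, rfl⟩
    · exact .inr ⟨codeLetter a, mem_letterCodes.2 ⟨a, rfl⟩, rfl⟩
  · rintro (⟨r, hr, rfl⟩ | ⟨c, hc, rfl⟩)
    · exact ⟨r, .inl hr, rfl⟩
    · obtain ⟨a, rfl⟩ := mem_letterCodes.1 hc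
      exact ⟨_, .inr ⟨a, rfl⟩, rfl⟩

theorem memCode_iff {w : List (Letter n)} :
    MemCode (codeInput n R V, w.map codeLetter) ↔
      wordVal (letterVal n R) w ∈ genSubgroup n R V := by
  have h := Linked.map_iff (T := relatorWords n R) (V := {v | v ∈ V}) (codeLetter_injective n)
    (u := []) (w := w)
  rw [image_relatorWords, linked_iff] at h
  simp only [wordVal_nil, inv_one, one_mul] at h
  rw [← h]
  have e : List.map codeLetter '' {v | v ∈ V} = {v | v ∈ V.map (List.map codeLetter)} := by
    ext; simp
  rw [e]
  rfl

theorem exists_map_eq_of_memCode {z : List LetterCode} (h : MemCode (codeInput n R V, z)) :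
    ∃ w : List (Letter n), w.map codeLetter = z := by
  have hT : ∀ r ∈ relatorCodes n (R.map (List.map codeLetter)),
      ∃ w : List (Letter n), w.map codeLetter = r := by
    intro r hr
    rw [← image_relatorWords] at hr
    exact ⟨hr.choose, hr.choose_spec.2⟩
  have hV : ∀ r ∈ V.map (List.map codeLetter), ∃ w : List (Letter n), w.map codeLetter = r := by
    intro r hr
    obtain ⟨w, -, rfl⟩ := List.mem_map.1 hr
    exact ⟨w, rfl⟩
  change Linked _ _ [] z at h
  induction h with
  | refl => exact ⟨[], rfl⟩
  | tail _ hs ih =>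
    obtain ⟨w, hw⟩ := ih
    rcases hs with ⟨x, r, y, rfl, rfl, hr⟩ | ⟨x, r, y, rfl, rfl, hr⟩
    · obtain ⟨x, y, rfl, rfl, rfl⟩ := List.map_eq_append_iff.1 hw
      obtain ⟨r, rfl⟩ : ∃ w : List (Letter n), w.map codeLetter = r := by
        rcases hr with hr | ⟨-, hr⟩
        · exact hT _ hr
        · exact hV _ hr
      exact ⟨x ++ r ++ y, by simp⟩
    · obtain ⟨x, y, rfl, h, rfl⟩ := List.map_eq_append_iff.1 hw
      obtain ⟨x, r, rfl, rfl, rfl⟩ := List.map_eq_append_iff.1 h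
      exact ⟨x ++ y, by simp⟩

theorem mem_of_memCode {z : List LetterCode} (h : MemCode (codeInput n R V, z)) :
    wordVal (codeVal n R) z ∈ genSubgroup n R V := by
  obtain ⟨w, rfl⟩ := exists_map_eq_of_memCode h
  rw [wordVal_map_codeLetter]
  exact memCode_iff.1 h

theorem genSubgroup_nil : genSubgroup n R [] = ⊥ := by
  simp [genSubgroup]

end CodeVal

/-! ### Certifying that an automaton respects values in the group -/

section Labels

variable {γ : Type}

/-- A labelling of the states of the automaton `c`, whose letters `γ` are read as the pairs of words
`(l γ, r γ)`: a live state is labelled by a word `d` such that every word `z` leading to it satisfies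
`H · l(z)⁻¹ r(z) = H · d`, states labelled by `none` do not lead to acceptance, and the labels of
accept states satisfy `d x ∈ H`. -/
def IsLabelling [DecidableEq γ] (letters : ℕ → List γ) (l r : γ → List LetterCode)
    (I : AlgInput) (c : AutomatonCode γ) (x : List LetterCode)
    (C : List (ℕ × Option (List LetterCode))) : Prop :=
  (∃ s ∈ C, s.1 = c.startNat ∧ (s.2 = none ∨ ∃ d, s.2 = some d ∧ MemCode (I, d))) ∧
  ∀ s ∈ C, (c.acceptsState s.1 = false ∨ ∃ d, s.2 = some d ∧ MemCode (I, d ++ x)) ∧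
    ∀ a ∈ letters I.1, ∃ s' ∈ C, s'.1 = c.stepNat s.1 a ∧ (s'.2 = none ∨
      ∃ d : List LetterCode × List LetterCode, (s.2 = some d.1 ∧ s'.2 = some d.2) ∧
        MemCode (I, FreeGroup.invRev (l a) ++ d.1 ++ r a ++ FreeGroup.invRev d.2))

theorem semiDec_labelled_transition [Primcodable γ] {l r : γ → List LetterCode} (hl : Primrec l)
    (hr : Primrec r) :
    SemiDec fun z : AlgInput × γ × Option (List LetterCode) × Option (List LetterCode) =>
      z.2.2.2 = none ∨ ∃ d : List LetterCode × List LetterCode,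
        (z.2.2.1 = some d.1 ∧ z.2.2.2 = some d.2) ∧
        MemCode (z.1, FreeGroup.invRev (l z.2.1) ++ d.1 ++ r z.2.1 ++ FreeGroup.invRev d.2) := by
  have h2 : Primrec fun z : AlgInput × γ × Option (List LetterCode) × Option (List LetterCode) =>
      z.2.2.2 := Primrec.snd.comp (Primrec.snd.comp Primrec.snd)
  have h1 : Primrec fun z : AlgInput × γ × Option (List LetterCode) × Option (List LetterCode) =>
      z.2.2.1 := Primrec.fst.comp (Primrec.snd.comp Primrec.snd)
  refine SemiDec.or (SemiDec.of_primrecPred (Primrec.eq.comp h2 (Primrec.const none))) ?_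
  refine SemiDec.ex (p := fun y : (AlgInput × γ × Option (List LetterCode) ×
      Option (List LetterCode)) × List LetterCode × List LetterCode =>
    (y.1.2.2.1 = some y.2.1 ∧ y.1.2.2.2 = some y.2.2) ∧
      MemCode (y.1.1, FreeGroup.invRev (l y.1.2.1) ++ y.2.1 ++ r y.1.2.1 ++
        FreeGroup.invRev y.2.2)) (SemiDec.and (SemiDec.of_primrecPred (PrimrecPred.and ?_ ?_)) ?_)
  · exact Primrec.eq.comp (h1.comp Primrec.fst)
      (Primrec.option_some.comp (Primrec.fst.comp Primrec.snd))
  · exact Primrec.eq.comp (h2.comp Primrec.fst)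
      (Primrec.option_some.comp (Primrec.snd.comp Primrec.snd))
  · have ha : Primrec fun y : (AlgInput × γ × Option (List LetterCode) ×
        Option (List LetterCode)) × List LetterCode × List LetterCode => y.1.2.1 :=
      Primrec.fst.comp (Primrec.snd.comp Primrec.fst)
    refine semiDec_memCode.comp ((Primrec.fst.comp Primrec.fst).pair
      (Primrec.list_append.comp (Primrec.list_append.comp (Primrec.list_append.comp ?_ ?_) ?_) ?_))
    · exact primrec_invRev.comp (hl.comp ha)
    · exact Primrec.fst.comp Primrec.snd
    · exact hr.comp ha
    · exact primrec_invRev.comp (Primrec.snd.comp Primrec.snd)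

theorem semiDec_exists_memCode_append :
    SemiDec fun z : AlgInput × List LetterCode × Option (List LetterCode) =>
      ∃ d, z.2.2 = some d ∧ MemCode (z.1, d ++ z.2.1) := by
  refine SemiDec.ex (p := fun y : (AlgInput × List LetterCode × Option (List LetterCode)) ×
    List LetterCode => y.1.2.2 = some y.2 ∧ MemCode (y.1.1, y.2 ++ y.1.2.1))
    (SemiDec.and (SemiDec.of_primrecPred ?_) ?_)
  · exact Primrec.eq.comp (Primrec.snd.comp (Primrec.snd.comp Primrec.fst))
      (Primrec.option_some.comp Primrec.snd)
  · exact semiDec_memCode.comp ((Primrec.fst.comp Primrec.fst).pair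
      (Primrec.list_append.comp Primrec.snd (Primrec.fst.comp (Primrec.snd.comp Primrec.fst))))

theorem semiDec_exists_isLabelling [DecidableEq γ] [Primcodable γ]
    {letters : ℕ → List γ} {l r : γ → List LetterCode}
    (hletters : Primrec letters) (hl : Primrec l) (hr : Primrec r) :
    SemiDec fun y : AlgInput × AutomatonCode γ × List LetterCode =>
      ∃ C, IsLabelling letters l r y.1 y.2.1 y.2.2 C := by
  refine SemiDec.invariant
    (start := fun z : (AlgInput × AutomatonCode γ × List LetterCode) ×
        (ℕ × Option (List LetterCode)) => z.2.1 = z.1.2.1.startNat ∧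
          (z.2.2 = none ∨ ∃ d, z.2.2 = some d ∧ MemCode (z.1.1, d)))
    (ok := fun z => z.1.2.1.acceptsState z.2.1 = false ∨
          ∃ d, z.2.2 = some d ∧ MemCode (z.1.1, d ++ z.1.2.2))
    (trans := fun z : (AlgInput × AutomatonCode γ × List LetterCode) ×
        (ℕ × Option (List LetterCode)) × γ × (ℕ × Option (List LetterCode)) =>
        z.2.2.2.1 = z.1.2.1.stepNat z.2.1.1 z.2.2.1 ∧ (z.2.2.2.2 = none ∨
          ∃ d : List LetterCode × List LetterCode,
          (z.2.1.2 = some d.1 ∧ z.2.2.2.2 = some d.2) ∧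
          MemCode (z.1.1, FreeGroup.invRev (l z.2.2.1) ++ d.1 ++ r z.2.2.1 ++
            FreeGroup.invRev d.2)))
    (letters := fun y => letters y.1.1) ?_ ?_ ?_
    (hletters.comp (Primrec.fst.comp Primrec.fst))
  · refine SemiDec.and (SemiDec.of_primrecPred ?_) (SemiDec.or (SemiDec.of_primrecPred ?_) ?_)
    · exact Primrec.eq.comp (Primrec.fst.comp Primrec.snd) (AutomatonCode.primrec_startNat.comp
        (Primrec.fst.comp (Primrec.snd.comp Primrec.fst)))
    · exact Primrec.eq.comp (Primrec.snd.comp Primrec.snd) (Primrec.const none)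
    · refine (semiDec_exists_memCode_append.comp ((Primrec.fst.comp Primrec.fst).pair
        ((Primrec.const []).pair (Primrec.snd.comp Primrec.snd)))).of_iff fun z => ?_
      simp
  · refine SemiDec.or (SemiDec.of_primrecPred ?_) ?_
    · exact Primrec.eq.comp (AutomatonCode.primrec_acceptsState
        (Primrec.fst.comp (Primrec.snd.comp Primrec.fst)) (Primrec.fst.comp Primrec.snd))
        (Primrec.const false)
    · exact semiDec_exists_memCode_append.comp ((Primrec.fst.comp Primrec.fst).pair
        ((Primrec.snd.comp (Primrec.snd.comp Primrec.fst)).pair (Primrec.snd.comp Primrec.snd)))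
  · have ha : Primrec fun z : (AlgInput × AutomatonCode γ × List LetterCode) ×
        (ℕ × Option (List LetterCode)) × γ × (ℕ × Option (List LetterCode)) => z.2.2.1 :=
      Primrec.fst.comp (Primrec.snd.comp Primrec.snd)
    have hs : Primrec fun z : (AlgInput × AutomatonCode γ × List LetterCode) ×
        (ℕ × Option (List LetterCode)) × γ × (ℕ × Option (List LetterCode)) => z.2.1 :=
      Primrec.fst.comp Primrec.snd
    have ht : Primrec fun z : (AlgInput × AutomatonCode γ × List LetterCode) ×
        (ℕ × Option (List LetterCode)) × γ × (ℕ × Option (List LetterCode)) => z.2.2.2 :=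
      Primrec.snd.comp (Primrec.snd.comp Primrec.snd)
    have hc : Primrec fun z : (AlgInput × AutomatonCode γ × List LetterCode) ×
        (ℕ × Option (List LetterCode)) × γ × (ℕ × Option (List LetterCode)) => z.1.2.1 :=
      Primrec.fst.comp (Primrec.snd.comp Primrec.fst)
    refine SemiDec.and (SemiDec.of_primrecPred ?_) ?_
    · exact Primrec.eq.comp (Primrec.fst.comp ht)
        (AutomatonCode.primrec_stepNat hc (Primrec.fst.comp hs) ha)
    · exact (semiDec_labelled_transition hl hr).comp ((Primrec.fst.comp Primrec.fst).pair
        (ha.pair ((Primrec.snd.comp hs).pair (Primrec.snd.comp ht))))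

variable {n : ℕ} {R V : List (List (Letter n))}

/-- A labelling exists if and only if all accepted words `z` satisfy `l(z)⁻¹ r(z) x ∈ H`; here
conjugation by the words `l γ` has to preserve `H`. -/
theorem exists_isLabelling_iff [DecidableEq γ] {letters : ℕ → List γ} {l r : γ → List LetterCode}
    (hl : ∀ a ∈ letters n, ∀ c ∈ l a, c ∈ letterCodes n)
    (hr : ∀ a ∈ letters n, ∀ c ∈ r a, c ∈ letterCodes n)
    (hconj : ∀ a h, (wordVal (codeVal n R) (l a))⁻¹ * h * wordVal (codeVal n R) (l a) ∈
      genSubgroup n R V ↔ h ∈ genSubgroup n R V)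
    {c : AutomatonCode γ} {x : List LetterCode} (hx : ∀ c ∈ x, c ∈ letterCodes n) :
    (∃ C, IsLabelling letters l r (codeInput n R V) c x C) ↔
      ∀ z : List γ, (∀ a ∈ z, a ∈ letters n) → c.acceptsState (c.run z) = true →
        (wordVal (codeVal n R) (z.flatMap l))⁻¹ * wordVal (codeVal n R) (z.flatMap r) *
          wordVal (codeVal n R) x ∈ genSubgroup n R V := by
  set H := genSubgroup n R V
  set π := wordVal (codeVal n R) with hπ
  constructor
  · rintro ⟨C, ⟨s, hs, hs1, hs2⟩, hC⟩ z hz hacc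
    have inv : ∃ s ∈ C, s.1 = c.run z ∧
        ∀ d, s.2 = some d → (π (z.flatMap l))⁻¹ * π (z.flatMap r) * (π d)⁻¹ ∈ H := by
      clear hacc
      induction z using List.reverseRecOn with
      | nil =>
        refine ⟨s, hs, hs1, fun d hd => ?_⟩
        rcases hs2 with h | ⟨d', h, hd'⟩
        · simp [h] at hd
        · rw [h, Option.some.injEq] at hd
          subst hd
          simpa using mem_of_memCode hd'
      | append_singleton z a ih =>
        obtain ⟨t, ht, ht1, ht2⟩ := ih fun b hb => hz b (by simp [hb])
        obtain ⟨s', hs', e1, e2⟩ := (hC t ht).2 a (hz a (by simp))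
        refine ⟨s', hs', by rw [e1, ht1, AutomatonCode.run_append_singleton], fun d hd => ?_⟩
        rcases e2 with h | ⟨⟨d1, d2⟩, ⟨h1, h2⟩, h3⟩
        · simp [h] at hd
        · rw [h2, Option.some.injEq] at hd
          subst hd
          have h4 := mem_of_memCode h3
          have h5 := (hconj a _).2 (ht2 _ h1)
          simp only [wordVal_append, wordVal_codeVal_invRev] at h4
          have h6 := mul_mem h5 h4
          simp only [List.flatMap_append, List.flatMap_singleton, hπ, wordVal_append] at h6 ⊢
          convert h6 using 1
          group
    obtain ⟨s, hs, h1, h2⟩ := inv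
    rcases (hC s hs).1 with h | ⟨d, hd, h⟩
    · rw [h1, hacc] at h
      cases h
    · have h3 := mul_mem (h2 d hd) (mem_of_memCode h)
      simp only [wordVal_append] at h3
      convert h3 using 1
      simp only [hπ]
      group
  · intro hval
    have hconj' : ∀ (t : List γ) h, (π (t.flatMap l))⁻¹ * h * π (t.flatMap l) ∈ H ↔ h ∈ H := by
      intro t
      induction t with
      | nil => simp [hπ]
      | cons a t ih =>
        intro h
        refine Iff.trans ?_ ((ih _).trans (hconj a h))
        simp only [List.flatMap_cons, hπ, wordVal_append, mul_inv_rev, mul_assoc]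
    -- A tail leading from the state to acceptance, for live states.
    let live : ℕ → Prop := fun s => ∃ t : List γ, (∀ a ∈ t, a ∈ letters n) ∧
      c.acceptsState (t.foldl c.stepNat s) = true
    classical
    let lab : ℕ → Option (List LetterCode) := fun s =>
      if h : live s then some (h.choose.flatMap l ++ FreeGroup.invRev x ++
        FreeGroup.invRev (h.choose.flatMap r)) else none
    have hinv : ∀ w : List LetterCode, (∀ c ∈ w, c ∈ letterCodes n) →
        ∀ c ∈ FreeGroup.invRev w, c ∈ letterCodes n := by
      intro w hw c hc
      simp only [FreeGroup.invRev, List.mem_reverse, List.mem_map] at hc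
      obtain ⟨c', hc', rfl⟩ := hc
      obtain ⟨a, rfl⟩ := mem_letterCodes.1 (hw c' hc')
      exact mem_letterCodes.2 ⟨(a.1, !a.2), rfl⟩
    have hlab : ∀ s d, lab s = some d → (∀ c ∈ d, c ∈ letterCodes n) ∧
        ∀ z : List γ, (∀ a ∈ z, a ∈ letters n) → c.run z = s →
          (π (z.flatMap l))⁻¹ * π (z.flatMap r) * (π d)⁻¹ ∈ H := by
      intro s d hd
      by_cases h : live s
      swap
      · simp [lab, h] at hd
      simp only [lab, dif_pos h, Option.some.injEq] at hd
      obtain ⟨ht, hacc⟩ := h.choose_spec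
      set t := h.choose
      subst hd
      refine ⟨?_, fun z hz e => ?_⟩
      · have hfl : ∀ f : γ → List LetterCode, (∀ a ∈ letters n, ∀ c ∈ f a, c ∈ letterCodes n) →
            ∀ c ∈ t.flatMap f, c ∈ letterCodes n := by
          intro f hf c hc
          obtain ⟨a, ha, hc⟩ := List.mem_flatMap.1 hc
          exact hf a (ht a ha) c hc
        intro c hc
        rcases List.mem_append.1 hc with hc | hc
        · rcases List.mem_append.1 hc with hc | hc
          · exact hfl l hl c hc
          · exact hinv x hx c hc
        · exact hinv _ (hfl r hr) c hc
      · have h1 := hval (z ++ t) (by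
          intro a ha
          rcases List.mem_append.1 ha with ha | ha
          exacts [hz a ha, ht a ha]) (by
            rw [AutomatonCode.run, List.foldl_append]
            change c.acceptsState (t.foldl c.stepNat (c.run z)) = true
            rwa [e])
        rw [← hconj' t]
        convert h1 using 1
        simp only [List.flatMap_append, hπ, wordVal_append, wordVal_codeVal_invRev]
        group
    have hmem : ∀ w : List LetterCode, (∀ c ∈ w, c ∈ letterCodes n) → π w ∈ H →
        MemCode (codeInput n R V, w) := by
      intro w hw hH
      obtain ⟨w, rfl⟩ := (forall_mem_iff_exists_map fun c => mem_letterCodes).1 hw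
      exact memCode_iff.2 (by rwa [hπ, wordVal_map_codeLetter] at hH)
    have hfin : {s : ℕ × Option (List LetterCode) | ∃ z : List γ,
        (∀ a ∈ z, a ∈ letters n) ∧ s = (c.run z, lab (c.run z))}.Finite := by
      refine ((Set.finite_Iio (c.1 + 1)).image fun s => (s, lab s)).subset ?_
      rintro _ ⟨z, -, rfl⟩
      exact ⟨c.run z, c.run_lt z, rfl⟩
    refine ⟨hfin.toFinset.toList, ⟨(c.run [], lab (c.run [])), ?_, rfl, ?_⟩, ?_⟩
    · simpa using ⟨[], by simp⟩
    · cases h : lab (c.run []) with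
      | none => exact .inl rfl
      | some d =>
        obtain ⟨h1, h2⟩ := hlab _ _ h
        refine .inr ⟨d, rfl, hmem d h1 ?_⟩
        simpa [hπ] using h2 [] (by simp) rfl
    · intro s hs
      simp only [Finset.mem_toList, Set.Finite.mem_toFinset] at hs ⊢
      obtain ⟨z, hz, rfl⟩ := hs
      refine ⟨?_, fun a ha => ?_⟩
      · by_cases hacc : c.acceptsState (c.run z) = true
        · refine .inr ?_
          have hlive : live (c.run z) := ⟨[], by simp, hacc⟩
          obtain ⟨d, hd⟩ : ∃ d, lab (c.run z) = some d := by simp [lab, hlive]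
          obtain ⟨h1, h2⟩ := hlab _ _ hd
          refine ⟨d, hd, hmem _ ?_ ?_⟩
          · intro c hc
            rcases List.mem_append.1 hc with hc | hc
            exacts [h1 c hc, hx c hc]
          · have h3 := mul_mem (inv_mem (h2 z hz rfl)) (hval z hz hacc)
            convert h3 using 1
            simp only [hπ, wordVal_append]
            group
        · exact .inl (by simpa using hacc)
      · have hza : ∀ b ∈ z ++ [a], b ∈ letters n := by
          intro b hb
          rcases List.mem_append.1 hb with hb | hb
          exacts [hz b hb, List.mem_singleton.1 hb ▸ ha]
        refine ⟨_, ⟨z ++ [a], hza, rfl⟩, c.run_append_singleton z a, ?_⟩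
        cases h : lab (c.run (z ++ [a])) with
        | none => exact .inl rfl
        | some d' =>
          have hlive : live (c.run z) := by
            by_cases h' : live (c.run (z ++ [a]))
            · obtain ⟨t, ht, hacc⟩ := h'
              refine ⟨a :: t, ?_, ?_⟩
              · intro b hb
                rcases List.mem_cons.1 hb with rfl | hb
                exacts [ha, ht b hb]
              · rwa [List.foldl_cons, ← AutomatonCode.run_append_singleton]
            · simp [lab, h'] at h
          obtain ⟨d, hd⟩ : ∃ d, lab (c.run z) = some d := by simp [lab, hlive]
          obtain ⟨h1, h2⟩ := hlab _ _ hd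
          obtain ⟨h1', h2'⟩ := hlab _ _ h
          refine .inr ⟨(d, d'), ⟨hd, rfl⟩, hmem _ ?_ ?_⟩
          · intro b hb
            rcases List.mem_append.1 hb with hb | hb
            · rcases List.mem_append.1 hb with hb | hb
              · rcases List.mem_append.1 hb with hb | hb
                exacts [hinv _ (hl a ha) b hb, h1 b hb]
              · exact hr a ha b hb
            · exact hinv _ h1' b hb
          · have h3 := (hconj a _).2 (inv_mem (h2 z hz rfl))
            have h4 := mul_mem h3 (h2' _ hza rfl)
            convert h4 using 1
            simp only [List.flatMap_append, List.flatMap_singleton, hπ, wordVal_append,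
              wordVal_codeVal_invRev]
            group

end Labels

/-! ### Reading several words in parallel -/

@[simp] theorem padPair_nil_nil {α : Type*} : padPair ([] : List α) [] = [] := rfl

@[simp] theorem padPair_nil_cons {α : Type*} (b : α) (v : List α) :
    padPair [] (b :: v) = (none, some b) :: padPair [] v := by
  simp [padPair, List.zipWithAll]

@[simp] theorem padPair_cons_nil {α : Type*} (a : α) (u : List α) :
    padPair (a :: u) [] = (some a, none) :: padPair u [] := by
  simp [padPair, List.zipWithAll]

@[simp] theorem padPair_cons_cons {α : Type*} (a b : α) (u v : List α) :
    padPair (a :: u) (b :: v) = (some a, some b) :: padPair u v := by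
  simp [padPair, List.zipWithAll]

theorem padPair_induction {α : Type*} {P : List α → List α → Prop} (nil : P [] [])
    (right : ∀ b v, P [] v → P [] (b :: v)) (left : ∀ a u, P u [] → P (a :: u) [])
    (cons : ∀ a b u v, P u v → P (a :: u) (b :: v)) : ∀ u v, P u v := by
  intro u
  induction u with
  | nil =>
    intro v
    induction v with
    | nil => exact nil
    | cons b v ih => exact right b v ih
  | cons a u ih =>
    intro v
    cases v with
    | nil => exact left a u (ih [])
    | cons b v => exact cons a b u v (ih v)

@[simp] theorem filterMap_fst_padPair {α : Type*} (u v : List α) :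
    (padPair u v).filterMap Prod.fst = u := by
  induction u, v using padPair_induction with
  | nil => rfl
  | right b v ih => rw [padPair_nil_cons, List.filterMap_cons]; simp only [ih]
  | left a u ih => rw [padPair_cons_nil, List.filterMap_cons]; simp only [ih]
  | cons a b u v ih => rw [padPair_cons_cons, List.filterMap_cons]; simp only [ih]

@[simp] theorem filterMap_snd_padPair {α : Type*} (u v : List α) :
    (padPair u v).filterMap Prod.snd = v := by
  induction u, v using padPair_induction with
  | nil => rfl
  | right b v ih => rw [padPair_nil_cons, List.filterMap_cons]; simp only [ih]
  | left a u ih => rw [padPair_cons_nil, List.filterMap_cons]; simp only [ih]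
  | cons a b u v ih => rw [padPair_cons_cons, List.filterMap_cons]; simp only [ih]

theorem padPair_injective {α : Type*} {u v u' v' : List α} (h : padPair u v = padPair u' v') :
    u = u' ∧ v = v' :=
  ⟨by rw [← filterMap_fst_padPair u v, h, filterMap_fst_padPair],
    by rw [← filterMap_snd_padPair u v, h, filterMap_snd_padPair]⟩

theorem padPair_map_codeLetter {n : ℕ} (u v : List (Letter n)) :
    padPair (u.map codeLetter) (v.map codeLetter) = (padPair u v).map codePair := by
  induction u, v using padPair_induction <;> simp_all [codePair]

theorem padPair_take_succ {α : Type*} [DecidableEq α] (u v : List α) (i : ℕ) :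
    padPair (u.take (i + 1)) (v.take (i + 1)) = padPair (u.take i) (v.take i) ++
      if u[i]? = none ∧ v[i]? = none then [] else [(u[i]?, v[i]?)] := by
  induction u, v using padPair_induction generalizing i with
  | nil => simp
  | right b v ih => cases i <;> simp_all
  | left a u ih => cases i <;> simp_all
  | cons a b u v ih => cases i <;> simp_all

/-! ### Deciding properties of words read in parallel -/

namespace ParallelRun

/-- Transition of a pair automaton that ignores columns consisting of padding only. -/
def pairStep (c : AutomatonCode PairCode) (s : ℕ) (a b : Option LetterCode) : ℕ :=
  if a = none ∧ b = none then s else c.stepNat s (a, b)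

/-- Transition of a word automaton that ignores padding. -/
def optionStep (c : AutomatonCode LetterCode) (s : ℕ) (a : Option LetterCode) : ℕ :=
  a.elim s fun b => c.stepNat s b

/-- Status of one track: `0` while only letters were read, `1` after letters followed by at least
one padding symbol, `2` after a letter was read behind a padding symbol. -/
def trackStep (t : ℕ) (a : Option LetterCode) : ℕ :=
  if a = none then (if t = 2 then 2 else 1) else (if t = 0 then 0 else 2)

/-- Replacement of the first padding symbol of a track. -/
def fillFirst (app : Option LetterCode) (t : ℕ) (a : Option LetterCode) : Option LetterCode :=
  if a = none ∧ t = 0 then app else a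

/-- Three pair automata, for the tracks `1, 2`, the tracks `2, 3` and the tracks `1, 3`, a letter to
be appended to the word on track `1` before the third automaton reads it, and two word automata,
for the tracks `1` and `2`; the first component is the number of generators. -/
abbrev Params : Type := ℕ × (AutomatonCode PairCode × AutomatonCode PairCode ×
  AutomatonCode PairCode) × Option LetterCode × AutomatonCode LetterCode × AutomatonCode LetterCode

/-- The states of the five automata, whether tracks `1` and `2` agree, and the status of the
tracks. -/
abbrev State : Type := (ℕ × ℕ × ℕ) × (ℕ × ℕ × Bool) × (ℕ × ℕ × ℕ)

/-- A column of three tracks, on which words are padded by `none`. -/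
abbrev Column : Type := Option LetterCode × Option LetterCode × Option LetterCode

/-- The initial state of the parallel run. -/
def start (P : Params) : State :=
  ((P.2.1.1.startNat, P.2.1.2.1.startNat, P.2.1.2.2.startNat),
    (P.2.2.2.1.startNat, P.2.2.2.2.startNat, true), (0, 0, 0))

/-- The transition of the parallel run. -/
def step (P : Params) (s : State) (a : Column) : State :=
  ((pairStep P.2.1.1 s.1.1 a.1 a.2.1, pairStep P.2.1.2.1 s.1.2.1 a.2.1 a.2.2,
      pairStep P.2.1.2.2 s.1.2.2 (fillFirst P.2.2.1 s.2.2.1 a.1) a.2.2),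
    (optionStep P.2.2.2.1 s.2.1.1 a.1, optionStep P.2.2.2.2 s.2.1.2.1 a.2.1,
      s.2.1.2.2 && decide (a.1 = a.2.1)),
    (trackStep s.2.2.1 a.1, trackStep s.2.2.2.1 a.2.1, trackStep s.2.2.2.2 a.2.2))

/-- All columns of codes of letters and of padding symbols. -/
def columns (n : ℕ) : List Column :=
  (optionCodes n).flatMap fun a => (pairCodes n).map fun b => (a, b)

/-- Which automata accept, and whether the first two words agree. -/
abbrev Bits : Type := (Bool × Bool × Bool) × (Bool × Bool × Bool)

/-- The answers that can be read off from a state of the parallel run. -/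
def stateBits (P : Params) (s : State) : Bits :=
  ((P.2.1.1.acceptsState s.1.1, P.2.1.2.1.acceptsState s.1.2.1, P.2.1.2.2.acceptsState s.1.2.2),
    (P.2.2.2.1.acceptsState s.2.1.1, P.2.2.2.2.acceptsState s.2.1.2.1, s.2.1.2.2))

/-- The answers for three given words. -/
def bits (P : Params) (u v w : List LetterCode) : Bits :=
  ((P.2.1.1.acceptsState (P.2.1.1.run (padPair u v)),
      P.2.1.2.1.acceptsState (P.2.1.2.1.run (padPair v w)),
      P.2.1.2.2.acceptsState (P.2.1.2.2.run (padPair (u ++ P.2.2.1.toList) w))),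
    (P.2.2.2.1.acceptsState (P.2.2.2.1.run u), P.2.2.2.2.acceptsState (P.2.2.2.2.run v),
      decide (u = v)))

/-- The first `N` columns of three words read in parallel. -/
def zipColumns (u v w : List LetterCode) (N : ℕ) : List Column :=
  (List.range N).map fun i => (u[i]?, v[i]?, w[i]?)

theorem run_padPair_take_succ (c : AutomatonCode PairCode) (u v : List LetterCode) (i : ℕ) :
    c.run (padPair (u.take (i + 1)) (v.take (i + 1))) =
      pairStep c (c.run (padPair (u.take i) (v.take i))) u[i]? v[i]? := by
  rw [padPair_take_succ, pairStep]
  split_ifs with h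
  · simp
  · rw [AutomatonCode.run_append_singleton]

theorem run_take_succ (c : AutomatonCode LetterCode) (u : List LetterCode) (i : ℕ) :
    c.run (u.take (i + 1)) = optionStep c (c.run (u.take i)) u[i]? := by
  rw [List.take_add_one, optionStep]
  cases u[i]? with
  | none => simp
  | some a => exact AutomatonCode.run_append_singleton _ _ _

theorem trackStep_getElem? (u : List LetterCode) (i : ℕ) :
    trackStep (if i ≤ u.length then 0 else 1) u[i]? = if i + 1 ≤ u.length then 0 else 1 := by
  by_cases h : i < u.length
  · simp [trackStep, h, h.le, Nat.succ_le_of_lt h]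
  · have : u[i]? = none := by simpa using h
    have h' : ¬ i + 1 ≤ u.length := h
    by_cases h'' : i ≤ u.length <;> simp [this, trackStep, h', h'']

theorem fillFirst_getElem? (app : Option LetterCode) (u : List LetterCode) (i : ℕ) :
    fillFirst app (if i ≤ u.length then 0 else 1) u[i]? = (u ++ app.toList)[i]? := by
  rcases lt_trichotomy i u.length with h | rfl | h
  · simp [fillFirst, List.getElem?_append_left h, h]
  · simp only [fillFirst, le_refl, List.getElem?_append_right, Nat.sub_self]
    cases app <;> simp
  · rw [List.getElem?_append_right h.le, List.getElem?_eq_none h.le, fillFirst,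
      if_neg (by simp [h])]
    have : app.toList.length ≤ i - u.length := by cases app <;> simp; omega
    rw [List.getElem?_eq_none this]

theorem decide_take_succ (u v : List LetterCode) (i : ℕ) :
    decide (u.take (i + 1) = v.take (i + 1)) =
      (decide (u.take i = v.take i) && decide (u[i]? = v[i]?)) := by
  rw [← Bool.decide_and, decide_eq_decide]
  constructor
  · intro h
    refine ⟨?_, ?_⟩
    · have := congrArg (List.take i) h
      simpa [List.take_take] using this
    · rw [← List.getElem?_take_of_lt (Nat.lt_succ_self i), h,
        List.getElem?_take_of_lt (Nat.lt_succ_self i)]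
  · rintro ⟨h1, h2⟩
    rw [List.take_add_one, List.take_add_one, h1, h2]

/-- The parallel run computes the states of all automata on the first `N` letters of the words; the
third pair automaton reads the appended letter in place of the first padding symbol. -/
theorem foldl_zipColumns (P : Params) (u v w : List LetterCode) (N : ℕ) :
    (zipColumns u v w N).foldl (step P) (start P) =
      ((P.2.1.1.run (padPair (u.take N) (v.take N)),
          P.2.1.2.1.run (padPair (v.take N) (w.take N)),
          P.2.1.2.2.run (padPair ((u ++ P.2.2.1.toList).take N) (w.take N))),
        (P.2.2.2.1.run (u.take N), P.2.2.2.2.run (v.take N), decide (u.take N = v.take N)),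
        (if N ≤ u.length then 0 else 1, if N ≤ v.length then 0 else 1,
          if N ≤ w.length then 0 else 1)) := by
  induction N with
  | zero => simp [zipColumns, start, AutomatonCode.run]
  | succ N ih =>
    rw [zipColumns, List.range_succ, List.map_append, List.foldl_append]
    change List.foldl (step P) (List.foldl (step P) (start P) (zipColumns u v w N)) _ = _
    rw [ih]
    simp only [List.map_cons, List.map_nil, List.foldl_cons, List.foldl_nil, step,
      run_padPair_take_succ, run_take_succ, decide_take_succ, trackStep_getElem?,
      fillFirst_getElem?]

theorem foldl_trackStep_two (l : List (Option LetterCode)) : l.foldl trackStep 2 = 2 := by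
  induction l with
  | nil => rfl
  | cons a l ih =>
    rw [List.foldl_cons]
    have : trackStep 2 a = 2 := by cases a <;> simp [trackStep]
    rw [this, ih]

theorem exists_of_foldl_trackStep (l : List (Option LetterCode))
    (h : l.foldl trackStep 0 = 1) :
    ∃ u : List LetterCode, u.length < l.length ∧ ∀ i < l.length, l[i]? = some u[i]? := by
  have h1 : ∀ l : List (Option LetterCode), l.foldl trackStep 1 = 1 →
      ∀ i < l.length, l[i]? = some none := by
    intro l
    induction l with
    | nil => simp
    | cons a l ih =>
      intro h i hi
      cases a with
      | none =>
        cases i with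
        | zero => simp
        | succ i => simpa using ih (by simpa [trackStep] using h) i (by simpa using hi)
      | some a =>
        rw [List.foldl_cons, show trackStep 1 (some a) = 2 by simp [trackStep],
          foldl_trackStep_two] at h
        omega
  induction l with
  | nil => simp at h
  | cons a l ih =>
    cases a with
    | none =>
      refine ⟨[], by simp, fun i hi => ?_⟩
      cases i with
      | zero => simp
      | succ i => simpa using h1 l (by simpa [trackStep] using h) i (by simpa using hi)
    | some a =>
      obtain ⟨u, hu, hl⟩ := ih (by simpa [trackStep] using h)
      refine ⟨a :: u, by simpa using hu, fun i hi => ?_⟩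
      cases i with
      | zero => simp
      | succ i => simpa using hl i (by simpa using hi)

/-- A component of a fold that evolves on its own is a fold. -/
theorem foldl_hom {σ τ α β : Type*} (g : σ → τ) (f : α → β) (st : σ → α → σ) (st' : τ → β → τ)
    (h : ∀ s a, g (st s a) = st' (g s) (f a)) (z : List α) (s : σ) :
    g (z.foldl st s) = (z.map f).foldl st' (g s) := by
  induction z generalizing s with
  | nil => rfl
  | cons a z ih => rw [List.foldl_cons, ih, h, List.map_cons, List.foldl_cons]

/-- When all tracks have status `1`, the columns come from three words, each of which has ended before
the last column, so that there was room for the appended letter. -/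
theorem exists_eq_zipColumns (P : Params) (z : List Column)
    (h : (z.foldl (step P) (start P)).2.2 = (1, 1, 1)) :
    ∃ u v w, z = zipColumns u v w z.length ∧ u.length < z.length ∧ v.length < z.length ∧
      w.length < z.length := by
  rw [Prod.ext_iff, Prod.ext_iff] at h
  obtain ⟨h1, h2, h3⟩ := h
  rw [foldl_hom (fun s : State => s.2.2.1) (fun a : Column => a.1) (step P) trackStep
    (fun _ _ => rfl)] at h1
  rw [foldl_hom (fun s : State => s.2.2.2.1) (fun a : Column => a.2.1) (step P) trackStep
    (fun _ _ => rfl)] at h2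
  rw [foldl_hom (fun s : State => s.2.2.2.2) (fun a : Column => a.2.2) (step P) trackStep
    (fun _ _ => rfl)] at h3
  obtain ⟨u, hu, hu'⟩ := exists_of_foldl_trackStep _ h1
  obtain ⟨v, hv, hv'⟩ := exists_of_foldl_trackStep _ h2
  obtain ⟨w, hw, hw'⟩ := exists_of_foldl_trackStep _ h3
  simp only [List.length_map] at hu hv hw hu' hv' hw'
  refine ⟨u, v, w, ?_, hu, hv, hw⟩
  refine List.ext_getElem (by simp [zipColumns]) fun i hi _ => ?_
  have e1 := hu' i hi
  have e2 := hv' i hi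
  have e3 := hw' i hi
  simp only [List.getElem?_map, List.getElem?_eq_getElem hi, Option.map_some,
    Option.some.injEq] at e1 e2 e3
  simp only [zipColumns, List.getElem_map, List.getElem_range]
  exact Prod.ext e1 (Prod.ext e2 e3)

theorem mem_columns {n : ℕ} {a : Column} :
    a ∈ columns n ↔ a.1 ∈ optionCodes n ∧ a.2.1 ∈ optionCodes n ∧ a.2.2 ∈ optionCodes n := by
  obtain ⟨a, b, c⟩ := a
  simp only [columns, List.mem_flatMap, List.mem_map, pairCodes]
  constructor
  · rintro ⟨a', ha, b', ⟨b, hb, c, hc, rfl⟩, h⟩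
    simp only [Prod.mk.injEq] at h
    obtain ⟨rfl, rfl, rfl⟩ := h
    exact ⟨ha, hb, hc⟩
  · rintro ⟨ha, hb, hc⟩
    exact ⟨a, ha, _, ⟨b, hb, c, hc, rfl⟩, rfl⟩

theorem some_mem_optionCodes {n : ℕ} {c : LetterCode} :
    some c ∈ optionCodes n ↔ c ∈ letterCodes n := by
  simp [optionCodes]

/-- A property of the automata on all well-formed columns is one on all triples of words. -/
theorem forall_columns_iff (P : Params) (φ : Bits → Bool) :
    (∀ z : List Column, (∀ a ∈ z, a ∈ columns P.1) →
        ((z.foldl (step P) (start P)).2.2 ≠ (1, 1, 1) ∨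
          φ (stateBits P (z.foldl (step P) (start P))) = true)) ↔
      ∀ u v w : List LetterCode, (∀ c ∈ u, c ∈ letterCodes P.1) →
        (∀ c ∈ v, c ∈ letterCodes P.1) → (∀ c ∈ w, c ∈ letterCodes P.1) →
        φ (bits P u v w) = true := by
  have key : ∀ (u v w : List LetterCode) (N : ℕ), u.length < N → v.length < N → w.length < N →
      ((zipColumns u v w N).foldl (step P) (start P)).2.2 = (1, 1, 1) ∧
        stateBits P ((zipColumns u v w N).foldl (step P) (start P)) = bits P u v w := by
    intro u v w N hu hv hw
    have hu' : (u ++ P.2.2.1.toList).length ≤ N := by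
      rw [List.length_append]
      cases P.2.2.1 <;> simp <;> omega
    rw [foldl_zipColumns, List.take_of_length_le hu']
    simp [stateBits, bits, List.take_of_length_le, hu.le, hv.le, hw.le, hu, hv, hw]
  constructor
  · intro h u v w hu hv hw
    let N := u.length + v.length + w.length + 1
    obtain ⟨h1, h2⟩ := key u v w N (by omega) (by omega) (by omega)
    have h3 := h (zipColumns u v w N) (by
      intro a ha
      obtain ⟨i, -, rfl⟩ := List.mem_map.1 ha
      have hop : ∀ u : List LetterCode, (∀ c ∈ u, c ∈ letterCodes P.1) →
          u[i]? ∈ optionCodes P.1 := by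
        intro u hu
        cases hi : u[i]? with
        | none => simp [optionCodes]
        | some c => exact some_mem_optionCodes.2 (hu c (List.mem_of_getElem? hi))
      exact mem_columns.2 ⟨hop u hu, hop v hv, hop w hw⟩)
    rw [h1, h2] at h3
    simpa using h3
  · intro h z hz
    by_cases ht : (z.foldl (step P) (start P)).2.2 = (1, 1, 1)
    swap
    · exact .inl ht
    right
    obtain ⟨u, v, w, e, hu, hv, hw⟩ := exists_eq_zipColumns P z ht
    have hop : ∀ i < z.length, u[i]? ∈ optionCodes P.1 ∧ v[i]? ∈ optionCodes P.1 ∧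
        w[i]? ∈ optionCodes P.1 := by
      intro i hi
      refine mem_columns.1 (hz (u[i]?, v[i]?, w[i]?) ?_)
      rw [e]
      exact List.mem_map.2 ⟨i, List.mem_range.2 hi, rfl⟩
    rw [e, (key u v w _ hu hv hw).2]
    have hmem : ∀ x : List LetterCode, x.length < z.length →
        (∀ i < z.length, x[i]? ∈ optionCodes P.1) → ∀ c ∈ x, c ∈ letterCodes P.1 := by
      intro x hx hxi c hc
      obtain ⟨i, hi, rfl⟩ := List.getElem_of_mem hc
      have := hxi i (by omega)
      rwa [List.getElem?_eq_getElem hi, some_mem_optionCodes] at this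
    exact h u v w (hmem u hu fun i hi => (hop i hi).1) (hmem v hv fun i hi => (hop i hi).2.1)
      (hmem w hw fun i hi => (hop i hi).2.2)

section Primrec

variable {β : Type*} [Primcodable β]

theorem primrec_pairStep {c : β → AutomatonCode PairCode} {s : β → ℕ}
    {a b : β → Option LetterCode} (hc : Primrec c) (hs : Primrec s) (ha : Primrec a)
    (hb : Primrec b) : Primrec fun x => pairStep (c x) (s x) (a x) (b x) :=
  Primrec.ite ((Primrec.eq.comp ha (Primrec.const none)).and
    (Primrec.eq.comp hb (Primrec.const none))) hs (AutomatonCode.primrec_stepNat hc hs (ha.pair hb))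

theorem primrec_optionStep {c : β → AutomatonCode LetterCode} {s : β → ℕ}
    {a : β → Option LetterCode} (hc : Primrec c) (hs : Primrec s) (ha : Primrec a) :
    Primrec fun x => optionStep (c x) (s x) (a x) := by
  refine (Primrec.option_casesOn ha hs (AutomatonCode.primrec_stepNat (hc.comp Primrec.fst)
    (hs.comp Primrec.fst) Primrec.snd).to₂).of_eq fun x => ?_
  cases h : a x <;> simp [optionStep]

theorem primrec_trackStep {t : β → ℕ} {a : β → Option LetterCode} (ht : Primrec t)
    (ha : Primrec a) : Primrec fun x => trackStep (t x) (a x) :=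
  Primrec.ite (Primrec.eq.comp ha (Primrec.const none))
    (Primrec.ite (Primrec.eq.comp ht (Primrec.const 2)) (Primrec.const 2) (Primrec.const 1))
    (Primrec.ite (Primrec.eq.comp ht (Primrec.const 0)) (Primrec.const 0) (Primrec.const 2))

theorem primrec_fillFirst {app : β → Option LetterCode} {t : β → ℕ} {a : β → Option LetterCode}
    (happ : Primrec app) (ht : Primrec t) (ha : Primrec a) :
    Primrec fun x => fillFirst (app x) (t x) (a x) :=
  Primrec.ite ((Primrec.eq.comp ha (Primrec.const none)).and
    (Primrec.eq.comp ht (Primrec.const 0))) happ ha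

theorem primrec_columns : Primrec columns := by
  have h : Primrec fun x : ℕ × Option LetterCode =>
      (pairCodes x.1).map fun b => ((x.2, b) : Column) :=
    Primrec.list_map (primrec_pairCodes.comp Primrec.fst)
      ((Primrec.snd.comp Primrec.fst).pair Primrec.snd).to₂
  exact Primrec.list_flatMap primrec_optionCodes h.to₂

theorem primrec_start : Primrec start := by
  have c : Primrec fun P : Params => P.2.1 := Primrec.fst.comp Primrec.snd
  have m : Primrec fun P : Params => P.2.2.2 := Primrec.snd.comp (Primrec.snd.comp Primrec.snd)
  refine Primrec.pair ?_ (Primrec.pair ?_ (Primrec.const _))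
  · exact (AutomatonCode.primrec_startNat.comp (Primrec.fst.comp c)).pair
      ((AutomatonCode.primrec_startNat.comp (Primrec.fst.comp (Primrec.snd.comp c))).pair
        (AutomatonCode.primrec_startNat.comp (Primrec.snd.comp (Primrec.snd.comp c))))
  · exact (AutomatonCode.primrec_startNat.comp (Primrec.fst.comp m)).pair
      ((AutomatonCode.primrec_startNat.comp (Primrec.snd.comp m)).pair (Primrec.const true))

theorem primrec_step : Primrec fun x : Params × State × Column => step x.1 x.2.1 x.2.2 := by
  have P : Primrec fun x : Params × State × Column => x.1 := Primrec.fst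
  have c : Primrec fun x : Params × State × Column => x.1.2.1 :=
    Primrec.fst.comp (Primrec.snd.comp P)
  have app : Primrec fun x : Params × State × Column => x.1.2.2.1 :=
    Primrec.fst.comp (Primrec.snd.comp (Primrec.snd.comp P))
  have m : Primrec fun x : Params × State × Column => x.1.2.2.2 :=
    Primrec.snd.comp (Primrec.snd.comp (Primrec.snd.comp P))
  have s : Primrec fun x : Params × State × Column => x.2.1 := Primrec.fst.comp Primrec.snd
  have a : Primrec fun x : Params × State × Column => x.2.2 := Primrec.snd.comp Primrec.snd
  have s1 : Primrec fun x : Params × State × Column => x.2.1.1 := Primrec.fst.comp s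
  have s2 : Primrec fun x : Params × State × Column => x.2.1.2.1 :=
    Primrec.fst.comp (Primrec.snd.comp s)
  have s3 : Primrec fun x : Params × State × Column => x.2.1.2.2 :=
    Primrec.snd.comp (Primrec.snd.comp s)
  have a1 : Primrec fun x : Params × State × Column => x.2.2.1 := Primrec.fst.comp a
  have a2 : Primrec fun x : Params × State × Column => x.2.2.2.1 :=
    Primrec.fst.comp (Primrec.snd.comp a)
  have a3 : Primrec fun x : Params × State × Column => x.2.2.2.2 :=
    Primrec.snd.comp (Primrec.snd.comp a)
  refine Primrec.pair (Primrec.pair ?_ (Primrec.pair ?_ ?_))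
    (Primrec.pair (Primrec.pair ?_ (Primrec.pair ?_ ?_)) (Primrec.pair ?_ (Primrec.pair ?_ ?_)))
  · exact primrec_pairStep (Primrec.fst.comp c) (Primrec.fst.comp s1) a1 a2
  · exact primrec_pairStep (Primrec.fst.comp (Primrec.snd.comp c))
      (Primrec.fst.comp (Primrec.snd.comp s1)) a2 a3
  · exact primrec_pairStep (Primrec.snd.comp (Primrec.snd.comp c))
      (Primrec.snd.comp (Primrec.snd.comp s1)) (primrec_fillFirst app (Primrec.fst.comp s3) a1) a3
  · exact primrec_optionStep (Primrec.fst.comp m) (Primrec.fst.comp s2) a1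
  · exact primrec_optionStep (Primrec.snd.comp m) (Primrec.fst.comp (Primrec.snd.comp s2)) a2
  · exact Primrec.and.comp (Primrec.snd.comp (Primrec.snd.comp s2)) (Primrec.eq.comp a1 a2).decide
  · exact primrec_trackStep (Primrec.fst.comp s3) a1
  · exact primrec_trackStep (Primrec.fst.comp (Primrec.snd.comp s3)) a2
  · exact primrec_trackStep (Primrec.snd.comp (Primrec.snd.comp s3)) a3

theorem primrec_stateBits : Primrec fun x : Params × State => stateBits x.1 x.2 := by
  have c : Primrec fun x : Params × State => x.1.2.1 :=
    Primrec.fst.comp (Primrec.snd.comp Primrec.fst)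
  have m : Primrec fun x : Params × State => x.1.2.2.2 :=
    Primrec.snd.comp (Primrec.snd.comp (Primrec.snd.comp Primrec.fst))
  have s1 : Primrec fun x : Params × State => x.2.1 := Primrec.fst.comp Primrec.snd
  have s2 : Primrec fun x : Params × State => x.2.2.1 :=
    Primrec.fst.comp (Primrec.snd.comp Primrec.snd)
  refine Primrec.pair (Primrec.pair ?_ (Primrec.pair ?_ ?_))
    (Primrec.pair ?_ (Primrec.pair ?_ (Primrec.snd.comp (Primrec.snd.comp s2))))
  · exact AutomatonCode.primrec_acceptsState (Primrec.fst.comp c) (Primrec.fst.comp s1)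
  · exact AutomatonCode.primrec_acceptsState (Primrec.fst.comp (Primrec.snd.comp c))
      (Primrec.fst.comp (Primrec.snd.comp s1))
  · exact AutomatonCode.primrec_acceptsState (Primrec.snd.comp (Primrec.snd.comp c))
      (Primrec.snd.comp (Primrec.snd.comp s1))
  · exact AutomatonCode.primrec_acceptsState (Primrec.fst.comp m) (Primrec.fst.comp s2)
  · exact AutomatonCode.primrec_acceptsState (Primrec.snd.comp m)
      (Primrec.fst.comp (Primrec.snd.comp s2))

end Primrec

theorem finite_states (P : Params) : ∃ S : Set State, S.Finite ∧ start P ∈ S ∧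
    ∀ s ∈ S, ∀ a ∈ columns P.1, step P s a ∈ S := by
  have hpair : ∀ (c : AutomatonCode PairCode) (s : ℕ) a b, s ∈ Set.Iio (c.1 + 1) →
      pairStep c s a b ∈ Set.Iio (c.1 + 1) := by
    intro c s a b hs
    unfold pairStep
    split_ifs
    exacts [hs, c.stepNat_lt _ _]
  have hopt : ∀ (c : AutomatonCode LetterCode) (s : ℕ) a, s ∈ Set.Iio (c.1 + 1) →
      optionStep c s a ∈ Set.Iio (c.1 + 1) := by
    intro c s a hs
    cases a
    exacts [hs, c.stepNat_lt _ _]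
  have htrack : ∀ t a, trackStep t a ∈ Set.Iio 3 := by
    intro t a
    unfold trackStep
    split_ifs <;> simp
  refine ⟨(Set.Iio (P.2.1.1.1 + 1) ×ˢ Set.Iio (P.2.1.2.1.1 + 1) ×ˢ Set.Iio (P.2.1.2.2.1 + 1)) ×ˢ
    (Set.Iio (P.2.2.2.1.1 + 1) ×ˢ Set.Iio (P.2.2.2.2.1 + 1) ×ˢ Set.univ) ×ˢ
    (Set.Iio 3 ×ˢ Set.Iio 3 ×ˢ Set.Iio 3), Set.toFinite _, ?_, ?_⟩
  · exact ⟨⟨AutomatonCode.startNat_lt _, AutomatonCode.startNat_lt _, AutomatonCode.startNat_lt _⟩,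
      ⟨AutomatonCode.startNat_lt _, AutomatonCode.startNat_lt _, trivial⟩,
      by simp [start]⟩
  · rintro s ⟨⟨h1, h2, h3⟩, ⟨h4, h5, -⟩, -⟩ a -
    exact ⟨⟨hpair _ _ _ _ h1, hpair _ _ _ _ h2, hpair _ _ _ _ h3⟩,
      ⟨hopt _ _ _ h4, hopt _ _ _ h5, trivial⟩, htrack _ _, htrack _ _, htrack _ _⟩

theorem semiDec_forall_code (φ : Bits → Bool) : SemiDec fun P : Params =>
    ∀ u v w : List LetterCode, (∀ c ∈ u, c ∈ letterCodes P.1) →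
      (∀ c ∈ v, c ∈ letterCodes P.1) → (∀ c ∈ w, c ∈ letterCodes P.1) →
      φ (bits P u v w) = true := by
  have h := SemiDec.forall_words (start := start)
    (step := fun x : Params × State × Column => step x.1 x.2.1 x.2.2)
    (ok := fun x : Params × State => x.2.2.2 ≠ (1, 1, 1) ∨ φ (stateBits x.1 x.2) = true)
    (letters := fun P => columns P.1) primrec_start primrec_step ?_
    (primrec_columns.comp Primrec.fst) finite_states
  · exact h.of_iff fun P => (forall_columns_iff P φ).symm
  · refine SemiDec.of_primrecPred (PrimrecPred.or (PrimrecPred.not ?_) ?_)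
    · exact Primrec.eq.comp (Primrec.snd.comp (Primrec.snd.comp Primrec.snd)) (Primrec.const _)
    · exact Primrec.eq.comp ((Primrec.dom_finite φ).comp primrec_stateBits) (Primrec.const true)

theorem forall_code_iff (n : ℕ) (X : AutomatonCode PairCode × AutomatonCode PairCode ×
    AutomatonCode PairCode) (app : Option (Letter n))
    (m : AutomatonCode LetterCode × AutomatonCode LetterCode) (Q : Bits → Prop) :
    (∀ u v w : List LetterCode, (∀ c ∈ u, c ∈ letterCodes n) →
      (∀ c ∈ v, c ∈ letterCodes n) → (∀ c ∈ w, c ∈ letterCodes n) →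
      Q (bits (n, X, app.map codeLetter, m) u v w)) ↔
    ∀ u v w : List (Letter n), Q (bits (n, X, app.map codeLetter, m)
      (u.map codeLetter) (v.map codeLetter) (w.map codeLetter)) := by
  constructor
  · intro h u v w
    exact h _ _ _ ((forall_mem_iff_exists_map fun c => mem_letterCodes).2 ⟨u, rfl⟩)
      ((forall_mem_iff_exists_map fun c => mem_letterCodes).2 ⟨v, rfl⟩)
      ((forall_mem_iff_exists_map fun c => mem_letterCodes).2 ⟨w, rfl⟩)
  · intro h u v w hu hv hw
    obtain ⟨u, rfl⟩ := (forall_mem_iff_exists_map fun c => mem_letterCodes).1 hu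
    obtain ⟨v, rfl⟩ := (forall_mem_iff_exists_map fun c => mem_letterCodes).1 hv
    obtain ⟨w, rfl⟩ := (forall_mem_iff_exists_map fun c => mem_letterCodes).1 hw
    exact h u v w

theorem bits_map {n : ℕ} (X : AutomatonCode PairCode × AutomatonCode PairCode ×
    AutomatonCode PairCode) (app : Option (Letter n))
    (m : AutomatonCode LetterCode × AutomatonCode LetterCode) (u v w : List (Letter n))
    [∀ z (c : AutomatonCode PairCode), Decidable (z ∈ pairLanguage n c)]
    [∀ z (c : AutomatonCode LetterCode), Decidable (z ∈ wordLanguage n c)] :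
    bits (n, X, app.map codeLetter, m) (u.map codeLetter) (v.map codeLetter)
        (w.map codeLetter) =
      ((decide (padPair u v ∈ pairLanguage n X.1), decide (padPair v w ∈ pairLanguage n X.2.1),
          decide (padPair (u ++ app.toList) w ∈ pairLanguage n X.2.2)),
        (decide (u ∈ wordLanguage n m.1), decide (v ∈ wordLanguage n m.2), decide (u = v))) := by
  have happ : (app.map codeLetter).toList = app.toList.map codeLetter := by cases app <;> rfl
  simp only [bits, happ, ← List.map_append, padPair_map_codeLetter, mem_pairLanguage,
    mem_wordLanguage, Bool.decide_eq_true,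
    (List.map_injective_iff.2 (codeLetter_injective n)).eq_iff]

end ParallelRun

/-! ### Padding and totality of pair automata -/

/-- Status of a word of padded pairs: `0` while there was no padding, `1` and `2` when only the
left, respectively right, word has ended, `3` when the word is not a padded pair. -/
def paddingStep (x : Fin 4 × Bool × Bool) : Fin 4 :=
  match x with
  | (0, true, true) => 0
  | (0, false, true) => 1
  | (1, false, true) => 1
  | (0, true, false) => 2
  | (2, true, false) => 2
  | _ => 3

theorem foldl_paddingStep_three {α : Type*} (z : List (Option α × Option α)) :
    z.foldl (fun t a => paddingStep (t, a.1.isSome, a.2.isSome)) 3 = 3 := by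
  induction z with
  | nil => rfl
  | cons a z ih =>
    have : ∀ b c : Bool, paddingStep (3, b, c) = 3 := by decide
    rw [List.foldl_cons, this, ih]

theorem foldl_paddingStep_ne_three_iff {α : Type*} (z : List (Option α × Option α)) :
    z.foldl (fun t a => paddingStep (t, a.1.isSome, a.2.isSome)) 0 ≠ 3 ↔
      ∃ u v, z = padPair u v := by
  have right : ∀ z : List (Option α × Option α),
      z.foldl (fun t a => paddingStep (t, a.1.isSome, a.2.isSome)) 1 ≠ 3 →
        ∃ v, z = padPair [] v := by
    intro z
    induction z with
    | nil => exact fun _ => ⟨[], rfl⟩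
    | cons a z ih =>
      intro h
      obtain ⟨_ | a, _ | b⟩ := a
      all_goals rw [List.foldl_cons] at h
      · exact absurd (foldl_paddingStep_three z) h
      · obtain ⟨v, rfl⟩ := ih h
        exact ⟨b :: v, by simp⟩
      · exact absurd (foldl_paddingStep_three z) h
      · exact absurd (foldl_paddingStep_three z) h
  have left : ∀ z : List (Option α × Option α),
      z.foldl (fun t a => paddingStep (t, a.1.isSome, a.2.isSome)) 2 ≠ 3 →
        ∃ u, z = padPair u [] := by
    intro z
    induction z with
    | nil => exact fun _ => ⟨[], rfl⟩
    | cons a z ih =>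
      intro h
      obtain ⟨_ | a, _ | b⟩ := a
      all_goals rw [List.foldl_cons] at h
      · exact absurd (foldl_paddingStep_three z) h
      · exact absurd (foldl_paddingStep_three z) h
      · obtain ⟨v, rfl⟩ := ih h
        exact ⟨a :: v, by simp⟩
      · exact absurd (foldl_paddingStep_three z) h
  constructor
  · induction z with
    | nil => exact fun _ => ⟨[], [], rfl⟩
    | cons a z ih =>
      intro h
      obtain ⟨_ | a, _ | b⟩ := a
      all_goals rw [List.foldl_cons] at h
      · exact absurd (foldl_paddingStep_three z) h
      · obtain ⟨v, rfl⟩ := right z h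
        exact ⟨[], b :: v, by simp⟩
      · obtain ⟨u, rfl⟩ := left z h
        exact ⟨a :: u, [], by simp⟩
      · obtain ⟨u, v, rfl⟩ := ih h
        exact ⟨a :: u, b :: v, by simp⟩
  · rintro ⟨u, v, rfl⟩
    have hr : ∀ v : List α,
        (padPair [] v).foldl (fun t a => paddingStep (t, a.1.isSome, a.2.isSome)) 1 = 1 := by
      intro v
      induction v with
      | nil => rfl
      | cons b v ih => simpa [paddingStep] using ih
    have hl : ∀ u : List α,
        (padPair u []).foldl (fun t a => paddingStep (t, a.1.isSome, a.2.isSome)) 2 = 2 := by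
      intro v
      induction v with
      | nil => rfl
      | cons b v ih => simpa [paddingStep] using ih
    induction u, v using padPair_induction with
    | nil => exact (by decide : (0 : Fin 4) ≠ 3)
    | right b v _ =>
      rw [padPair_nil_cons, List.foldl_cons]
      exact (hr v).symm ▸ (by decide)
    | left a u _ =>
      rw [padPair_cons_nil, List.foldl_cons]
      exact (hl u).symm ▸ (by decide)
    | cons a b u v ih => rwa [padPair_cons_cons, List.foldl_cons]

theorem semiDec_accepts_padded : SemiDec fun P : ℕ × AutomatonCode PairCode =>
    ∀ z : List PairCode, (∀ a ∈ z, a ∈ pairCodes P.1) →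
      P.2.acceptsState (P.2.run z) = true → ∃ u v, z = padPair u v := by
  have h := SemiDec.forall_words
    (start := fun P : ℕ × AutomatonCode PairCode => ((P.2.startNat, 0) : ℕ × Fin 4))
    (step := fun x : (ℕ × AutomatonCode PairCode) × (ℕ × Fin 4) × PairCode =>
      (x.1.2.stepNat x.2.1.1 x.2.2, paddingStep (x.2.1.2, x.2.2.1.isSome, x.2.2.2.isSome)))
    (ok := fun x => x.1.2.acceptsState x.2.1 = false ∨ x.2.2 ≠ 3)
    (letters := fun P => pairCodes P.1) ?_ ?_ ?_ (primrec_pairCodes.comp Primrec.fst) ?_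
  · refine h.of_iff fun P => ?_
    refine forall_congr' fun z => imp_congr_right fun _ => ?_
    simp only
    rw [ParallelRun.foldl_hom (fun s : ℕ × Fin 4 => s.1) id _ P.2.stepNat (fun _ _ => rfl),
      ParallelRun.foldl_hom (fun s : ℕ × Fin 4 => s.2) id _
        (fun t a => paddingStep (t, a.1.isSome, a.2.isSome)) (fun _ _ => rfl),
      List.map_id, foldl_paddingStep_ne_three_iff, AutomatonCode.run]
    rw [← Bool.not_eq_true, ← imp_iff_not_or]
  · exact (AutomatonCode.primrec_startNat.comp Primrec.snd).pair (Primrec.const 0)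
  · have a : Primrec fun x : (ℕ × AutomatonCode PairCode) × (ℕ × Fin 4) × PairCode => x.2.2 :=
      Primrec.snd.comp Primrec.snd
    have s : Primrec fun x : (ℕ × AutomatonCode PairCode) × (ℕ × Fin 4) × PairCode => x.2.1 :=
      Primrec.fst.comp Primrec.snd
    refine Primrec.pair (AutomatonCode.primrec_stepNat (Primrec.snd.comp Primrec.fst)
      (Primrec.fst.comp s) a) ?_
    exact (Primrec.dom_finite paddingStep).comp ((Primrec.snd.comp s).pair
      ((Primrec.option_isSome.comp (Primrec.fst.comp a)).pair
        (Primrec.option_isSome.comp (Primrec.snd.comp a))))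
  · refine SemiDec.of_primrecPred (PrimrecPred.or ?_ (PrimrecPred.not ?_))
    · exact Primrec.eq.comp (AutomatonCode.primrec_acceptsState (Primrec.snd.comp Primrec.fst)
        (Primrec.fst.comp Primrec.snd)) (Primrec.const false)
    · exact Primrec.eq.comp (Primrec.snd.comp Primrec.snd) (Primrec.const 3)
  · intro P
    refine ⟨Set.Iio (P.2.1 + 1) ×ˢ Set.univ, Set.toFinite _, ⟨P.2.startNat_lt, trivial⟩, ?_⟩
    rintro s - a -
    exact ⟨P.2.stepNat_lt _ _, trivial⟩

/-- Every accepted word of the word automaton is the left word of an accepted word of the pair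
automaton, up to trailing padding. -/
def IsTotalCode (n : ℕ) (c : AutomatonCode PairCode) (m : AutomatonCode LetterCode) : Prop :=
  ∀ u : List LetterCode, (∀ a ∈ u, a ∈ letterCodes n) → m.acceptsState (m.run u) = true →
    ∃ z : List PairCode, (∀ a ∈ z, a ∈ pairCodes n) ∧ c.acceptsState (c.run z) = true ∧
      ∃ k, z.map Prod.fst = u.map some ++ List.replicate k none

theorem mem_pairCodes_iff {n : ℕ} {a : PairCode} :
    a ∈ pairCodes n ↔ a.1 ∈ optionCodes n ∧ a.2 ∈ optionCodes n := by
  obtain ⟨a, b⟩ := a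
  simp [pairCodes]

/-- Certificates for totality are sets of pairs consisting of a state of the word automaton and
of a set of states that the pair automaton can reach at the same time, the left word being given. -/
theorem isTotalCode_iff (n : ℕ) (c : AutomatonCode PairCode) (m : AutomatonCode LetterCode) :
    IsTotalCode n c m ↔ ∃ C : List (ℕ × List ℕ),
      (∃ s ∈ C, s.1 = m.startNat ∧ ∀ t ∈ s.2, t = c.startNat) ∧
      ∀ s ∈ C, (m.acceptsState s.1 = false ∨ ∃ t ∈ s.2, ∃ y : List (Option LetterCode),
          (∀ b ∈ y, b ∈ optionCodes n) ∧
          c.acceptsState (y.foldl (fun t b => c.stepNat t (none, b)) t) = true) ∧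
        ∀ a ∈ letterCodes n, ∃ s' ∈ C, s'.1 = m.stepNat s.1 a ∧
          ∀ t' ∈ s'.2, ∃ t ∈ s.2, ∃ b ∈ optionCodes n, t' = c.stepNat t (some a, b) := by
  constructor
  · intro H
    classical
    let S : List LetterCode → List ℕ := fun u => (List.range (c.1 + 1)).filter fun t =>
      ∃ z : List PairCode, (∀ a ∈ z, a ∈ pairCodes n) ∧ z.map Prod.fst = u.map some ∧ c.run z = t
    have hS : ∀ u t, t ∈ S u ↔ ∃ z : List PairCode, (∀ a ∈ z, a ∈ pairCodes n) ∧
        z.map Prod.fst = u.map some ∧ c.run z = t := by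
      intro u t
      simp only [S, List.mem_filter, List.mem_range, decide_eq_true_eq, and_iff_right_iff_imp]
      rintro ⟨z, -, -, rfl⟩
      exact c.run_lt z
    have hfin : {s : ℕ × List ℕ | ∃ u : List LetterCode, (∀ a ∈ u, a ∈ letterCodes n) ∧
        s = (m.run u, S u)}.Finite := by
      refine ((Set.finite_Iio (m.1 + 1)).prod
        ((List.range (c.1 + 1)).sublists.toFinset.finite_toSet)).subset ?_
      rintro _ ⟨u, -, rfl⟩
      exact ⟨m.run_lt u, by simp [S]⟩
    refine ⟨hfin.toFinset.toList, ⟨(m.run [], S []), ?_, rfl, fun t ht => ?_⟩, fun s hs => ?_⟩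
    · simpa using ⟨[], by simp⟩
    · obtain ⟨z, -, hz, rfl⟩ := (hS [] t).1 ht
      rw [List.map_nil, List.map_eq_nil_iff] at hz
      rw [hz]
      rfl
    · simp only [Finset.mem_toList, Set.Finite.mem_toFinset] at hs ⊢
      obtain ⟨u, hu, rfl⟩ := hs
      refine ⟨?_, fun a ha => ⟨_, ⟨u ++ [a], ?_, rfl⟩, m.run_append_singleton u a, ?_⟩⟩
      · by_cases hacc : m.acceptsState (m.run u) = true
        swap
        · exact .inl (by simpa using hacc)
        obtain ⟨z, hz, hzacc, k, hk⟩ := H u hu hacc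
        obtain ⟨z₁, z₂, rfl, h1, h2⟩ := List.map_eq_append_iff.1 hk
        refine .inr ⟨c.run z₁, (hS u _).2 ⟨z₁, fun a ha => hz a (by simp [ha]), h1, rfl⟩,
          z₂.map Prod.snd, ?_, ?_⟩
        · intro b hb
          obtain ⟨a, ha, rfl⟩ := List.mem_map.1 hb
          exact (mem_pairCodes_iff.1 (hz a (by simp [ha]))).2
        · have e : z₂ = (z₂.map Prod.snd).map fun b => (none, b) := by
            rw [List.map_map]
            refine (List.map_congr_left (f := id) fun a ha => ?_).symm.trans (List.map_id _) |>.symm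
            have : a.1 ∈ List.replicate k none := h2 ▸ List.mem_map_of_mem ha
            exact Prod.ext (List.eq_of_mem_replicate this) rfl
          rw [AutomatonCode.run, List.foldl_append, e, List.foldl_map] at hzacc
          exact hzacc
      · intro b hb
        rcases List.mem_append.1 hb with hb | hb
        exacts [hu b hb, List.mem_singleton.1 hb ▸ ha]
      · intro t' ht'
        obtain ⟨z, hz, hzu, rfl⟩ := (hS _ _).1 ht'
        rw [List.map_append] at hzu
        obtain ⟨z₁, z₂, rfl, h1, h2⟩ := List.map_eq_append_iff.1 hzu
        obtain ⟨p, rfl, hp⟩ : ∃ p, z₂ = [p] ∧ p.1 = some a := by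
          simpa [List.map_eq_cons_iff] using h2
        refine ⟨c.run z₁, (hS u _).2 ⟨z₁, fun a ha => hz a (by simp [ha]), h1, rfl⟩, p.2,
          (mem_pairCodes_iff.1 (hz p (by simp))).2, ?_⟩
        rw [AutomatonCode.run_append_singleton, ← hp]
  · rintro ⟨C, ⟨s, hs, hs1, hs2⟩, hC⟩ u hu hacc
    have inv : ∃ s ∈ C, s.1 = m.run u ∧ ∀ t ∈ s.2, ∃ z : List PairCode,
        (∀ a ∈ z, a ∈ pairCodes n) ∧ z.map Prod.fst = u.map some ∧ c.run z = t := by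
      clear hacc
      induction u using List.reverseRecOn with
      | nil => exact ⟨s, hs, hs1, fun t ht => ⟨[], by simp, rfl, (hs2 t ht).symm⟩⟩
      | append_singleton u a ih =>
        obtain ⟨s, hs, h1, h2⟩ := ih fun b hb => hu b (by simp [hb])
        have ha := hu a (by simp)
        obtain ⟨s', hs', e, h3⟩ := (hC s hs).2 a ha
        refine ⟨s', hs', by rw [e, h1, AutomatonCode.run_append_singleton], fun t' ht' => ?_⟩
        obtain ⟨t, ht, b, hb, rfl⟩ := h3 t' ht'
        obtain ⟨z, hz, hzu, rfl⟩ := h2 t ht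
        refine ⟨z ++ [(some a, b)], ?_, by simp [hzu], AutomatonCode.run_append_singleton _ _ _⟩
        intro p hp
        rcases List.mem_append.1 hp with hp | hp
        · exact hz p hp
        · rw [List.mem_singleton.1 hp]
          exact mem_pairCodes_iff.2 ⟨ParallelRun.some_mem_optionCodes.2 ha, hb⟩
    obtain ⟨s, hs, h1, h2⟩ := inv
    rcases (hC s hs).1 with h | ⟨t, ht, y, hy, hyacc⟩
    · rw [h1, hacc] at h
      cases h
    · obtain ⟨z, hz, hzu, rfl⟩ := h2 t ht
      refine ⟨z ++ y.map fun b => (none, b), ?_, ?_, y.length, ?_⟩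
      · intro p hp
        rcases List.mem_append.1 hp with hp | hp
        · exact hz p hp
        · obtain ⟨b, hb, rfl⟩ := List.mem_map.1 hp
          exact mem_pairCodes_iff.2 ⟨by simp [optionCodes], hy b hb⟩
      · rw [AutomatonCode.run, List.foldl_append, List.foldl_map]
        exact hyacc
      · simp only [List.map_append, hzu, List.map_map, List.append_cancel_left_eq]
        refine (List.map_congr_left (g := fun _ => none) fun _ _ => rfl).trans ?_
        rw [List.map_const']

theorem primrec_foldl_right_track :
    Primrec fun x : AutomatonCode PairCode × ℕ × List (Option LetterCode) =>
      x.2.2.foldl (fun t b => x.1.stepNat t (none, b)) x.2.1 := by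
  have h : Primrec fun y : (AutomatonCode PairCode × ℕ × List (Option LetterCode)) ×
      (ℕ × Option LetterCode) => y.1.1.stepNat y.2.1 (none, y.2.2) :=
    AutomatonCode.primrec_stepNat (Primrec.fst.comp Primrec.fst) (Primrec.fst.comp Primrec.snd)
      ((Primrec.const none).pair (Primrec.snd.comp Primrec.snd))
  have h2 := h.to₂
  have h3 := Primrec.list_foldl
    (f := fun x : AutomatonCode PairCode × ℕ × List (Option LetterCode) => x.2.2)
    (g := fun x => x.2.1) (h := fun x tb => x.1.stepNat tb.1 (none, tb.2))
    (Primrec.snd.comp Primrec.snd) (Primrec.fst.comp Primrec.snd) h2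
  exact h3

theorem semiDec_total_transition : SemiDec fun x :
    (ℕ × AutomatonCode PairCode) × LetterCode × List ℕ × List ℕ =>
    ∀ t' ∈ x.2.2.2, ∃ t ∈ x.2.2.1, ∃ b ∈ optionCodes x.1.1,
      t' = x.1.2.stepNat t (some x.2.1, b) := by
  refine SemiDec.ball (p := fun y : ((ℕ × AutomatonCode PairCode) × LetterCode × List ℕ × List ℕ) ×
      ℕ =>
    ∃ t ∈ y.1.2.2.1, ∃ b ∈ optionCodes y.1.1.1, y.2 = y.1.1.2.stepNat t (some y.1.2.1, b))
    (l := fun x => x.2.2.2) ?_ (Primrec.snd.comp (Primrec.snd.comp Primrec.snd))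
  refine SemiDec.bex (p := fun y : (((ℕ × AutomatonCode PairCode) × LetterCode × List ℕ × List ℕ) ×
      ℕ) × ℕ =>
    ∃ b ∈ optionCodes y.1.1.1.1, y.1.2 = y.1.1.1.2.stepNat y.2 (some y.1.1.2.1, b))
    (l := fun y => y.1.2.2.1) ?_
    (Primrec.fst.comp (Primrec.snd.comp (Primrec.snd.comp Primrec.fst)))
  refine SemiDec.bex (p := fun y : ((((ℕ × AutomatonCode PairCode) × LetterCode × List ℕ × List ℕ) ×
      ℕ) × ℕ) × Option LetterCode => y.1.1.2 = y.1.1.1.1.2.stepNat y.1.2 (some y.1.1.1.2.1, y.2))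
    (l := fun y => optionCodes y.1.1.1.1) (SemiDec.of_primrecPred ?_)
    (primrec_optionCodes.comp (Primrec.fst.comp (Primrec.fst.comp (Primrec.fst.comp Primrec.fst))))
  have f3 : Primrec fun y : ((((ℕ × AutomatonCode PairCode) × LetterCode × List ℕ × List ℕ) ×
      ℕ) × ℕ) × Option LetterCode => y.1.1.1 := Primrec.fst.comp (Primrec.fst.comp Primrec.fst)
  have h := AutomatonCode.primrec_stepNat (Primrec.snd.comp (Primrec.fst.comp f3))
    (Primrec.snd.comp Primrec.fst)
    ((Primrec.option_some.comp (Primrec.fst.comp (Primrec.snd.comp f3))).pair Primrec.snd)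
  exact Primrec.eq.comp (Primrec.snd.comp (Primrec.fst.comp Primrec.fst)) h

theorem semiDec_isTotalCode : SemiDec fun P :
    ℕ × AutomatonCode PairCode × AutomatonCode LetterCode =>
    IsTotalCode P.1 P.2.1 P.2.2 := by
  have h := SemiDec.invariant
    (start := fun x : (ℕ × AutomatonCode PairCode × AutomatonCode LetterCode) × (ℕ × List ℕ) =>
      x.2.1 = x.1.2.2.startNat ∧ ∀ t ∈ x.2.2, t = x.1.2.1.startNat)
    (ok := fun x => x.1.2.2.acceptsState x.2.1 = false ∨ ∃ t ∈ x.2.2,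
      ∃ y : List (Option LetterCode), (∀ b ∈ y, b ∈ optionCodes x.1.1) ∧
        x.1.2.1.acceptsState (y.foldl (fun t b => x.1.2.1.stepNat t (none, b)) t) = true)
    (trans := fun x : (ℕ × AutomatonCode PairCode × AutomatonCode LetterCode) × (ℕ × List ℕ) ×
        LetterCode × (ℕ × List ℕ) => x.2.2.2.1 = x.1.2.2.stepNat x.2.1.1 x.2.2.1 ∧
      ∀ t' ∈ x.2.2.2.2, ∃ t ∈ x.2.1.2, ∃ b ∈ optionCodes x.1.1,
        t' = x.1.2.1.stepNat t (some x.2.2.1, b))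
    (letters := fun P => letterCodes P.1) ?_ ?_ ?_ (primrec_letterCodes.comp Primrec.fst)
  · exact h.of_iff fun P => isTotalCode_iff _ _ _
  · refine SemiDec.and (SemiDec.of_primrecPred (Primrec.eq.comp (Primrec.fst.comp Primrec.snd)
      (AutomatonCode.primrec_startNat.comp (Primrec.snd.comp (Primrec.snd.comp Primrec.fst))))) ?_
    refine SemiDec.ball (p := fun y : ((ℕ × AutomatonCode PairCode × AutomatonCode LetterCode) ×
      (ℕ × List ℕ)) × ℕ => y.2 = y.1.1.2.1.startNat) (l := fun y => y.2.2)
      (SemiDec.of_primrecPred (Primrec.eq.comp Primrec.snd (AutomatonCode.primrec_startNat.comp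
        (Primrec.fst.comp (Primrec.snd.comp (Primrec.fst.comp Primrec.fst))))))
      (Primrec.snd.comp Primrec.snd)
  · refine SemiDec.or (SemiDec.of_primrecPred (Primrec.eq.comp (AutomatonCode.primrec_acceptsState
      (Primrec.snd.comp (Primrec.snd.comp Primrec.fst)) (Primrec.fst.comp Primrec.snd))
      (Primrec.const false))) ?_
    refine SemiDec.bex (p := fun z : ((ℕ × AutomatonCode PairCode × AutomatonCode LetterCode) ×
      (ℕ × List ℕ)) × ℕ => ∃ y : List (Option LetterCode), (∀ b ∈ y, b ∈ optionCodes z.1.1.1) ∧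
        z.1.1.2.1.acceptsState (y.foldl (fun t b => z.1.1.2.1.stepNat t (none, b)) z.2) = true)
      (l := fun y => y.2.2) ?_ (Primrec.snd.comp Primrec.snd)
    refine SemiDec.ex (p := fun z : (((ℕ × AutomatonCode PairCode × AutomatonCode LetterCode) ×
      (ℕ × List ℕ)) × ℕ) × List (Option LetterCode) =>
        (∀ b ∈ z.2, b ∈ optionCodes z.1.1.1.1) ∧ z.1.1.1.2.1.acceptsState
          (z.2.foldl (fun t b => z.1.1.1.2.1.stepNat t (none, b)) z.1.2) = true)
      (SemiDec.of_primrecPred (PrimrecPred.and ?_ ?_))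
    · refine PrimrecPred.ball (p := fun z : ((((ℕ × AutomatonCode PairCode ×
        AutomatonCode LetterCode) × (ℕ × List ℕ)) × ℕ) × List (Option LetterCode)) ×
          Option LetterCode => z.2 ∈ optionCodes z.1.1.1.1.1) (l := fun z => z.2) ?_ Primrec.snd
      refine (PrimrecPred.bex (p := fun z : (((((ℕ × AutomatonCode PairCode ×
        AutomatonCode LetterCode) × (ℕ × List ℕ)) × ℕ) × List (Option LetterCode)) ×
          Option LetterCode) × Option LetterCode => z.1.2 = z.2)
        (l := fun z => optionCodes z.1.1.1.1.1) (Primrec.eq.comp (Primrec.snd.comp Primrec.fst)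
          Primrec.snd) (primrec_optionCodes.comp (Primrec.fst.comp (Primrec.fst.comp
            (Primrec.fst.comp (Primrec.fst.comp Primrec.fst)))))).of_eq fun z => ?_
      simp
    · have c : Primrec fun z : (((ℕ × AutomatonCode PairCode × AutomatonCode LetterCode) ×
          (ℕ × List ℕ)) × ℕ) × List (Option LetterCode) => z.1.1.1.2.1 :=
        Primrec.fst.comp (Primrec.snd.comp (Primrec.fst.comp (Primrec.fst.comp Primrec.fst)))
      refine Primrec.eq.comp (AutomatonCode.primrec_acceptsState c ?_) (Primrec.const true)
      have h1 : Primrec fun z : (((ℕ × AutomatonCode PairCode × AutomatonCode LetterCode) ×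
          (ℕ × List ℕ)) × ℕ) × List (Option LetterCode) => (z.1.1.1.2.1, z.1.2, z.2) :=
        c.pair ((Primrec.snd.comp Primrec.fst).pair Primrec.snd)
      have h2 := primrec_foldl_right_track.comp h1
      exact h2
  · have t : Primrec fun x : (ℕ × AutomatonCode PairCode × AutomatonCode LetterCode) ×
        (ℕ × List ℕ) × LetterCode × (ℕ × List ℕ) => x.2.2.2 :=
      Primrec.snd.comp (Primrec.snd.comp Primrec.snd)
    have a : Primrec fun x : (ℕ × AutomatonCode PairCode × AutomatonCode LetterCode) ×
        (ℕ × List ℕ) × LetterCode × (ℕ × List ℕ) => x.2.2.1 :=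
      Primrec.fst.comp (Primrec.snd.comp Primrec.snd)
    have s : Primrec fun x : (ℕ × AutomatonCode PairCode × AutomatonCode LetterCode) ×
        (ℕ × List ℕ) × LetterCode × (ℕ × List ℕ) => x.2.1 := Primrec.fst.comp Primrec.snd
    have m : Primrec fun x : (ℕ × AutomatonCode PairCode × AutomatonCode LetterCode) ×
        (ℕ × List ℕ) × LetterCode × (ℕ × List ℕ) => x.1.2.2 :=
      Primrec.snd.comp (Primrec.snd.comp Primrec.fst)
    have h1 := AutomatonCode.primrec_stepNat m (Primrec.fst.comp s) a
    refine SemiDec.and (SemiDec.of_primrecPred (Primrec.eq.comp (Primrec.fst.comp t) h1)) ?_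
    exact semiDec_total_transition.comp (((Primrec.fst.comp Primrec.fst).pair
      (Primrec.fst.comp (Primrec.snd.comp Primrec.fst))).pair
      (a.pair ((Primrec.snd.comp s).pair (Primrec.snd.comp t))))

/-! ### Certificates of correctness -/

namespace ParallelRun

/-- The property `φ` of the automata holds for all triples of words. -/
def Holds (φ : Bits → Bool) (P : Params) : Prop :=
  ∀ u v w : List LetterCode, (∀ c ∈ u, c ∈ letterCodes P.1) →
    (∀ c ∈ v, c ∈ letterCodes P.1) → (∀ c ∈ w, c ∈ letterCodes P.1) → φ (bits P u v w) = true

theorem semiDec_holds (φ : Bits → Bool) {β : Type*} [Primcodable β] {n : β → ℕ}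
    {X Y Z : β → AutomatonCode PairCode} {app : β → Option LetterCode}
    {m m' : β → AutomatonCode LetterCode} (hn : Primrec n) (hX : Primrec X) (hY : Primrec Y)
    (hZ : Primrec Z) (happ : Primrec app) (hm : Primrec m) (hm' : Primrec m') :
    SemiDec fun x => Holds φ (n x, (X x, Y x, Z x), app x, (m x, m' x)) := by
  have h1 : Primrec fun x => ((n x, (X x, Y x, Z x), app x, (m x, m' x)) : Params) :=
    hn.pair ((hX.pair (hY.pair hZ)).pair (happ.pair (hm.pair hm')))
  have h2 := (semiDec_forall_code φ).comp h1
  exact h2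

end ParallelRun

section Certificate

open ParallelRun

/-- `(u, v) ∈ X` and `(v, w) ∈ Y` imply `(u a, w) ∈ Z`, where the letter `a` is optional. -/
def ComposesInto (n : ℕ) (app : Option LetterCode) (X Y Z : AutomatonCode PairCode) : Prop :=
  Holds (fun b => !b.1.1 || !b.1.2.1 || b.1.2.2)
    (n, (X, Y, Z), app, ((0, 0, [], []), (0, 0, [], [])))

/-- `(u, v) ∈ X` implies that `u ∈ m` and `v ∈ m`. -/
def RelatesWords (n : ℕ) (X : AutomatonCode PairCode) (m : AutomatonCode LetterCode) : Prop :=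
  Holds (fun b => !b.1.1 || (b.2.1 && b.2.2.1)) (n, (X, X, X), none, (m, m))

/-- `(u, v) ∈ X` and `u ∈ m` imply `u = v`. -/
def FixesWords (n : ℕ) (X : AutomatonCode PairCode) (m : AutomatonCode LetterCode) : Prop :=
  Holds (fun b => !b.1.1 || !b.2.1 || b.2.2.2) (n, (X, X, X), none, (m, m))

/-- `(u, v) ∈ X` if and only if `u = v ∈ m`. -/
def IsDiagonal (n : ℕ) (X : AutomatonCode PairCode) (m : AutomatonCode LetterCode) : Prop :=
  Holds (fun b => b.1.1 == (b.2.1 && b.2.2.2)) (n, (X, X, X), none, (m, m))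

/-- `(u, v) ∈ X` implies that `u ∈ m` if and only if `v ∈ m`. -/
def PreservesWords (n : ℕ) (X : AutomatonCode PairCode) (m : AutomatonCode LetterCode) : Prop :=
  Holds (fun b => !b.1.1 || (b.2.1 == b.2.2.1)) (n, (X, X, X), none, (m, m))

/-- The words of `m` are words of `m'`. -/
def IsSubautomaton (n : ℕ) (m m' : AutomatonCode LetterCode) : Prop :=
  Holds (fun b => !b.2.2.2 || !b.2.1 || b.2.2.1)
    (n, ((0, 0, [], []), (0, 0, [], []), (0, 0, [], [])), none, (m, m'))

/-- All accepted words of columns are padded pairs. -/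
def IsPadded (n : ℕ) (X : AutomatonCode PairCode) : Prop :=
  ∀ z : List PairCode, (∀ a ∈ z, a ∈ pairCodes n) → X.acceptsState (X.run z) = true →
    ∃ u v, z = padPair u v

/-- The multiplier automaton of a letter in an output. -/
def AlgOutput.multiplier (o : AlgOutput) (b : LetterCode) : AutomatonCode PairCode :=
  cond b.2 (o.2.2.1.getD b.1 ((0, 0, [], []), (0, 0, [], []))).1
    (o.2.2.1.getD b.1 ((0, 0, [], []), (0, 0, [], []))).2

/-- The conditions on the multiplier automaton of the letter `b`: it relates words `u`, `v` of the
language only if `π(u) b = π(v)`, every word is related to some word, multiplication by `b` and then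
by `b⁻¹` is trivial, and `Y`, which follows the orbit of the word for `1`, is closed under `b`. -/
def LetterCertified (I : AlgInput) (o : AlgOutput) (Y : AutomatonCode PairCode)
    (b : LetterCode) : Prop :=
  IsPadded I.1 (o.multiplier b) ∧ RelatesWords I.1 (o.multiplier b) o.1 ∧
    (∃ C, IsLabelling pairCodes (fun p => p.1.toList) (fun p => p.2.toList) (I.1, I.2.1, [])
      (o.multiplier b) [(b.1, !b.2)] C) ∧
    IsTotalCode I.1 (o.multiplier b) o.1 ∧
    ComposesInto I.1 none (o.multiplier b) (o.multiplier (b.1, !b.2)) o.2.1 ∧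
    ComposesInto I.1 (some b) Y (o.multiplier b) Y

/-- In a list of words with pair automata, every automaton contains the multiplication by its
word. -/
def WordsCertified (n : ℕ) (o : AlgOutput)
    (W : List (List LetterCode × AutomatonCode PairCode)) : Prop :=
  ∀ p ∈ W, (p.1 = [] ∧ p.2 = o.2.1) ∨ ∃ p' ∈ W, ∃ b ∈ letterCodes n,
    p.1 = p'.1 ++ [b] ∧ ComposesInto n none p'.2 (o.multiplier b) p.2

/-- The conditions that make the output `o` correct for the input `I`. The certificate consists of
automata `W` for the multiplication by the prefixes of relators and of generators of the subgroup,
an automaton `Y` that contains, for all words `p`, the pair of `p` and the word obtained by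
multiplying the word `w₀` for `1` by the letters of `p`. -/
def Certified (I : AlgInput) (o : AlgOutput) (W : List (List LetterCode × AutomatonCode PairCode))
    (Y : AutomatonCode PairCode) (w₀ : List LetterCode) : Prop :=
  (o.2.2.1.length = I.1 ∧ ∀ b ∈ letterCodes I.1, LetterCertified I o Y b) ∧
  (IsPadded I.1 o.2.1 ∧ IsDiagonal I.1 o.2.1 o.1) ∧
  (WordsCertified I.1 o W ∧ (∀ r ∈ I.2.1, ∃ p ∈ W, p.1 = r ∧ FixesWords I.1 p.2 o.1) ∧
    ∀ v ∈ I.2.2, ∃ p ∈ W, p.1 = v ∧ PreservesWords I.1 p.2 o.2.2.2) ∧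
  (o.1.acceptsState (o.1.run w₀) = true ∧ Y.acceptsState (Y.run (padPair [] w₀)) = true ∧
    o.2.2.2.acceptsState (o.2.2.2.run w₀) = true ∧ MemCode ((I.1, I.2.1, []), w₀)) ∧
  FixesWords I.1 Y o.1 ∧
  (IsSubautomaton I.1 o.2.2.2 o.1 ∧
    ∃ C, IsLabelling letterCodes (fun _ => []) (fun a => [a]) I o.2.2.2 [] C)

theorem primrec_multiplier {β : Type*} [Primcodable β] {o : β → AlgOutput} {b : β → LetterCode}
    (ho : Primrec o) (hb : Primrec b) : Primrec fun x => (o x).multiplier (b x) := by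
  have h1 : Primrec fun x => (o x).2.2.1 := Primrec.fst.comp (Primrec.snd.comp (Primrec.snd.comp ho))
  have h2 := (Primrec.list_getD (α := AutomatonCode PairCode × AutomatonCode PairCode)
    ((0, 0, [], []), (0, 0, [], []))).comp h1 (Primrec.fst.comp hb)
  exact Primrec.cond (Primrec.snd.comp hb) (Primrec.fst.comp h2) (Primrec.snd.comp h2)

theorem primrec_run {β : Type*} [Primcodable β] {α : Type} [DecidableEq α] [Primcodable α]
    {c : β → AutomatonCode α} {w : β → List α} (hc : Primrec c) (hw : Primrec w) :
    Primrec fun x => (c x).run (w x) := by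
  have h : Primrec fun y : β × (ℕ × α) => (c y.1).stepNat y.2.1 y.2.2 :=
    AutomatonCode.primrec_stepNat (hc.comp Primrec.fst) (Primrec.fst.comp Primrec.snd)
      (Primrec.snd.comp Primrec.snd)
  have h2 := h.to₂
  have h3 := Primrec.list_foldl (f := w) (g := fun x => (c x).startNat)
    (h := fun x tb => (c x).stepNat tb.1 tb.2) hw (AutomatonCode.primrec_startNat.comp hc) h2
  exact h3

theorem primrec_padPair_nil : Primrec fun w : List LetterCode => padPair [] w := by
  have h : Primrec fun w : List LetterCode => w.map fun b => ((none, some b) : PairCode) :=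
    Primrec.list_map Primrec.id
      ((Primrec.const none).pair (Primrec.option_some.comp Primrec.snd)).to₂
  refine h.of_eq fun w => ?_
  induction w with
  | nil => rfl
  | cons a w ih => rw [padPair_nil_cons, ← ih, List.map_cons]

theorem semiDec_letterCertified : SemiDec fun x :
    ((AlgInput × AlgOutput) × AutomatonCode PairCode) × LetterCode =>
    LetterCertified x.1.1.1 x.1.1.2 x.1.2 x.2 := by
  have hI : Primrec fun x : ((AlgInput × AlgOutput) × AutomatonCode PairCode) × LetterCode =>
      x.1.1.1 := Primrec.fst.comp (Primrec.fst.comp Primrec.fst)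
  have hn : Primrec fun x : ((AlgInput × AlgOutput) × AutomatonCode PairCode) × LetterCode =>
      x.1.1.1.1 := Primrec.fst.comp hI
  have ho : Primrec fun x : ((AlgInput × AlgOutput) × AutomatonCode PairCode) × LetterCode =>
      x.1.1.2 := Primrec.snd.comp (Primrec.fst.comp Primrec.fst)
  have hM : Primrec fun x : ((AlgInput × AlgOutput) × AutomatonCode PairCode) × LetterCode =>
      x.1.1.2.1 := Primrec.fst.comp ho
  have hE : Primrec fun x : ((AlgInput × AlgOutput) × AutomatonCode PairCode) × LetterCode =>
      x.1.1.2.2.1 := Primrec.fst.comp (Primrec.snd.comp ho)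
  have hY : Primrec fun x : ((AlgInput × AlgOutput) × AutomatonCode PairCode) × LetterCode =>
      x.1.2 := Primrec.snd.comp Primrec.fst
  have hb : Primrec fun x : ((AlgInput × AlgOutput) × AutomatonCode PairCode) × LetterCode =>
      x.2 := Primrec.snd
  have hb' := primrec_codeInv.comp hb
  have hX := primrec_multiplier ho hb
  have hX' := primrec_multiplier ho hb'
  have h0 : Primrec fun _ : ((AlgInput × AlgOutput) × AutomatonCode PairCode) × LetterCode =>
      ((0, 0, [], []) : AutomatonCode LetterCode) := Primrec.const _
  have hI' : Primrec fun x : ((AlgInput × AlgOutput) × AutomatonCode PairCode) × LetterCode =>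
      ((x.1.1.1.1, x.1.1.1.2.1, []) : AlgInput) :=
    hn.pair ((Primrec.fst.comp (Primrec.snd.comp hI)).pair (Primrec.const []))
  have hx := Primrec.list_cons.comp hb' (Primrec.const [])
  have hl := semiDec_exists_isLabelling primrec_pairCodes
    (Primrec.optionToList.comp Primrec.fst) (Primrec.optionToList.comp Primrec.snd)
  have c1 := semiDec_accepts_padded.comp (hn.pair hX)
  have c2 := semiDec_holds (fun b => !b.1.1 || (b.2.1 && b.2.2.1)) hn hX hX hX
    (Primrec.const none) hM hM
  have c3 := hl.comp (hI'.pair (hX.pair hx))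
  have c4 := semiDec_isTotalCode.comp (hn.pair (hX.pair hM))
  have c5 := semiDec_holds (fun b => !b.1.1 || !b.1.2.1 || b.1.2.2) hn hX hX' hE
    (Primrec.const none) h0 h0
  have c6 := semiDec_holds (fun b => !b.1.1 || !b.1.2.1 || b.1.2.2) hn hY hX hY
    (Primrec.option_some.comp hb) h0 h0
  exact c1.and (c2.and (c3.and (c4.and (c5.and c6))))

theorem semiDec_wordsCertified : SemiDec fun x :
    (AlgInput × AlgOutput) × List (List LetterCode × AutomatonCode PairCode) =>
    WordsCertified x.1.1.1 x.1.2 x.2 := by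
  refine SemiDec.ball (p := fun y : ((AlgInput × AlgOutput) × List (List LetterCode ×
    AutomatonCode PairCode)) × (List LetterCode × AutomatonCode PairCode) =>
    (y.2.1 = [] ∧ y.2.2 = y.1.1.2.2.1) ∨ ∃ p' ∈ y.1.2, ∃ b ∈ letterCodes y.1.1.1.1,
      y.2.1 = p'.1 ++ [b] ∧ ComposesInto y.1.1.1.1 none p'.2 (y.1.1.2.multiplier b) y.2.2)
    (l := fun x => x.2) (SemiDec.or ?_ ?_) Primrec.snd
  · refine SemiDec.of_primrecPred (PrimrecPred.and ?_ ?_)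
    · exact Primrec.eq.comp (Primrec.fst.comp Primrec.snd) (Primrec.const [])
    · exact Primrec.eq.comp (Primrec.snd.comp Primrec.snd) (Primrec.fst.comp (Primrec.snd.comp
        (Primrec.snd.comp (Primrec.fst.comp Primrec.fst))))
  · refine SemiDec.bex (p := fun y : (((AlgInput × AlgOutput) × List (List LetterCode ×
      AutomatonCode PairCode)) × (List LetterCode × AutomatonCode PairCode)) ×
        (List LetterCode × AutomatonCode PairCode) => ∃ b ∈ letterCodes y.1.1.1.1.1,
        y.1.2.1 = y.2.1 ++ [b] ∧
          ComposesInto y.1.1.1.1.1 none y.2.2 (y.1.1.1.2.multiplier b) y.1.2.2)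
      (l := fun y => y.1.2) ?_ (Primrec.snd.comp Primrec.fst)
    refine SemiDec.bex (p := fun y : ((((AlgInput × AlgOutput) × List (List LetterCode ×
      AutomatonCode PairCode)) × (List LetterCode × AutomatonCode PairCode)) ×
        (List LetterCode × AutomatonCode PairCode)) × LetterCode =>
        y.1.1.2.1 = y.1.2.1 ++ [y.2] ∧
          ComposesInto y.1.1.1.1.1.1 none y.1.2.2 (y.1.1.1.1.2.multiplier y.2) y.1.1.2.2)
      (l := fun y => letterCodes y.1.1.1.1.1) ?_
      (primrec_letterCodes.comp (Primrec.fst.comp (Primrec.fst.comp (Primrec.fst.comp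
        (Primrec.fst.comp Primrec.fst)))))
    have f1 : Primrec fun y : ((((AlgInput × AlgOutput) × List (List LetterCode ×
      AutomatonCode PairCode)) × (List LetterCode × AutomatonCode PairCode)) ×
        (List LetterCode × AutomatonCode PairCode)) × LetterCode => y.1.1.1.1 :=
      Primrec.fst.comp (Primrec.fst.comp (Primrec.fst.comp Primrec.fst))
    have f2 : Primrec fun y : ((((AlgInput × AlgOutput) × List (List LetterCode ×
      AutomatonCode PairCode)) × (List LetterCode × AutomatonCode PairCode)) ×
        (List LetterCode × AutomatonCode PairCode)) × LetterCode => y.1.1.2 :=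
      Primrec.snd.comp (Primrec.fst.comp Primrec.fst)
    have f3 : Primrec fun y : ((((AlgInput × AlgOutput) × List (List LetterCode ×
      AutomatonCode PairCode)) × (List LetterCode × AutomatonCode PairCode)) ×
        (List LetterCode × AutomatonCode PairCode)) × LetterCode => y.1.2 :=
      Primrec.snd.comp Primrec.fst
    have h0 : Primrec fun _ : ((((AlgInput × AlgOutput) × List (List LetterCode ×
      AutomatonCode PairCode)) × (List LetterCode × AutomatonCode PairCode)) ×
        (List LetterCode × AutomatonCode PairCode)) × LetterCode =>
        ((0, 0, [], []) : AutomatonCode LetterCode) := Primrec.const _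
    have c1 := Primrec.eq.comp (Primrec.fst.comp f2) (Primrec.list_append.comp
      (Primrec.fst.comp f3) (Primrec.list_cons.comp Primrec.snd (Primrec.const [])))
    have c2 := semiDec_holds (fun b => !b.1.1 || !b.1.2.1 || b.1.2.2)
      (Primrec.fst.comp (Primrec.fst.comp f1)) (Primrec.snd.comp f3)
      (primrec_multiplier (Primrec.snd.comp f1) Primrec.snd) (Primrec.snd.comp f2)
      (Primrec.const none) h0 h0
    exact (SemiDec.of_primrecPred c1).and c2

theorem semiDec_exists_mem_words {φ : Bits → Bool} : SemiDec fun x :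
    (ℕ × AutomatonCode LetterCode) × List (List LetterCode × AutomatonCode PairCode) ×
      List (List LetterCode) =>
    ∀ r ∈ x.2.2, ∃ p ∈ x.2.1, p.1 = r ∧
      Holds φ (x.1.1, (p.2, p.2, p.2), none, (x.1.2, x.1.2)) := by
  refine SemiDec.ball (p := fun y : ((ℕ × AutomatonCode LetterCode) × List (List LetterCode ×
    AutomatonCode PairCode) × List (List LetterCode)) × List LetterCode => ∃ p ∈ y.1.2.1,
      p.1 = y.2 ∧ Holds φ (y.1.1.1, (p.2, p.2, p.2), none, (y.1.1.2, y.1.1.2)))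
    (l := fun x => x.2.2) ?_ (Primrec.snd.comp Primrec.snd)
  refine SemiDec.bex (p := fun y : (((ℕ × AutomatonCode LetterCode) × List (List LetterCode ×
    AutomatonCode PairCode) × List (List LetterCode)) × List LetterCode) ×
      (List LetterCode × AutomatonCode PairCode) => y.2.1 = y.1.2 ∧ Holds φ (y.1.1.1.1,
      (y.2.2, y.2.2, y.2.2), none, (y.1.1.1.2, y.1.1.1.2))) (l := fun y => y.1.2.1) ?_
    (Primrec.fst.comp (Primrec.snd.comp Primrec.fst))
  have f1 : Primrec fun y : (((ℕ × AutomatonCode LetterCode) × List (List LetterCode ×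
    AutomatonCode PairCode) × List (List LetterCode)) × List LetterCode) ×
      (List LetterCode × AutomatonCode PairCode) => y.1.1.1 :=
    Primrec.fst.comp (Primrec.fst.comp Primrec.fst)
  have f2 : Primrec fun y : (((ℕ × AutomatonCode LetterCode) × List (List LetterCode ×
    AutomatonCode PairCode) × List (List LetterCode)) × List LetterCode) ×
      (List LetterCode × AutomatonCode PairCode) => y.2.2 := Primrec.snd.comp Primrec.snd
  have c1 := Primrec.eq.comp (Primrec.fst.comp (Primrec.snd (α := ((ℕ × AutomatonCode LetterCode) ×
    List (List LetterCode × AutomatonCode PairCode) × List (List LetterCode)) × List LetterCode)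
    (β := List LetterCode × AutomatonCode PairCode))) (Primrec.snd.comp Primrec.fst)
  have c2 := semiDec_holds φ (Primrec.fst.comp f1) f2 f2 f2 (Primrec.const none)
    (Primrec.snd.comp f1) (Primrec.snd.comp f1)
  exact (SemiDec.of_primrecPred c1).and c2

theorem semiDec_exists_certified : SemiDec fun x : AlgInput × AlgOutput =>
    ∃ c : List (List LetterCode × AutomatonCode PairCode) × AutomatonCode PairCode ×
      List LetterCode, Certified x.1 x.2 c.1 c.2.1 c.2.2 := by
  refine SemiDec.ex (p := fun y : (AlgInput × AlgOutput) × List (List LetterCode ×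
    AutomatonCode PairCode) × AutomatonCode PairCode × List LetterCode =>
      Certified y.1.1 y.1.2 y.2.1 y.2.2.1 y.2.2.2) ?_
  have hIo : Primrec fun y : (AlgInput × AlgOutput) × List (List LetterCode ×
    AutomatonCode PairCode) × AutomatonCode PairCode × List LetterCode => y.1 := Primrec.fst
  have hI : Primrec fun y : (AlgInput × AlgOutput) × List (List LetterCode ×
    AutomatonCode PairCode) × AutomatonCode PairCode × List LetterCode => y.1.1 :=
    Primrec.fst.comp hIo
  have hn : Primrec fun y : (AlgInput × AlgOutput) × List (List LetterCode ×
    AutomatonCode PairCode) × AutomatonCode PairCode × List LetterCode => y.1.1.1 :=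
    Primrec.fst.comp hI
  have hR : Primrec fun y : (AlgInput × AlgOutput) × List (List LetterCode ×
    AutomatonCode PairCode) × AutomatonCode PairCode × List LetterCode => y.1.1.2.1 :=
    Primrec.fst.comp (Primrec.snd.comp hI)
  have hV : Primrec fun y : (AlgInput × AlgOutput) × List (List LetterCode ×
    AutomatonCode PairCode) × AutomatonCode PairCode × List LetterCode => y.1.1.2.2 :=
    Primrec.snd.comp (Primrec.snd.comp hI)
  have ho : Primrec fun y : (AlgInput × AlgOutput) × List (List LetterCode ×
    AutomatonCode PairCode) × AutomatonCode PairCode × List LetterCode => y.1.2 :=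
    Primrec.snd.comp hIo
  have hM : Primrec fun y : (AlgInput × AlgOutput) × List (List LetterCode ×
    AutomatonCode PairCode) × AutomatonCode PairCode × List LetterCode => y.1.2.1 :=
    Primrec.fst.comp ho
  have hE : Primrec fun y : (AlgInput × AlgOutput) × List (List LetterCode ×
    AutomatonCode PairCode) × AutomatonCode PairCode × List LetterCode => y.1.2.2.1 :=
    Primrec.fst.comp (Primrec.snd.comp ho)
  have hMx : Primrec fun y : (AlgInput × AlgOutput) × List (List LetterCode ×
    AutomatonCode PairCode) × AutomatonCode PairCode × List LetterCode => y.1.2.2.2.1 :=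
    Primrec.fst.comp (Primrec.snd.comp (Primrec.snd.comp ho))
  have hMH : Primrec fun y : (AlgInput × AlgOutput) × List (List LetterCode ×
    AutomatonCode PairCode) × AutomatonCode PairCode × List LetterCode => y.1.2.2.2.2 :=
    Primrec.snd.comp (Primrec.snd.comp (Primrec.snd.comp ho))
  have hW : Primrec fun y : (AlgInput × AlgOutput) × List (List LetterCode ×
    AutomatonCode PairCode) × AutomatonCode PairCode × List LetterCode => y.2.1 :=
    Primrec.fst.comp Primrec.snd
  have hY : Primrec fun y : (AlgInput × AlgOutput) × List (List LetterCode ×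
    AutomatonCode PairCode) × AutomatonCode PairCode × List LetterCode => y.2.2.1 :=
    Primrec.fst.comp (Primrec.snd.comp Primrec.snd)
  have hw : Primrec fun y : (AlgInput × AlgOutput) × List (List LetterCode ×
    AutomatonCode PairCode) × AutomatonCode PairCode × List LetterCode => y.2.2.2 :=
    Primrec.snd.comp (Primrec.snd.comp Primrec.snd)
  have h0 : Primrec fun _ : (AlgInput × AlgOutput) × List (List LetterCode ×
    AutomatonCode PairCode) × AutomatonCode PairCode × List LetterCode =>
      ((0, 0, [], []) : AutomatonCode PairCode) := Primrec.const _
  have hnone : Primrec fun _ : (AlgInput × AlgOutput) × List (List LetterCode ×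
    AutomatonCode PairCode) × AutomatonCode PairCode × List LetterCode =>
      (none : Option LetterCode) := Primrec.const _
  have c1 := SemiDec.of_primrecPred (Primrec.eq.comp (Primrec.list_length.comp hMx) hn)
  have c2 : SemiDec fun y : (AlgInput × AlgOutput) × List (List LetterCode ×
    AutomatonCode PairCode) × AutomatonCode PairCode × List LetterCode =>
      ∀ b ∈ letterCodes y.1.1.1, LetterCertified y.1.1 y.1.2 y.2.2.1 b :=
    SemiDec.ball (p := fun z : ((AlgInput × AlgOutput) × List (List LetterCode ×
      AutomatonCode PairCode) × AutomatonCode PairCode × List LetterCode) × LetterCode =>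
      LetterCertified z.1.1.1 z.1.1.2 z.1.2.2.1 z.2)
      (semiDec_letterCertified.comp (((hIo.comp Primrec.fst).pair (hY.comp Primrec.fst)).pair
        Primrec.snd)) (primrec_letterCodes.comp hn)
  have c3 := semiDec_accepts_padded.comp (hn.pair hE)
  have c4 := semiDec_holds (fun b => b.1.1 == (b.2.1 && b.2.2.2)) hn hE hE hE hnone hM hM
  have c5 := semiDec_wordsCertified.comp (hIo.pair hW)
  have c6 := (semiDec_exists_mem_words (φ := fun b => !b.1.1 || !b.2.1 || b.2.2.2)).comp
    ((hn.pair hM).pair (hW.pair hR))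
  have c7 := (semiDec_exists_mem_words (φ := fun b => !b.1.1 || (b.2.1 == b.2.2.1))).comp
    ((hn.pair hMH).pair (hW.pair hV))
  have c8 := SemiDec.of_primrecPred (Primrec.eq.comp (AutomatonCode.primrec_acceptsState hM
    (primrec_run hM hw)) (Primrec.const true))
  have c9 := SemiDec.of_primrecPred (Primrec.eq.comp (AutomatonCode.primrec_acceptsState hY
    (primrec_run hY (primrec_padPair_nil.comp hw))) (Primrec.const true))
  have c10 := SemiDec.of_primrecPred (Primrec.eq.comp (AutomatonCode.primrec_acceptsState hMH
    (primrec_run hMH hw)) (Primrec.const true))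
  have c11 := semiDec_memCode.comp ((hn.pair (hR.pair (Primrec.const []))).pair hw)
  have c12 := semiDec_holds (fun b => !b.1.1 || !b.2.1 || b.2.2.2) hn hY hY hY hnone hM hM
  have c13 := semiDec_holds (fun b => !b.2.2.2 || !b.2.1 || b.2.2.1) hn h0 h0 h0 hnone hMH hM
  have hl := semiDec_exists_isLabelling (l := fun _ : LetterCode => []) (r := fun a => [a])
    primrec_letterCodes (Primrec.const []) (Primrec.list_cons.comp Primrec.id (Primrec.const []))
  have c14 := hl.comp (hI.pair (hMH.pair (Primrec.const [])))
  exact (c1.and c2).and ((c3.and c4).and ((c5.and (c6.and c7)).and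
    ((c8.and (c9.and (c10.and c11))).and (c12.and (c13.and c14)))))

end Certificate

/-! ### The meaning of the conditions of a certificate -/

section Meaning

open ParallelRun

variable {n : ℕ}

theorem holds_iff (φ : Bits → Bool) (X : AutomatonCode PairCode × AutomatonCode PairCode ×
    AutomatonCode PairCode) (app : Option (Letter n))
    (m : AutomatonCode LetterCode × AutomatonCode LetterCode)
    [∀ z (c : AutomatonCode PairCode), Decidable (z ∈ pairLanguage n c)]
    [∀ z (c : AutomatonCode LetterCode), Decidable (z ∈ wordLanguage n c)] :
    Holds φ (n, X, app.map codeLetter, m) ↔ ∀ u v w : List (Letter n), φ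
      ((decide (padPair u v ∈ pairLanguage n X.1), decide (padPair v w ∈ pairLanguage n X.2.1),
          decide (padPair (u ++ app.toList) w ∈ pairLanguage n X.2.2)),
        (decide (u ∈ wordLanguage n m.1), decide (v ∈ wordLanguage n m.2), decide (u = v)))
      = true := by
  unfold Holds
  rw [forall_code_iff n X app m fun b => φ b = true]
  simp only [bits_map]

theorem composesInto_iff {app : Option (Letter n)} {X Y Z : AutomatonCode PairCode} :
    ComposesInto n (app.map codeLetter) X Y Z ↔ ∀ u v w, padPair u v ∈ pairLanguage n X →
      padPair v w ∈ pairLanguage n Y → padPair (u ++ app.toList) w ∈ pairLanguage n Z := by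
  classical
  rw [ComposesInto, holds_iff]
  refine forall_congr' fun u => forall_congr' fun v => forall_congr' fun w => ?_
  by_cases h1 : padPair u v ∈ pairLanguage n X <;>
    by_cases h2 : padPair v w ∈ pairLanguage n Y <;> simp [h1, h2]

theorem relatesWords_iff {X : AutomatonCode PairCode} {m : AutomatonCode LetterCode} :
    RelatesWords n X m ↔ ∀ u v, padPair u v ∈ pairLanguage n X →
      u ∈ wordLanguage n m ∧ v ∈ wordLanguage n m := by
  classical
  rw [RelatesWords, show (none : Option LetterCode) = (none : Option (Letter n)).map codeLetter from rfl,
    holds_iff]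
  refine forall_congr' fun u => forall_congr' fun v => ?_
  by_cases h1 : padPair u v ∈ pairLanguage n X <;> simp [h1]

theorem fixesWords_iff {X : AutomatonCode PairCode} {m : AutomatonCode LetterCode} :
    FixesWords n X m ↔ ∀ u v, padPair u v ∈ pairLanguage n X →
      u ∈ wordLanguage n m → u = v := by
  classical
  rw [FixesWords, show (none : Option LetterCode) = (none : Option (Letter n)).map codeLetter from rfl,
    holds_iff]
  refine forall_congr' fun u => forall_congr' fun v => ?_
  by_cases h1 : padPair u v ∈ pairLanguage n X <;>
    by_cases h2 : u ∈ wordLanguage n m <;> simp [h1, h2]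

theorem isDiagonal_iff {X : AutomatonCode PairCode} {m : AutomatonCode LetterCode} :
    IsDiagonal n X m ↔ ∀ u v, padPair u v ∈ pairLanguage n X ↔
      u ∈ wordLanguage n m ∧ u = v := by
  classical
  rw [IsDiagonal, show (none : Option LetterCode) = (none : Option (Letter n)).map codeLetter from rfl,
    holds_iff]
  refine forall_congr' fun u => forall_congr' fun v => ?_
  by_cases h1 : padPair u v ∈ pairLanguage n X <;>
    by_cases h2 : u ∈ wordLanguage n m <;> simp [h1, h2]

theorem preservesWords_iff {X : AutomatonCode PairCode} {m : AutomatonCode LetterCode} :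
    PreservesWords n X m ↔ ∀ u v, padPair u v ∈ pairLanguage n X →
      (u ∈ wordLanguage n m ↔ v ∈ wordLanguage n m) := by
  classical
  rw [PreservesWords, show (none : Option LetterCode) = (none : Option (Letter n)).map codeLetter
    from rfl, holds_iff]
  refine forall_congr' fun u => forall_congr' fun v => ?_
  by_cases h1 : padPair u v ∈ pairLanguage n X <;> by_cases h2 : u ∈ wordLanguage n m <;>
    simp [h1, h2]

theorem isSubautomaton_iff {m m' : AutomatonCode LetterCode} :
    IsSubautomaton n m m' ↔ ∀ u ∈ wordLanguage n m, u ∈ wordLanguage n m' := by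
  classical
  rw [IsSubautomaton, show (none : Option LetterCode) = (none : Option (Letter n)).map codeLetter
    from rfl, holds_iff]
  constructor
  · intro h u hu
    simpa [hu] using h u u []
  · intro h u v _
    by_cases huv : u = v
    · subst huv
      by_cases hu : u ∈ wordLanguage n m <;> simp [hu, h u]
    · simp [huv]

theorem isPadded_iff {X : AutomatonCode PairCode} :
    IsPadded n X ↔ ∀ z ∈ pairLanguage n X, ∃ u v, z = padPair u v := by
  constructor
  · intro h z hz
    obtain ⟨u, v, e⟩ := h _ ((forall_mem_iff_exists_map fun c => mem_pairCodes).2 ⟨z, rfl⟩)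
      (mem_pairLanguage.1 hz)
    have hvalid : ∀ (f : PairCode → Option LetterCode) (w : List LetterCode),
        (∀ a ∈ pairCodes n, f a ∈ optionCodes n) → (z.map codePair).filterMap f = w →
        ∃ w' : List (Letter n), w'.map codeLetter = w := by
      rintro f w hf rfl
      refine (forall_mem_iff_exists_map fun c => mem_letterCodes).1 fun c hc => ?_
      obtain ⟨a, ha, hac⟩ := List.mem_filterMap.1 hc
      have h1 := hf a ((forall_mem_iff_exists_map fun c => mem_pairCodes).2 ⟨z, rfl⟩ a ha)
      rwa [hac, some_mem_optionCodes] at h1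
    obtain ⟨u, rfl⟩ := hvalid Prod.fst u (fun a ha => (mem_pairCodes_iff.1 ha).1)
      (by rw [e, filterMap_fst_padPair])
    obtain ⟨v, rfl⟩ := hvalid Prod.snd v (fun a ha => (mem_pairCodes_iff.1 ha).2)
      (by rw [e, filterMap_snd_padPair])
    rw [padPair_map_codeLetter] at e
    exact ⟨u, v, List.map_injective_iff.2 (codePair_injective n) e⟩
  · intro h z hz hacc
    obtain ⟨z, rfl⟩ := (forall_mem_iff_exists_map fun c => mem_pairCodes).1 hz
    obtain ⟨u, v, rfl⟩ := h z (mem_pairLanguage.2 hacc)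
    exact ⟨_, _, (padPair_map_codeLetter u v).symm⟩

theorem filterMap_map_codePair_fst (z : List (Option (Letter n) × Option (Letter n))) :
    (z.map codePair).filterMap Prod.fst = (z.filterMap Prod.fst).map codeLetter := by
  rw [List.filterMap_map, List.map_filterMap]
  rfl

theorem filterMap_map_codePair_snd (z : List (Option (Letter n) × Option (Letter n))) :
    (z.map codePair).filterMap Prod.snd = (z.filterMap Prod.snd).map codeLetter := by
  rw [List.filterMap_map, List.map_filterMap]
  rfl

theorem IsTotalCode.exists_filterMap {c : AutomatonCode PairCode} {m : AutomatonCode LetterCode}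
    (h : IsTotalCode n c m) {u : List (Letter n)} (hu : u ∈ wordLanguage n m) :
    ∃ z ∈ pairLanguage n c, z.filterMap Prod.fst = u := by
  obtain ⟨z, hz, hacc, k, hk⟩ := h _ ((forall_mem_iff_exists_map fun c => mem_letterCodes).2
    ⟨u, rfl⟩) (mem_wordLanguage.1 hu)
  obtain ⟨z, rfl⟩ := (forall_mem_iff_exists_map fun c => mem_pairCodes).1 hz
  refine ⟨z, mem_pairLanguage.2 hacc, ?_⟩
  have h1 : ((z.map codePair).map Prod.fst).reduceOption = u.map codeLetter := by
    rw [hk, List.reduceOption_append, List.reduceOption_replicate_none, List.append_nil]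
    simp [List.reduceOption, List.filterMap_map]
  have h2 : ((z.map codePair).map Prod.fst).reduceOption = (z.map codePair).filterMap Prod.fst := by
    rw [List.reduceOption, List.filterMap_map]
    rfl
  rw [h2, filterMap_map_codePair_fst] at h1
  exact List.map_injective_iff.2 (codeLetter_injective n) h1

theorem map_fst_padPair {α : Type*} (u v : List α) :
    ∃ k, (padPair u v).map Prod.fst = u.map some ++ List.replicate k none := by
  induction u, v using padPair_induction with
  | nil => exact ⟨0, rfl⟩
  | right b v ih =>
    obtain ⟨k, hk⟩ := ih
    exact ⟨k + 1, by simpa [List.replicate_succ] using hk⟩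
  | left a u ih =>
    obtain ⟨k, hk⟩ := ih
    exact ⟨k, by simpa using hk⟩
  | cons a b u v ih =>
    obtain ⟨k, hk⟩ := ih
    exact ⟨k, by simpa using hk⟩

theorem IsTotalCode.of_exists {c : AutomatonCode PairCode} {m : AutomatonCode LetterCode}
    (h : ∀ u ∈ wordLanguage n m, ∃ v, padPair u v ∈ pairLanguage n c) : IsTotalCode n c m := by
  intro u hu hacc
  obtain ⟨u, rfl⟩ := (forall_mem_iff_exists_map fun c => mem_letterCodes).1 hu
  obtain ⟨v, hv⟩ := h u (mem_wordLanguage.2 hacc)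
  refine ⟨_, (forall_mem_iff_exists_map fun c => mem_pairCodes).2 ⟨padPair u v, rfl⟩,
    mem_pairLanguage.1 hv, ?_⟩
  rw [← padPair_map_codeLetter]
  exact map_fst_padPair _ _

variable {R V : List (List (Letter n))}

theorem exists_pair_labelling_iff {X : AutomatonCode PairCode} {a : Letter n} :
    (∃ C, IsLabelling pairCodes (fun p => p.1.toList) (fun p => p.2.toList)
      (n, R.map (List.map codeLetter), []) X [((codeLetter a).1, !(codeLetter a).2)] C) ↔
    ∀ z ∈ pairLanguage n X, wordVal (letterVal n R) (z.filterMap Prod.fst) * letterVal n R a =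
      wordVal (letterVal n R) (z.filterMap Prod.snd) := by
  have hopt : ∀ b : Option LetterCode, b ∈ optionCodes n → ∀ c ∈ b.toList, c ∈ letterCodes n := by
    intro b hb c hc
    rw [Option.mem_toList] at hc
    rw [hc] at hb
    exact some_mem_optionCodes.1 hb
  have key := exists_isLabelling_iff (n := n) (R := R) (V := []) (letters := pairCodes)
    (l := fun p => p.1.toList) (r := fun p => p.2.toList)
    (fun p hp => hopt _ (mem_pairCodes_iff.1 hp).1)
    (fun p hp => hopt _ (mem_pairCodes_iff.1 hp).2) (c := X)
    (x := [((codeLetter a).1, !(codeLetter a).2)]) ?_ ?_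
  · refine key.trans ?_
    have hfl : ∀ (f : PairCode → Option LetterCode) (z : List PairCode),
        z.flatMap (fun p => (f p).toList) = z.filterMap f := by
      intro f z
      induction z with
      | nil => rfl
      | cons p z ih =>
        rw [List.flatMap_cons, ih, List.filterMap_cons]
        cases f p <;> rfl
    constructor
    · intro h z hz
      have h1 := h _ ((forall_mem_iff_exists_map fun c => mem_pairCodes).2 ⟨z, rfl⟩)
        (mem_pairLanguage.1 hz)
      rw [hfl, hfl, filterMap_map_codePair_fst, filterMap_map_codePair_snd, genSubgroup_nil,
        Subgroup.mem_bot, show [((codeLetter a).1, !(codeLetter a).2)] =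
          [(a.1, !a.2)].map codeLetter from rfl] at h1
      simp only [wordVal_map_codeLetter, wordVal_cons, letterVal_not, wordVal_nil, mul_one] at h1
      rw [mul_inv_eq_one, inv_mul_eq_iff_eq_mul] at h1
      exact h1.symm
    · intro h z hz hacc
      obtain ⟨z, rfl⟩ := (forall_mem_iff_exists_map fun c => mem_pairCodes).1 hz
      have h1 := h z (mem_pairLanguage.2 hacc)
      rw [hfl, hfl, filterMap_map_codePair_fst, filterMap_map_codePair_snd, genSubgroup_nil,
        Subgroup.mem_bot, show [((codeLetter a).1, !(codeLetter a).2)] =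
          [(a.1, !a.2)].map codeLetter from rfl]
      simp only [wordVal_map_codeLetter, wordVal_cons, letterVal_not, wordVal_nil, mul_one]
      rw [mul_inv_eq_one, inv_mul_eq_iff_eq_mul, h1]
  · intro p h
    rw [genSubgroup_nil, Subgroup.mem_bot, Subgroup.mem_bot]
    constructor
    · intro e
      have := congrArg (fun g => wordVal (codeVal n R) p.1.toList * g *
        (wordVal (codeVal n R) p.1.toList)⁻¹) e
      simpa [mul_assoc] using this
    · rintro rfl
      simp
  · intro c hc
    rw [List.mem_singleton.1 hc]
    exact mem_letterCodes.2 ⟨(a.1, !a.2), rfl⟩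

theorem exists_word_labelling_iff {m : AutomatonCode LetterCode} :
    (∃ C, IsLabelling letterCodes (fun _ => []) (fun a => [a]) (codeInput n R V) m [] C) ↔
    ∀ w ∈ wordLanguage n m, wordVal (letterVal n R) w ∈ genSubgroup n R V := by
  have hnil : ∀ w : List LetterCode, w.flatMap (fun _ => ([] : List LetterCode)) = [] := by
    simp [List.flatMap_eq_nil_iff]
  have key := exists_isLabelling_iff (n := n) (R := R) (V := V) (letters := letterCodes)
    (l := fun _ => []) (r := fun a => [a]) (by simp) (by simp) (c := m) (x := []) (by simp)
    (by simp)
  refine key.trans ?_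
  constructor
  · intro h w hw
    simpa [hnil] using h _ ((forall_mem_iff_exists_map fun c => mem_letterCodes).2 ⟨w, rfl⟩)
      (mem_wordLanguage.1 hw)
  · intro h w hw hacc
    obtain ⟨w, rfl⟩ := (forall_mem_iff_exists_map fun c => mem_letterCodes).1 hw
    simpa [hnil] using h w (mem_wordLanguage.2 hacc)

end Meaning

/-! ### A certified output is correct -/

section WordPath

variable {n : ℕ}

/-- `v` arises from `u` by applying the relations `X a` for the letters `a` of a word. -/
def WordPath (X : Letter n → List (Letter n) → List (Letter n) → Prop) :
    List (Letter n) → List (Letter n) → List (Letter n) → Prop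
  | [], u, v => u = v
  | a :: w, u, v => ∃ u', X a u u' ∧ WordPath X w u' v

variable {X : Letter n → List (Letter n) → List (Letter n) → Prop} {L : Set (List (Letter n))}

theorem wordPath_append {w w' u v : List (Letter n)} :
    WordPath X (w ++ w') u v ↔ ∃ m, WordPath X w u m ∧ WordPath X w' m v := by
  induction w generalizing u with
  | nil => simp [WordPath]
  | cons a w ih =>
    simp only [List.cons_append, WordPath, ih]
    constructor
    · rintro ⟨u', h, m, h1, h2⟩
      exact ⟨m, ⟨u', h, h1⟩, h2⟩
    · rintro ⟨m, ⟨u', h, h1⟩, h2⟩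
      exact ⟨u', h, m, h1, h2⟩

theorem wordPath_singleton {a : Letter n} {u v : List (Letter n)} : WordPath X [a] u v ↔ X a u v := by
  simp [WordPath]

theorem WordPath.mem (hX : ∀ a u v, X a u v → u ∈ L ∧ v ∈ L) {w u v : List (Letter n)}
    (h : WordPath X w u v) (hu : u ∈ L) : v ∈ L := by
  induction w generalizing u with
  | nil => exact h ▸ hu
  | cons a w ih =>
    obtain ⟨u', h1, h2⟩ := h
    exact ih h2 (hX _ _ _ h1).2

theorem WordPath.exists (hX : ∀ a u v, X a u v → u ∈ L ∧ v ∈ L) (htot : ∀ a, ∀ u ∈ L, ∃ v, X a u v)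
    (w : List (Letter n)) {u : List (Letter n)} (hu : u ∈ L) : ∃ v, WordPath X w u v := by
  induction w generalizing u with
  | nil => exact ⟨u, rfl⟩
  | cons a w ih =>
    obtain ⟨u', h⟩ := htot a u hu
    obtain ⟨v, hv⟩ := ih (hX _ _ _ h).2
    exact ⟨v, u', h, hv⟩

/-- Total relations that are inverse to each other in the sense of `hinv` are functions. -/
theorem WordPath.unique (hX : ∀ a u v, X a u v → u ∈ L ∧ v ∈ L) (htot : ∀ a, ∀ u ∈ L, ∃ v, X a u v)
    (hinv : ∀ a u v w, X a u v → X (a.1, !a.2) v w → u = w) {w u v v' : List (Letter n)}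
    (h : WordPath X w u v) (h' : WordPath X w u v') : v = v' := by
  induction w generalizing u with
  | nil => exact h.symm.trans h'
  | cons a w ih =>
    obtain ⟨x, hx, h⟩ := h
    obtain ⟨y, hy, h'⟩ := h'
    obtain ⟨t, ht⟩ := htot (a.1, !a.2) x (hX _ _ _ hx).2
    obtain rfl := hinv _ _ _ _ hx ht
    obtain rfl := hinv (a.1, !a.2) _ _ _ ht (by simpa using hy)
    exact ih h h'

theorem WordPath.wordVal_eq {R : List (List (Letter n))}
    (hval : ∀ a u v, X a u v →
      wordVal (letterVal n R) u * letterVal n R a = wordVal (letterVal n R) v)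
    {w u v : List (Letter n)} (h : WordPath X w u v) :
    wordVal (letterVal n R) u * wordVal (letterVal n R) w = wordVal (letterVal n R) v := by
  induction w generalizing u with
  | nil =>
    obtain rfl : u = v := h
    simp
  | cons a w ih =>
    obtain ⟨u', h1, h2⟩ := h
    rw [wordVal_cons, ← mul_assoc, hval _ _ _ h1, ih h2]

/-- If the relators act trivially, then words with the same value act in the same way. -/
theorem wordPath_iff_of_insertionMove {R : List (List (Letter n))}
    (hX : ∀ a u v, X a u v → u ∈ L ∧ v ∈ L) (htot : ∀ a, ∀ u ∈ L, ∃ v, X a u v)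
    (hinv : ∀ a u v w, X a u v → X (a.1, !a.2) v w → u = w)
    (hrel : ∀ r ∈ R, ∀ u ∈ L, ∀ v, WordPath X r u v → u = v) {w w' : List (Letter n)}
    (h : InsertionMove (relatorWords n R) ∅ w w') {u v : List (Letter n)} (hu : u ∈ L) :
    WordPath X w u v ↔ WordPath X w' u v := by
  obtain ⟨x, r, y, rfl, rfl, hr | ⟨-, hr⟩⟩ := h
  swap
  · exact absurd hr (Set.notMem_empty r)
  have key : ∀ m ∈ L, ∀ m', WordPath X r m m' → m = m' := by
    rcases hr with hr | ⟨a, rfl⟩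
    · exact hrel r hr
    · rintro m - m' ⟨m₁, h1, m₂, h2, rfl⟩
      exact hinv a _ _ _ h1 h2
  rw [wordPath_append, wordPath_append]
  constructor
  · rintro ⟨m, h1, h2⟩
    obtain ⟨m', h3⟩ := WordPath.exists hX htot r (h1.mem hX hu)
    obtain rfl := key m (h1.mem hX hu) m' h3
    exact ⟨m, wordPath_append.2 ⟨m, h1, h3⟩, h2⟩
  · rintro ⟨m, h1, h2⟩
    obtain ⟨m', h3, h4⟩ := wordPath_append.1 h1
    obtain rfl := key m' (h3.mem hX hu) m h4
    exact ⟨m', h3, h2⟩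

end WordPath

theorem getElem_eq_multiplier {n : ℕ} {o : AlgOutput} (h : o.2.2.1.length = n) (i : Fin n) :
    (o.2.2.1[i.val]'(h.symm ▸ i.isLt)) =
      (o.multiplier (codeLetter (i, true)), o.multiplier (codeLetter (i, false))) := by
  have hi : i.val < o.2.2.1.length := h.symm ▸ i.isLt
  simp [AlgOutput.multiplier, codeLetter, List.getD_eq_getElem?_getD, hi]

theorem Certified.isCorrectOutput {n : ℕ} {R V : List (List (Letter n))} {o : AlgOutput}
    {W : List (List LetterCode × AutomatonCode PairCode)} {Y : AutomatonCode PairCode}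
    {w₀ : List LetterCode} (h : Certified (codeInput n R V) o W Y w₀) :
    IsCorrectOutput n R V o := by
  obtain ⟨⟨hlen, hletter⟩, ⟨hEpad, hEdiag⟩, ⟨hW, hWR, hWV⟩, ⟨hw₀, hYw₀, hHw₀, hπw₀⟩, hY,
    hsub, hHval⟩ := h
  simp only [codeInput] at hlen hletter hEpad hEdiag hW hWR hWV hπw₀ hY hsub
  have hletter' : ∀ a : Letter n, LetterCertified
      (n, R.map (List.map codeLetter), V.map (List.map codeLetter)) o Y (codeLetter a) :=
    fun a => hletter _ (mem_letterCodes.2 ⟨a, rfl⟩)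
  obtain ⟨w₀, rfl⟩ := exists_map_eq_of_memCode (n := n) (R := R) (V := []) hπw₀
  set π := wordVal (letterVal n R) with hπ
  set L := wordLanguage n o.1
  set LH := wordLanguage n o.2.2.2
  let X : Letter n → List (Letter n) → List (Letter n) → Prop := fun a u v =>
    padPair u v ∈ pairLanguage n (o.multiplier (codeLetter a))
  have hX : ∀ a u v, X a u v → u ∈ L ∧ v ∈ L := fun a =>
    relatesWords_iff.1 (hletter' a).2.1
  have hpad : ∀ a, ∀ z ∈ pairLanguage n (o.multiplier (codeLetter a)), ∃ u v, z = padPair u v :=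
    fun a => isPadded_iff.1 (hletter' a).1
  have hval : ∀ a u v, X a u v → π u * letterVal n R a = π v := by
    intro a u v huv
    have h1 := exists_pair_labelling_iff.1 (hletter' a).2.2.1 _ huv
    rwa [filterMap_fst_padPair, filterMap_snd_padPair] at h1
  have htot : ∀ a, ∀ u ∈ L, ∃ v, X a u v := by
    intro a u hu
    obtain ⟨z, hz, hzu⟩ := (hletter' a).2.2.2.1.exists_filterMap hu
    obtain ⟨u', v, rfl⟩ := hpad a z hz
    rw [filterMap_fst_padPair] at hzu
    exact ⟨v, hzu ▸ hz⟩
  have hEdiag' := isDiagonal_iff.1 hEdiag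
  have hinv : ∀ a u v w, X a u v → X (a.1, !a.2) v w → u = w := by
    intro a u v w h1 h2
    have h3 := composesInto_iff (app := none).1 (hletter' a).2.2.2.2.1 u v w h1 h2
    simp only [Option.toList_none, List.append_nil] at h3
    exact ((hEdiag' u w).1 h3).2
  have hYX : ∀ a p v v', padPair p v ∈ pairLanguage n Y → X a v v' →
      padPair (p ++ [a]) v' ∈ pairLanguage n Y := fun a p v v' h1 h2 =>
    composesInto_iff (app := some a).1 (hletter' a).2.2.2.2.2 p v v' h1 h2
  have hWpath : ∀ w : List (Letter n), ∀ Z, (w.map codeLetter, Z) ∈ W →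
      ∀ u ∈ L, ∀ v, WordPath X w u v → padPair u v ∈ pairLanguage n Z := by
    intro w
    induction w using List.reverseRecOn with
    | nil =>
      rintro Z hZ u hu v rfl
      rcases hW _ hZ with ⟨-, h1⟩ | ⟨p, -, b, -, h1, -⟩
      · simp only at h1
        rw [h1]
        exact (hEdiag' u u).2 ⟨hu, rfl⟩
      · simp at h1
    | append_singleton w a ih =>
      intro Z hZ u hu v hv
      rcases hW _ hZ with ⟨h1, -⟩ | ⟨⟨w', Z'⟩, hZ', b, -, h1, h2⟩
      · simp at h1
      · simp only [List.map_append, List.map_singleton] at h1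
        obtain ⟨rfl, h3⟩ := List.append_inj' h1 rfl
        obtain rfl : codeLetter a = b := by simpa using h3
        obtain ⟨m, hm, hmv⟩ := wordPath_append.1 hv
        have h4 := composesInto_iff (app := none).1 h2 u m v (ih Z' hZ' u hu m hm)
          (wordPath_singleton.1 hmv)
        simpa using h4
  have hrel : ∀ r ∈ R, ∀ u ∈ L, ∀ v, WordPath X r u v → u = v := by
    intro r hr u hu v hv
    obtain ⟨⟨r', Z⟩, hZ, rfl, hfix⟩ := hWR (r.map codeLetter) (List.mem_map_of_mem hr)
    exact fixesWords_iff.1 hfix u v (hWpath r Z hZ u hu v hv) hu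
  have hpres : ∀ x ∈ V, ∀ u ∈ L, ∀ v, WordPath X x u v → (u ∈ LH ↔ v ∈ LH) := by
    intro x hx u hu v hv
    obtain ⟨⟨x', Z⟩, hZ, rfl, hpr⟩ := hWV (x.map codeLetter) (List.mem_map_of_mem hx)
    exact preservesWords_iff.1 hpr u v (hWpath x Z hZ u hu v hv)
  have hw₀L : w₀ ∈ L := mem_wordLanguage.2 hw₀
  have hw₀π : π w₀ = 1 := by
    have h1 := (memCode_iff (V := [])).1 hπw₀
    rwa [genSubgroup_nil, Subgroup.mem_bot] at h1
  -- The orbit of `w₀` is followed by `Y`, so that it meets every word of `L` in the word itself.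
  have hYpath : ∀ w v, WordPath X w w₀ v → padPair w v ∈ pairLanguage n Y := by
    intro w
    induction w using List.reverseRecOn with
    | nil =>
      rintro v rfl
      rw [mem_pairLanguage, ← padPair_map_codeLetter]
      exact hYw₀
    | append_singleton w a ih =>
      intro v hv
      obtain ⟨m, hm, hmv⟩ := wordPath_append.1 hv
      exact hYX a w m v (ih m hm) (wordPath_singleton.1 hmv)
  have hself : ∀ u ∈ L, WordPath X u w₀ u := by
    intro u hu
    obtain ⟨v, hv⟩ := WordPath.exists hX htot u hw₀L
    obtain rfl := fixesWords_iff.1 hY u v (hYpath u v hv) hu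
    exact hv
  have hmove : ∀ {w w' : List (Letter n)}, InsertionMove (relatorWords n R) ∅ w w' →
      ∀ v, WordPath X w w₀ v ↔ WordPath X w' w₀ v := fun hm v =>
    wordPath_iff_of_insertionMove hX htot hinv hrel hm hw₀L
  have hlinked : ∀ {w w' : List (Letter n)}, π w = π w' →
      ∀ v, WordPath X w w₀ v ↔ WordPath X w' w₀ v := by
    intro w w' e v
    have hl := linked_of_wordVal_eq e
    clear e
    induction hl with
    | refl => exact Iff.rfl
    | tail _ hs ih =>
      refine ih.trans ?_
      rcases hs with hs | hs
      exacts [hmove hs v, (hmove hs v).symm]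
  have hinj : ∀ u ∈ L, ∀ v ∈ L, π u = π v → u = v := by
    intro u hu v hv e
    exact WordPath.unique hX htot hinv ((hlinked e u).1 (hself u hu)) (hself v hv)
  have hmul : ∀ a, pairLanguage n (o.multiplier (codeLetter a)) =
      multiplierLanguage (letterVal n R) L (letterVal n R a) := by
    intro a
    ext z
    constructor
    · intro hz
      obtain ⟨u, v, rfl⟩ := hpad a z hz
      exact ⟨u, (hX a u v hz).1, v, (hX a u v hz).2, hval a u v hz, rfl⟩
    · rintro ⟨u, hu, v, hv, e, rfl⟩
      obtain ⟨v', hv'⟩ := htot a u hu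
      obtain rfl := hinj v hv v' (hX a u v' hv').2 (e.symm.trans (hval a u v' hv'))
      exact hv'
  have hHL : ∀ u ∈ LH, u ∈ L := isSubautomaton_iff.1 hsub
  refine ⟨⟨?_, ?_, hlen, fun i => ?_⟩, ?_⟩
  · intro g
    obtain ⟨w, rfl⟩ := wordVal_surjective g
    obtain ⟨v, hv⟩ := WordPath.exists hX htot w hw₀L
    have e : π v = π w := by
      have h1 := hv.wordVal_eq hval
      rw [← hπ, hw₀π, one_mul] at h1
      exact h1.symm
    have hvL := hv.mem hX hw₀L
    exact ⟨v, ⟨hvL, e⟩, fun v' hv' => hinj v' hv'.1 v hvL (hv'.2.trans e.symm)⟩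
  · ext z
    constructor
    · intro hz
      obtain ⟨u, v, rfl⟩ := isPadded_iff.1 hEpad z hz
      obtain ⟨hu, rfl⟩ := (hEdiag' u v).1 hz
      exact ⟨u, hu, u, hu, by simp, rfl⟩
    · rintro ⟨u, hu, v, hv, e, rfl⟩
      rw [mul_one] at e
      exact (hEdiag' u v).2 ⟨hu, hinj u hu v hv e⟩
  · rw [getElem_eq_multiplier hlen i]
    exact ⟨hmul (i, true), hmul (i, false)⟩
  · ext w
    constructor
    · intro hw
      exact ⟨hHL w hw, exists_word_labelling_iff.1 hHval w hw⟩
    · rintro ⟨hw, hwH⟩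
      have hl : Linked (relatorWords n R) {v | v ∈ V} [] w :=
        linked_iff.2 (by simpa using hwH)
      have key : ∀ w w', InsertionMove (relatorWords n R) {v | v ∈ V} w w' →
          ((∃ v ∈ LH, WordPath X w w₀ v) ↔ ∃ v ∈ LH, WordPath X w' w₀ v) := by
        rintro _ _ ⟨x, r, y, rfl, rfl, hr | ⟨rfl, hr⟩⟩
        · have hm := hmove ⟨x, r, y, rfl, rfl, .inl hr⟩
          exact exists_congr fun v => and_congr_right fun _ => hm v
        · simp only [List.append_nil]
          constructor
          · rintro ⟨v, hv, hp⟩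
            obtain ⟨v', hv'⟩ := WordPath.exists hX htot r (hHL v hv)
            exact ⟨v', (hpres r hr v (hHL v hv) v' hv').1 hv, wordPath_append.2 ⟨v, hp, hv'⟩⟩
          · rintro ⟨v, hv, hp⟩
            obtain ⟨m, hm, hmv⟩ := wordPath_append.1 hp
            exact ⟨m, (hpres r hr m (hm.mem hX hw₀L) v hmv).2 hv, hm⟩
      have hend : ∃ v ∈ LH, WordPath X w w₀ v := by
        clear hw hwH
        induction hl with
        | refl => exact ⟨w₀, mem_wordLanguage.2 hHw₀, rfl⟩
        | tail _ hs ih =>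
          rcases hs with hs | hs
          exacts [(key _ _ hs).1 ih, (key _ _ hs).2 ih]
      obtain ⟨v, hv, hp⟩ := hend
      rw [WordPath.unique hX htot hinv (hself w hw) hp]
      exact hv

/-! ### Closure properties of regular languages -/

section RegularLanguages

variable {α β : Type*}

/-- If the left quotients of a language are determined by an invariant with finitely many values,
then the language is regular. -/
theorem isRegular_of_leftQuotient_eq {κ : Type*} {L : Language α} {S : Set κ} (hS : S.Finite)
    (f : List α → κ) (hf : ∀ x, f x ∈ S) (Φ : κ → Language α)
    (h : ∀ x, L.leftQuotient x = Φ (f x)) : L.IsRegular :=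
  .of_finite_range_leftQuotient ((hS.image Φ).subset (by
    rintro _ ⟨x, rfl⟩
    exact ⟨f x, hf x, (h x).symm⟩))

theorem isRegular_foldl {σ : Type*} [Finite σ] (step : σ → α → σ) (s : σ) (acc : Set σ) :
    Language.IsRegular ({x | x.foldl step s ∈ acc} : Language α) := by
  cases nonempty_fintype σ
  exact Language.isRegular_iff.2 ⟨σ, inferInstance, ⟨step, s, acc⟩, rfl⟩

theorem isRegular_preimage_filterMap {L : Language β} (hL : L.IsRegular) (f : α → Option β) :
    Language.IsRegular ({z | z.filterMap f ∈ L} : Language α) :=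
  isRegular_of_leftQuotient_eq hL.finite_range_leftQuotient
    (fun x => L.leftQuotient (x.filterMap f)) (fun _ => ⟨_, rfl⟩)
    (fun Q => {z | z.filterMap f ∈ Q}) fun x => by
      ext y
      change (x ++ y).filterMap f ∈ L ↔ x.filterMap f ++ y.filterMap f ∈ L
      rw [List.filterMap_append]

theorem isRegular_image_filterMap {L : Language α} (hL : L.IsRegular) (f : α → Option β) :
    Language.IsRegular ({w | ∃ z ∈ L, z.filterMap f = w} : Language β) :=
  isRegular_of_leftQuotient_eq hL.finite_range_leftQuotient.finite_subsets
    (fun p => {Q | ∃ z, z.filterMap f = p ∧ L.leftQuotient z = Q})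
    (by
      rintro p _ ⟨z, -, rfl⟩
      exact ⟨z, rfl⟩)
    (fun T => {y | ∃ Q ∈ T, ∃ z ∈ Q, z.filterMap f = y}) fun p => by
      ext y
      constructor
      · rintro ⟨z, hz, e⟩
        obtain ⟨z₁, z₂, rfl, h1, h2⟩ := List.filterMap_eq_append_iff.1 e
        exact ⟨_, ⟨z₁, h1, rfl⟩, z₂, hz, h2⟩
      · rintro ⟨_, ⟨z₁, h1, rfl⟩, z₂, hz, h2⟩
        exact ⟨z₁ ++ z₂, hz, by rw [List.filterMap_append, h1, h2]⟩

/-- The prefixes of the words of a language. -/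
def prefixLanguage (L : Language α) : Language α := {p | ∃ y, p ++ y ∈ L}

theorem isRegular_prefixLanguage {L : Language α} (hL : L.IsRegular) :
    (prefixLanguage L).IsRegular :=
  isRegular_of_leftQuotient_eq hL.finite_range_leftQuotient L.leftQuotient (fun _ => ⟨_, rfl⟩)
    (fun Q => {y | ∃ w, y ++ w ∈ Q}) fun x => by
      ext y
      exact exists_congr fun w => by rw [List.append_assoc]; rfl

/-- The language of the padded pairs of words `u ∈ L₁`, `v ∈ L₂`. -/
def padLanguage (L₁ L₂ : Language α) : Language (Option α × Option α) :=
  {z | ∃ u ∈ L₁, ∃ v ∈ L₂, z = padPair u v}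

theorem isRegular_padLanguage {L₁ L₂ : Language α} (h₁ : L₁.IsRegular) (h₂ : L₂.IsRegular) :
    (padLanguage L₁ L₂).IsRegular := by
  have h := ((isRegular_foldl
    (fun t a => paddingStep (t, a.1.isSome, a.2.isSome)) 0 {s | s ≠ 3}).inf
    (isRegular_preimage_filterMap h₁ (Prod.fst (β := Option α)))).inf
    (isRegular_preimage_filterMap h₂ (Prod.snd (α := Option α)))
  refine (congrArg Language.IsRegular (Language.ext fun z => ?_)).mpr h
  constructor
  · rintro ⟨u, hu, v, hv, rfl⟩
    refine ⟨⟨(foldl_paddingStep_ne_three_iff _).2 ⟨u, v, rfl⟩, ?_⟩, ?_⟩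
    · change List.filterMap Prod.fst _ ∈ L₁
      rwa [filterMap_fst_padPair]
    · change List.filterMap Prod.snd _ ∈ L₂
      rwa [filterMap_snd_padPair]
  · rintro ⟨⟨h1, h2⟩, h3⟩
    obtain ⟨u, v, rfl⟩ := (foldl_paddingStep_ne_three_iff _).1 h1
    change List.filterMap Prod.fst _ ∈ L₁ at h2
    change List.filterMap Prod.snd _ ∈ L₂ at h3
    rw [filterMap_fst_padPair] at h2
    rw [filterMap_snd_padPair] at h3
    exact ⟨u, h2, v, h3, rfl⟩

/-- The words whose pair with some word belongs to a regular language. -/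
theorem isRegular_exists_padPair_right {Z : Language (Option α × Option α)} (hZ : Z.IsRegular) :
    Language.IsRegular ({v | ∃ u, padPair u v ∈ Z} : Language α) := by
  have huniv : Language.IsRegular ({_w | True} : Language α) :=
    isRegular_foldl (σ := Unit) (fun _ _ => ()) () Set.univ
  have h := isRegular_image_filterMap (hZ.inf (isRegular_padLanguage huniv huniv))
    (Prod.snd (α := Option α))
  refine (congrArg Language.IsRegular (Language.ext fun v => ?_)).mpr h
  constructor
  · rintro ⟨u, hu⟩
    exact ⟨padPair u v, ⟨hu, u, trivial, v, trivial, rfl⟩, filterMap_snd_padPair u v⟩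
  · rintro ⟨_, ⟨hz, u, -, v', -, rfl⟩, rfl⟩
    exact ⟨u, by rwa [filterMap_snd_padPair]⟩

end RegularLanguages

/-! ### Fellow travelling words -/

section FellowTravel

variable {α G : Type*} [Group G] (val : α → G)

theorem padPair_take {α : Type*} (u v : List α) (t : ℕ) :
    (padPair u v).take t = padPair (u.take t) (v.take t) := by
  induction u, v using padPair_induction generalizing t with
  | nil => simp
  | right b v ih => cases t <;> simp_all
  | left a u ih => cases t <;> simp_all
  | cons a b u v ih => cases t <;> simp_all

/-- The words `u` and `v` fellow travel: the prefixes of equal length represent elements that differ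
by an element of `F` only. -/
def FellowTravel (F : Set G) (u v : List α) : Prop :=
  ∀ t, (wordVal val (u.take t))⁻¹ * wordVal val (v.take t) ∈ F

/-- The difference of the elements represented by the two tracks of a word of columns. -/
def trackDiff (z : List (Option α × Option α)) : G :=
  (wordVal val (z.filterMap Prod.fst))⁻¹ * wordVal val (z.filterMap Prod.snd)

theorem trackDiff_append (z z' : List (Option α × Option α)) :
    trackDiff val (z ++ z') = (wordVal val (z'.filterMap Prod.fst))⁻¹ * trackDiff val z *
      wordVal val (z'.filterMap Prod.snd) := by
  simp [trackDiff, mul_assoc]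

theorem trackDiff_padPair (u v : List α) :
    trackDiff val (padPair u v) = (wordVal val u)⁻¹ * wordVal val v := by
  rw [trackDiff, filterMap_fst_padPair, filterMap_snd_padPair]

theorem trackDiff_padPair_take (u v : List α) (t : ℕ) :
    trackDiff val ((padPair u v).take t) =
      (wordVal val (u.take t))⁻¹ * wordVal val (v.take t) := by
  rw [padPair_take, trackDiff_padPair]

theorem isRegular_trackDiff {F : Set G} (hF : F.Finite) (g : G) :
    Language.IsRegular ({z | (∀ t, trackDiff val (z.take t) ∈ F) ∧ trackDiff val z = g} :
      Language (Option α × Option α)) := by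
  classical
  refine isRegular_of_leftQuotient_eq (S := insert none (some '' F)) ((hF.image some).insert none)
    (fun x => if ∀ t, trackDiff val (x.take t) ∈ F then some (trackDiff val x) else none)
    (fun x => ?_) (fun d => {y | ∃ h ∈ d, (∀ t, (wordVal val ((y.take t).filterMap Prod.fst))⁻¹ * h *
      wordVal val ((y.take t).filterMap Prod.snd) ∈ F) ∧
      (wordVal val (y.filterMap Prod.fst))⁻¹ * h * wordVal val (y.filterMap Prod.snd) = g})
    fun x => ?_
  · split_ifs with h
    · exact Or.inr ⟨_, by simpa using h x.length, rfl⟩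
    · exact Or.inl rfl
  · ext y
    have hsplit : (∀ t, trackDiff val ((x ++ y).take t) ∈ F) ↔
        (∀ t, trackDiff val (x.take t) ∈ F) ∧ ∀ t, trackDiff val (x ++ y.take t) ∈ F := by
      constructor
      · refine fun h => ⟨fun t => ?_, fun t => ?_⟩
        · have h1 := h (min t x.length)
          rwa [List.take_append_of_le_length (min_le_right _ _), ← List.take_eq_take_min] at h1
        · have h1 := h (x.length + t)
          rwa [List.take_length_add_append] at h1
      · rintro ⟨h1, h2⟩ t
        rcases le_total t x.length with h | h
        · rw [List.take_append_of_le_length h]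
          exact h1 t
        · obtain ⟨s, rfl⟩ := Nat.exists_eq_add_of_le h
          rw [List.take_length_add_append]
          exact h2 s
    change (∀ t, trackDiff val ((x ++ y).take t) ∈ F) ∧ trackDiff val (x ++ y) = g ↔ ∃ h ∈ _, _
    rw [hsplit]
    simp only [trackDiff_append]
    split_ifs with h
    · simp [h]
    · simp [h]

theorem isRegular_fellowTravel {L₁ L₂ : Language α} (h₁ : L₁.IsRegular) (h₂ : L₂.IsRegular)
    {F : Set G} (hF : F.Finite) (g : G) : Language.IsRegular ({z | ∃ u ∈ L₁, ∃ v ∈ L₂,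
      FellowTravel val F u v ∧ wordVal val u * g = wordVal val v ∧ z = padPair u v} :
      Language (Option α × Option α)) := by
  refine (congrArg Language.IsRegular (Language.ext fun z => ?_)).mpr
    ((isRegular_padLanguage h₁ h₂).inf (isRegular_trackDiff val hF g))
  constructor
  · rintro ⟨u, hu, v, hv, h, e, rfl⟩
    refine ⟨⟨u, hu, v, hv, rfl⟩, fun t => ?_, ?_⟩
    · rw [trackDiff_padPair_take]
      exact h t
    · rw [trackDiff_padPair, ← e, inv_mul_cancel_left]
  · rintro ⟨⟨u, hu, v, hv, rfl⟩, h, e⟩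
    refine ⟨u, hu, v, hv, fun t => ?_, ?_, rfl⟩
    · rw [← trackDiff_padPair_take]
      exact h t
    · rw [trackDiff_padPair] at e
      rw [← e, mul_inv_cancel_left]

/-- Words of `L` that represent elements differing by `g` fellow travel uniformly. -/
def FellowTraveller (L : Language α) (g : G) : Prop :=
  ∃ F : Set G, F.Finite ∧ ∀ u ∈ L, ∀ v ∈ L, wordVal val u * g = wordVal val v →
    FellowTravel val F u v

variable {val}

theorem FellowTraveller.mono {L L' : Language α} {g : G} (h : FellowTraveller val L g)
    (hL : ∀ w ∈ L', w ∈ L) : FellowTraveller val L' g := by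
  obtain ⟨F, hF, h⟩ := h
  exact ⟨F, hF, fun u hu v hv => h u (hL u hu) v (hL v hv)⟩

theorem FellowTraveller.isRegular {L : Language α} (hL : L.IsRegular) {g : G}
    (h : FellowTraveller val L g) : (multiplierLanguage val L g).IsRegular := by
  obtain ⟨F, hF, h⟩ := h
  refine (congrArg Language.IsRegular (Language.ext fun z => ?_)).mpr
    (isRegular_fellowTravel val hL hL hF g)
  exact exists_congr fun u => and_congr_right fun hu => exists_congr fun v =>
    and_congr_right fun hv => ⟨fun ⟨e, hz⟩ => ⟨h u hu v hv e, e, hz⟩, fun ⟨_, e, hz⟩ => ⟨e, hz⟩⟩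

/-- Two prefixes that can be completed to a pair of the multiplier language can be completed by
finitely many pairs of words, which leaves finitely many differences of the prefixes. -/
theorem FellowTraveller.of_isRegular {L : Language α} {g : G}
    (h : (multiplierLanguage val L g).IsRegular) : FellowTraveller val L g := by
  classical
  set Z := multiplierLanguage val L g
  let y : Language (Option α × Option α) → List (Option α × Option α) := fun Q =>
    if hQ : ∃ y, y ∈ Q then hQ.choose else []
  refine ⟨_, h.finite_range_leftQuotient.image fun Q => wordVal val ((y Q).filterMap Prod.fst) * g *
    (wordVal val ((y Q).filterMap Prod.snd))⁻¹, fun u hu v hv e t => ?_⟩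
  have hQ : ∃ x, x ∈ Z.leftQuotient ((padPair u v).take t) :=
    ⟨(padPair u v).drop t, by
      rw [Language.mem_leftQuotient, List.take_append_drop]
      exact ⟨u, hu, v, hv, e, rfl⟩⟩
  refine ⟨_, ⟨(padPair u v).take t, rfl⟩, ?_⟩
  have hy : y (Z.leftQuotient ((padPair u v).take t)) ∈ Z.leftQuotient ((padPair u v).take t) := by
    simp only [y, dif_pos hQ]
    exact hQ.choose_spec
  obtain ⟨u', -, v', -, e', hz⟩ := hy
  dsimp only
  rw [← trackDiff_padPair_take]
  have h1 := congrArg (trackDiff val) hz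
  rw [trackDiff_append] at h1
  rw [trackDiff_padPair, ← e', inv_mul_cancel_left] at h1
  rw [← h1]
  group

theorem FellowTraveller.mul {L : Language α} (hL : ∀ g, ∃ w ∈ L, wordVal val w = g) {g h : G}
    (hg : FellowTraveller val L g) (hh : FellowTraveller val L h) :
    FellowTraveller val L (g * h) := by
  obtain ⟨F, hF, hg⟩ := hg
  obtain ⟨F', hF', hh⟩ := hh
  refine ⟨_, hF.image2 (· * ·) hF', fun u hu v hv e t => ?_⟩
  obtain ⟨w, hw, ew⟩ := hL (wordVal val u * g)
  refine ⟨_, hg u hu w hw ew.symm t, _, hh w hw v hv (by rw [ew, ← e, mul_assoc]) t, ?_⟩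
  dsimp only
  group

theorem IsAutomaticStructure.fellowTraveller [Finite α] {L : Language α}
    (h : IsAutomaticStructure val L) (g : G) : FellowTraveller val L g := by
  obtain ⟨w, -, rfl⟩ := h.surjective g
  induction w with
  | nil => exact .of_isRegular h.regular_eq
  | cons a w ih =>
    rw [wordVal_cons]
    exact .mul h.surjective (.of_isRegular (h.regular_mul a)) ih

end FellowTravel

/-! ### Change of the alphabet -/

section Shadow

variable {α β G : Type*} [Group G] (val : α → G) (val' : β → G)

/-- The words `w` that represent the same element as some `u ∈ L` and follow it at `ℓ` times its
speed: the prefix of length `t` of `w` and the prefix of length `t / ℓ` of `u` represent elements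
that differ by an element of `E`. -/
def shadowLanguage (L : Language α) (ℓ : ℕ) (E : Set G) : Language β :=
  {w | ∃ u ∈ L, u.length = w.length / ℓ ∧ wordVal val u = wordVal val' w ∧
    ∀ t ≤ w.length, (wordVal val (u.take (t / ℓ)))⁻¹ * wordVal val' (w.take t) ∈ E}

/-- A left quotient by `p` depends on `p` only through the length of `p` modulo `ℓ` and the set of
the left quotients of `L` and the elements of `E` belonging to the words that `p` follows. -/
theorem isRegular_shadowLanguage {L : Language α} (hL : L.IsRegular) {ℓ : ℕ} (hℓ : 0 < ℓ) {E : Set G}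
    (hE : E.Finite) : (shadowLanguage val val' L ℓ E).IsRegular := by
  refine isRegular_of_leftQuotient_eq
    ((Set.finite_lt_nat ℓ).prod (hL.finite_range_leftQuotient.prod hE).finite_subsets)
    (fun p : List β => (p.length % ℓ, {x : Language α × G | ∃ u : List α, u.length = p.length / ℓ ∧
      (∀ t ≤ p.length, (wordVal val (u.take (t / ℓ)))⁻¹ * wordVal val' (p.take t) ∈ E) ∧
      x = (L.leftQuotient u, (wordVal val u)⁻¹ * wordVal val' p)}))
    (fun p => ⟨Nat.mod_lt _ hℓ, ?_⟩)
    (fun k => {y | ∃ x ∈ k.2, ∃ u ∈ x.1, u.length = (k.1 + y.length) / ℓ ∧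
      (wordVal val u)⁻¹ * x.2 * wordVal val' y = 1 ∧ ∀ t ≤ y.length,
        (wordVal val (u.take ((k.1 + t) / ℓ)))⁻¹ * x.2 * wordVal val' (y.take t) ∈ E})
    fun p => ?_
  · rintro _ ⟨u, hu, h, rfl⟩
    refine ⟨⟨u, rfl⟩, ?_⟩
    have h1 := h p.length le_rfl
    rwa [← hu, List.take_length, List.take_length] at h1
  · have hdiv : ∀ t, (p.length + t) / ℓ = p.length / ℓ + (p.length % ℓ + t) / ℓ := by
      intro t
      conv_lhs => rw [← Nat.div_add_mod p.length ℓ, add_assoc, Nat.mul_add_div hℓ]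
    ext y
    constructor
    · rintro ⟨u, hu, hlen, e, h⟩
      rw [List.length_append, hdiv] at hlen
      obtain ⟨u₁, u₂, rfl, h1⟩ : ∃ u₁ u₂, u = u₁ ++ u₂ ∧ u₁.length = p.length / ℓ :=
        ⟨_, _, (List.take_append_drop (p.length / ℓ) u).symm, by
          rw [List.length_take, hlen, min_eq_left (Nat.le_add_right _ _)]⟩
      refine ⟨_, ⟨u₁, h1, fun t ht => ?_, rfl⟩, u₂, hu, ?_, ?_, fun t ht => ?_⟩
      · have h2 := h t (by rw [List.length_append]; omega)
        rwa [List.take_append_of_le_length ht, List.take_append_of_le_length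
          (h1 ▸ Nat.div_le_div_right ht)] at h2
      · simp only [List.length_append] at hlen ⊢
        omega
      · rw [wordVal_append, wordVal_append] at e
        simp only
        rw [← mul_assoc, ← mul_inv_rev, mul_assoc, ← e, inv_mul_cancel]
      · have h2 := h (p.length + t) (by rw [List.length_append]; omega)
        rw [hdiv, ← h1, List.take_length_add_append, List.take_length_add_append, wordVal_append,
          wordVal_append] at h2
        simpa [mul_assoc] using h2
    · rintro ⟨_, ⟨u₁, h1, h2, rfl⟩, u₂, hu, hlen, e, h⟩
      refine ⟨u₁ ++ u₂, hu, ?_, ?_, fun t ht => ?_⟩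
      · rw [List.length_append, List.length_append, hdiv, h1, hlen]
      · rw [wordVal_append, wordVal_append]
        simp only at e
        rw [← mul_assoc, ← mul_inv_rev, mul_assoc, inv_mul_eq_one] at e
        exact e
      · rcases le_total t p.length with ht' | ht'
        · rw [List.take_append_of_le_length ht', List.take_append_of_le_length
            (h1 ▸ Nat.div_le_div_right ht')]
          exact h2 t ht'
        · obtain ⟨s, rfl⟩ := Nat.exists_eq_add_of_le ht'
          rw [hdiv, ← h1, List.take_length_add_append, List.take_length_add_append, wordVal_append,
            wordVal_append]
          have h3 := h s (by rw [List.length_append] at ht; omega)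
          simpa [mul_assoc] using h3

variable {val val'}

theorem subgroupLanguage_shadowLanguage (L : Language α) (ℓ : ℕ) (E : Set G) (H : Subgroup G) :
    subgroupLanguage val' (shadowLanguage val val' L ℓ E) H =
      shadowLanguage val val' (subgroupLanguage val L H) ℓ E := by
  ext w
  constructor
  · rintro ⟨⟨u, hu, hlen, e, h⟩, hw⟩
    exact ⟨u, ⟨hu, e ▸ hw⟩, hlen, e, h⟩
  · rintro ⟨u, ⟨hu, hH⟩, hlen, e, h⟩
    exact ⟨⟨u, hu, hlen, e, h⟩, e ▸ hH⟩

theorem FellowTraveller.shadowLanguage {L : Language α} {g : G} (h : FellowTraveller val L g)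
    {ℓ : ℕ} {E : Set G} (hE : E.Finite) :
    FellowTraveller val' (shadowLanguage val val' L ℓ E) g := by
  obtain ⟨F, hF, h⟩ := h
  refine ⟨_, (hE.image2 (fun a b => a⁻¹ * b) hF).image2 (· * ·) hE, ?_⟩
  rintro w ⟨u, hu, hlen, e, hs⟩ w' ⟨u', hu', hlen', e', hs'⟩ eg t
  have key : ∀ {w : List β} {u : List α}, u.length = w.length / ℓ → wordVal val u = wordVal val' w →
      (∀ t ≤ w.length, (wordVal val (u.take (t / ℓ)))⁻¹ * wordVal val' (w.take t) ∈ E) →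
      (wordVal val (u.take (t / ℓ)))⁻¹ * wordVal val' (w.take t) ∈ E := by
    intro w u hlen e hs
    rcases le_total t w.length with ht | ht
    · exact hs t ht
    · have h1 := hs w.length le_rfl
      rw [← hlen, List.take_length, List.take_length] at h1
      rwa [List.take_of_length_le ht, List.take_of_length_le (hlen ▸ Nat.div_le_div_right ht)]
  refine ⟨_, ⟨_, key hlen e hs, _, h u hu u' hu' (by rw [e, eg, e']) (t / ℓ), rfl⟩, _,
    key hlen' e' hs', ?_⟩
  dsimp only
  group

end Shadow

/-! ### Words of prescribed length -/

section Blocks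

variable {α G : Type*} [Group G] {n : ℕ} {R : List (List (Letter n))}

theorem finite_setOf_wordVal_length_le {β : Type*} [Finite β] (val : β → G) (m : ℕ) :
    {g | ∃ w : List β, w.length ≤ m ∧ wordVal val w = g}.Finite :=
  ((List.finite_length_le β m).image (wordVal val)).subset fun _ ⟨w, hw, e⟩ => ⟨w, hw, e⟩

/-- Up to a letter `x`, every element is represented by a word of length `2 * m`, for all large `m`:
words are lengthened by `x x⁻¹`, and the parity of the length is corrected by `x`. -/
theorem exists_length_eq_two_mul (x : Letter n) (g : PresGroup n R) :
    ∃ m₀, ∀ m ≥ m₀, ∃ w : List (Letter n), w.length = 2 * m ∧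
      (wordVal (letterVal n R) w = g ∨ wordVal (letterVal n R) w = g * letterVal n R x) := by
  have hpad : ∀ (k : ℕ) (w : List (Letter n)), ∃ w' : List (Letter n),
      w'.length = w.length + 2 * k ∧ wordVal (letterVal n R) w' = wordVal (letterVal n R) w := by
    intro k w
    induction k with
    | zero => exact ⟨w, rfl, rfl⟩
    | succ k ih =>
      obtain ⟨w', h1, h2⟩ := ih
      exact ⟨x :: (x.1, !x.2) :: w', by simp [h1]; omega, by
        rw [wordVal_cons, wordVal_cons, letterVal_not, h2, mul_inv_cancel_left]⟩
  obtain ⟨w, rfl⟩ := wordVal_surjective g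
  rcases Nat.even_or_odd' w.length with ⟨k, hk | hk⟩
  · refine ⟨k, fun m hm => ?_⟩
    obtain ⟨w', h1, h2⟩ := hpad (m - k) w
    exact ⟨w', by omega, Or.inl h2⟩
  · refine ⟨k + 1, fun m hm => ?_⟩
    obtain ⟨w', h1, h2⟩ := hpad (m - (k + 1)) (w ++ [x])
    refine ⟨w', by simp at h1; omega, Or.inr ?_⟩
    rw [h2, wordVal_append, wordVal_cons, wordVal_nil, mul_one]

/-- For some even length `ℓ`, every word is followed by a word over the letters of the presentation
at `ℓ` times its speed. -/
theorem exists_shadow [Finite α] (val : α → PresGroup n R) (x : Letter n) :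
    ∃ (ℓ : ℕ) (E : Set (PresGroup n R)), 0 < ℓ ∧ E.Finite ∧ ∀ L : Language α, ∀ u ∈ L,
      ∃ w ∈ shadowLanguage val (letterVal n R) L ℓ E,
        wordVal (letterVal n R) w = wordVal val u := by
  set π := wordVal (letterVal n R)
  set S : Set (PresGroup n R) := {1, letterVal n R x}
  have hblock : ∃ m, 0 < m ∧ ∀ (e : S) (a : α), ∃ w : List (Letter n), w.length = 2 * m ∧
      (π w = (e : PresGroup n R)⁻¹ * val a ∨
        π w = (e : PresGroup n R)⁻¹ * val a * letterVal n R x) := by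
    have hfin : Finite S := (Set.toFinite _).to_subtype
    have h1 : ∀ p : S × α, ∀ᶠ m in Filter.atTop, ∃ w : List (Letter n), w.length = 2 * m ∧
        (π w = (p.1 : PresGroup n R)⁻¹ * val p.2 ∨
          π w = (p.1 : PresGroup n R)⁻¹ * val p.2 * letterVal n R x) := fun p =>
      Filter.eventually_atTop.2 (exists_length_eq_two_mul x _)
    obtain ⟨m, h2, h3⟩ := ((Filter.eventually_all.2 h1).and (Filter.eventually_gt_atTop 0)).exists
    exact ⟨m, h3, fun e a => h2 (e, a)⟩
  obtain ⟨m, hm, hblock⟩ := hblock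
  set ℓ := 2 * m
  set E : Set (PresGroup n R) := {g | ∃ w : List (Letter n), w.length ≤ ℓ + 1 ∧ π w = g}
  -- Up to an element of `S`, all words are followed by words of length divisible by `ℓ`.
  have key : ∀ u : List α, ∃ w : List (Letter n), w.length = ℓ * u.length ∧
      (wordVal val u)⁻¹ * π w ∈ S ∧
      ∀ t ≤ w.length, (wordVal val (u.take (t / ℓ)))⁻¹ * π (w.take t) ∈ E := by
    intro u
    induction u using List.reverseRecOn with
    | nil => exact ⟨[], rfl, by simp [π, S], fun t ht => ⟨[], by simp, by simp [π]⟩⟩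
    | append_singleton u a ih =>
      obtain ⟨w, hlen, hS, hE⟩ := ih
      obtain ⟨b, hb, hval⟩ := hblock ⟨_, hS⟩ a
      have hS' : (wordVal val (u ++ [a]))⁻¹ * π (w ++ b) ∈ S := by
        rw [show π (w ++ b) = π w * π b from wordVal_append _ _ _, wordVal_append, wordVal_cons,
          wordVal_nil, mul_one]
        rcases hval with h | h
        · left
          rw [h]
          group
        · right
          rw [h, Set.mem_singleton_iff]
          group
      refine ⟨w ++ b, by simp [hlen, hb, mul_add], hS', fun t ht => ?_⟩
      rcases le_or_gt t w.length with h | h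
      · rw [List.take_append_of_le_length h, List.take_append_of_le_length]
        · exact hE t h
        · refine (Nat.div_le_div_right h).trans ?_
          rw [hlen, Nat.mul_div_cancel_left _ (by omega)]
      · obtain ⟨s, rfl⟩ := Nat.exists_eq_add_of_le h.le
        have hsmall : ∀ g ∈ S, ∃ y : List (Letter n), y.length ≤ 1 ∧ π y = g := by
          rintro g (rfl | rfl)
          exacts [⟨[], by simp, by simp [π]⟩, ⟨[x], by simp, by simp [π]⟩]
        rw [List.length_append, hb] at ht
        rcases (show s ≤ ℓ by omega).lt_or_eq with hs | rfl
        · obtain ⟨y, hy, hy'⟩ := hsmall _ hS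
          refine ⟨y ++ b.take s, by simp; omega, ?_⟩
          rw [List.take_length_add_append, hlen, Nat.mul_add_div (by omega), Nat.div_eq_of_lt hs,
            add_zero, List.take_append_of_le_length le_rfl, List.take_length]
          simp only [π, wordVal_append] at hy' ⊢
          rw [hy', mul_assoc]
        · obtain ⟨y, hy, hy'⟩ := hsmall _ hS'
          refine ⟨y, by omega, ?_⟩
          rw [hy', List.take_of_length_le, List.take_of_length_le]
          · simp [hb]
          · rw [hlen, Nat.mul_add_div (by omega), Nat.div_self (by omega)]
            simp
  refine ⟨ℓ, E, by omega, finite_setOf_wordVal_length_le _ _, fun L u hu => ?_⟩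
  obtain ⟨w, hlen, hS, hE⟩ := key u
  have hdiv : w.length / ℓ = u.length := by rw [hlen, Nat.mul_div_cancel_left _ (by omega)]
  rcases hS with h | h
  · have h1 : π w = wordVal val u := (inv_mul_eq_one.1 h).symm
    exact ⟨w, ⟨u, hu, hdiv.symm, h1.symm, hE⟩, h1⟩
  · have h1 : π (w ++ [(x.1, !x.2)]) = wordVal val u := by
      have h2 : π w = wordVal val u * letterVal n R x := inv_mul_eq_iff_eq_mul.1 h
      simp only [π, wordVal_append, wordVal_cons, wordVal_nil, letterVal_not, mul_one] at h2 ⊢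
      rw [h2, mul_inv_cancel_right]
    have hdiv' : (w ++ [(x.1, !x.2)]).length / ℓ = u.length := by
      rw [List.length_append, hlen, Nat.mul_add_div (by omega), List.length_singleton,
        Nat.div_eq_of_lt (by omega), add_zero]
    refine ⟨_, ⟨u, hu, hdiv'.symm, h1.symm, fun t ht => ?_⟩, h1⟩
    rcases le_or_gt t w.length with ht' | ht'
    · rw [List.take_append_of_le_length ht']
      exact hE t ht'
    · obtain rfl : t = (w ++ [(x.1, !x.2)]).length := by
        rw [List.length_append, List.length_singleton] at ht ⊢
        omega
      rw [hdiv', List.take_length, List.take_length, ← h1, inv_mul_cancel]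
      exact ⟨[], by simp, by simp [π]⟩

end Blocks

/-! ### Unique representatives -/

section WordNumber

variable {α : Type*} (d : α → ℕ) (B : ℕ)

/-- The number whose digits in base `B`, the least significant one first, are given by the letters of
a word. No letter has the digit `0`, which is left to the padding symbol. -/
def wordNumber : List α → ℕ
  | [] => 0
  | a :: u => d a + 1 + B * wordNumber u

/-- Comparison of the numbers of two words, column by column. -/
def numberStep (s : Ordering) (a : Option α × Option α) : Ordering :=
  (compare (a.1.elim 0 fun b => d b + 1) (a.2.elim 0 fun b => d b + 1)).then s

variable {d B}

theorem compare_add_mul {x y m k : ℕ} (hx : x < B) (hy : y < B) :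
    compare (x + B * m) (y + B * k) = (compare m k).then (compare x y) := by
  rcases lt_trichotomy m k with h | rfl | h
  · have : B * (m + 1) ≤ B * k := Nat.mul_le_mul_left B h
    rw [compare_lt_iff_lt.2 h, compare_lt_iff_lt.2 (by rw [mul_add] at this; omega)]
    rfl
  · rcases lt_trichotomy x y with h | rfl | h
    · rw [compare_lt_iff_lt.2 h, compare_lt_iff_lt.2 (by omega), compare_eq_iff_eq.2 rfl]
      rfl
    · simp
    · rw [compare_gt_iff_gt.2 h, compare_gt_iff_gt.2 (by omega), compare_eq_iff_eq.2 rfl]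
      rfl
  · have : B * (k + 1) ≤ B * m := Nat.mul_le_mul_left B h
    rw [compare_gt_iff_gt.2 h, compare_gt_iff_gt.2 (by rw [mul_add] at this; omega)]
    rfl

theorem wordNumber_injective (hinj : Function.Injective d) (hB : ∀ a, d a + 1 < B) :
    Function.Injective (wordNumber d B) := by
  intro u
  induction u with
  | nil =>
    rintro (_ | ⟨b, v⟩) h
    · rfl
    · simp only [wordNumber] at h
      omega
  | cons a u ih =>
    rintro (_ | ⟨b, v⟩) h
    · simp only [wordNumber] at h
      omega
    · have h1 := compare_eq_iff_eq.2 h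
      rw [wordNumber, wordNumber, compare_add_mul (hB a) (hB b), Ordering.then_eq_eq,
        compare_eq_iff_eq, compare_eq_iff_eq] at h1
      rw [ih h1.1, hinj (Nat.succ_injective h1.2)]

theorem foldl_numberStep (hB : ∀ a, d a + 1 < B) (u v : List α) (s : Ordering) :
    (padPair u v).foldl (numberStep d) s =
      (compare (wordNumber d B u) (wordNumber d B v)).then s := by
  induction u, v using padPair_induction generalizing s with
  | nil => simp [wordNumber]
  | right b v ih =>
    rw [padPair_nil_cons, List.foldl_cons, ih, numberStep, ← Ordering.then_assoc,
      Option.elim_none, Option.elim_some,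
      ← compare_add_mul ((Nat.succ_pos _).trans (hB b)) (hB b)]
    simp [wordNumber]
  | left a u ih =>
    rw [padPair_cons_nil, List.foldl_cons, ih, numberStep, ← Ordering.then_assoc,
      Option.elim_none, Option.elim_some,
      ← compare_add_mul (hB a) ((Nat.succ_pos _).trans (hB a))]
    simp [wordNumber]
  | cons a b u v ih =>
    rw [padPair_cons_cons, List.foldl_cons, ih, numberStep, ← Ordering.then_assoc,
      Option.elim_some, Option.elim_some, ← compare_add_mul (hB a) (hB b)]
    rfl

end WordNumber

section UniqueRepresentatives

variable {α G : Type*} [Group G] {val : α → G}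

/-- The words of least number among the words of `L` for the same element form a regular
language, since words of `L` for the same element fellow travel. -/
theorem exists_unique_representatives [Finite α] {L : Language α} (hL : L.IsRegular)
    (hsurj : ∀ g, ∃ w ∈ L, wordVal val w = g) (h : FellowTraveller val L 1) :
    ∃ L' : Language α, L'.IsRegular ∧ (∀ w ∈ L', w ∈ L) ∧ ∀ g, ∃! w, w ∈ L' ∧ wordVal val w = g := by
  obtain ⟨k, ⟨e⟩⟩ := Finite.exists_equiv_fin α
  set N := wordNumber (fun a => (e a).val) (k + 1)
  have hB : ∀ a, (e a).val + 1 < k + 1 := fun a => Nat.succ_lt_succ (e a).isLt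
  have hN : Function.Injective N :=
    wordNumber_injective (Fin.val_injective.comp e.injective) hB
  have hreg := hL.inf (isRegular_exists_padPair_right ((h.isRegular hL).inf (isRegular_foldl
    (numberStep fun a => (e a).val) .eq {.lt}))).compl
  refine ⟨_, hreg, fun w hw => hw.1, fun g => ?_⟩
  have hmem : ∀ v, (v ∈ L ∧ ∀ u ∈ L, wordVal val u = wordVal val v → N v ≤ N u) ↔
      v ∈ L ⊓ ({v | ∃ u, padPair u v ∈ multiplierLanguage val L 1 ⊓
        {x | List.foldl (numberStep fun a => (e a).val) .eq x ∈ ({.lt} : Set Ordering)}} :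
          Language α)ᶜ := by
    intro v
    refine and_congr_right fun hv => ?_
    change _ ↔ ¬ ∃ u, padPair u v ∈ multiplierLanguage val L 1 ∧ List.foldl _ _ _ = Ordering.lt
    rw [not_exists]
    refine forall_congr' fun u => ?_
    rw [foldl_numberStep hB, Ordering.then_eq, compare_lt_iff_lt, not_and, not_lt]
    constructor
    · rintro h1 ⟨u', hu', v', hv', e1, e2⟩
      obtain ⟨rfl, rfl⟩ := padPair_injective e2
      exact h1 hu' (by rwa [mul_one] at e1)
    · intro h1 hu e1
      exact h1 ⟨u, hu, v, hv, by rwa [mul_one], rfl⟩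
  simp only [← hmem]
  obtain ⟨w, hw, hmin⟩ := WellFounded.has_min (InvImage.wf N Nat.lt_wfRel.wf)
    {w | w ∈ L ∧ wordVal val w = g} (hsurj g)
  refine ⟨w, ⟨⟨hw.1, fun u hu e1 => not_lt.1 (hmin u ⟨hu, e1.trans hw.2⟩)⟩, hw.2⟩, ?_⟩
  rintro v ⟨⟨hv, hv'⟩, e1⟩
  exact hN (le_antisymm (hv' w hw.1 (hw.2.trans e1.symm)) (not_lt.1 (hmin v ⟨hv, e1⟩)))

end UniqueRepresentatives

/-! ### Following the orbit of the trivial element -/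

section Orbit

variable {α G : Type*} [Group G] (val : α → G)

/-- The pairs of a word `p` and a word `v ∈ L` such that `p` is not a prefix of a word of `L` or
represents the same element as `v`. -/
def orbitLanguage (L : Language α) : Language (Option α × Option α) :=
  {z | ∃ p, ∃ v ∈ L, (p ∈ prefixLanguage L → wordVal val p = wordVal val v) ∧ z = padPair p v}

variable {val}

/-- Prefixes of words of `L` can be completed by finitely many words, so that they fellow travel with
the words of `L` for the same element. -/
theorem fellowTravel_of_prefix {L : Language α} (hL : L.IsRegular)
    (h : ∀ g, FellowTraveller val L g) : ∃ F : Set G, F.Finite ∧ ∀ p ∈ prefixLanguage L, ∀ v ∈ L,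
      wordVal val p = wordVal val v → FellowTravel val F p v := by
  classical
  choose F hF h using h
  let y : Language α → List α := fun Q => if hQ : ∃ y, y ∈ Q then hQ.choose else []
  refine ⟨⋃ s ∈ y '' Set.range L.leftQuotient, Set.image2 (· * ·)
    ((fun i => wordVal val (s.take i)) '' {i | i ≤ s.length}) (F (wordVal val s)⁻¹),
    (hL.finite_range_leftQuotient.image y).biUnion fun s _ =>
      ((Set.finite_le_nat _).image _).image2 _ (hF _), fun p hp v hv e t => ?_⟩
  set s := y (L.leftQuotient p) with hs
  have hps : p ++ s ∈ L := by
    have h1 : ∃ x, x ∈ L.leftQuotient p := hp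
    rw [hs]
    simp only [y, dif_pos h1]
    exact h1.choose_spec
  refine Set.mem_biUnion ⟨_, ⟨p, rfl⟩, hs.symm⟩ ⟨_, ⟨min (t - p.length) s.length,
    Nat.min_le_right _ _, rfl⟩, _, h _ (p ++ s) hps v hv ?_ t, ?_⟩
  · rw [wordVal_append, mul_inv_cancel_right, e]
  · simp only [← List.take_eq_take_min]
    rw [List.take_append, wordVal_append]
    group

theorem isRegular_orbitLanguage {L : Language α} (hL : L.IsRegular)
    (h : ∀ g, FellowTraveller val L g) : (orbitLanguage val L).IsRegular := by
  obtain ⟨F, hF, h⟩ := fellowTravel_of_prefix hL h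
  have hP := isRegular_prefixLanguage hL
  refine (congrArg Language.IsRegular (Language.ext fun z => ?_)).mpr
    ((isRegular_padLanguage hP.compl hL).add (isRegular_fellowTravel val hP hL hF 1))
  constructor
  · rintro ⟨p, v, hv, e, rfl⟩
    by_cases hp : p ∈ prefixLanguage L
    · exact Or.inr ⟨p, hp, v, hv, h p hp v hv (e hp), by rw [mul_one, e hp], rfl⟩
    · exact Or.inl ⟨p, hp, v, hv, rfl⟩
  · rintro (⟨p, hp, v, hv, rfl⟩ | ⟨p, hp, v, hv, -, e, rfl⟩)
    · exact ⟨p, v, hv, fun hp' => absurd hp' hp, rfl⟩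
    · exact ⟨p, v, hv, fun _ => by rwa [mul_one] at e, rfl⟩

end Orbit

/-! ### The automatic structure over the letters of the presentation -/

section Existence

variable {n : ℕ} {R : List (List (Letter n))}

theorem exists_language_over_letters {H : Subgroup (PresGroup n R)}
    (h : IsRationalForSomeAutomaticStructure H) : ∃ L : Language (Letter n), L.IsRegular ∧
      (∀ g, ∃ w ∈ L, wordVal (letterVal n R) w = g) ∧
      (∀ g, FellowTraveller (letterVal n R) L g) ∧
      (subgroupLanguage (letterVal n R) L H).IsRegular := by
  obtain ⟨k, val, L, hL, hH⟩ := h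
  rcases Nat.eq_zero_or_pos n with rfl | hn
  · -- Without letters the group is trivial and the empty word is the only word.
    have hreg : ∀ K : Language (Letter 0), K.IsRegular := fun K => by
      refine (congrArg Language.IsRegular (Language.ext fun w => ?_)).mpr
        (isRegular_foldl (fun _ _ => ()) () {_u | [] ∈ K})
      rw [Subsingleton.elim w []]
      rfl
    have hone : ∀ g : PresGroup 0 R, g = 1 := fun g => by
      obtain ⟨w, rfl⟩ := wordVal_surjective g
      rw [Subsingleton.elim w [], wordVal_nil]
    refine ⟨{[]}, hreg _, fun g => ⟨[], rfl, by rw [hone g, wordVal_nil]⟩, fun g =>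
      ⟨{1}, Set.finite_singleton 1, fun u _ v _ _ t => hone _⟩, hreg _⟩
  · obtain ⟨ℓ, E, hℓ, hE, hsh⟩ := exists_shadow (R := R) val (⟨⟨0, hn⟩, true⟩ : Letter n)
    refine ⟨shadowLanguage val (letterVal n R) L ℓ E,
      isRegular_shadowLanguage _ _ hL.regular hℓ hE, fun g => ?_,
      fun g => (hL.fellowTraveller g).shadowLanguage hE, ?_⟩
    · obtain ⟨u, hu, rfl⟩ := hL.surjective g
      exact hsh L u hu
    · rw [subgroupLanguage_shadowLanguage]
      exact isRegular_shadowLanguage _ _ hH hℓ hE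

theorem exists_structure_with_uniqueness {H : Subgroup (PresGroup n R)}
    (h : IsRationalForSomeAutomaticStructure H) : ∃ L : Language (Letter n), L.IsRegular ∧
      (∀ g, ∃! w, w ∈ L ∧ wordVal (letterVal n R) w = g) ∧
      (∀ g, (multiplierLanguage (letterVal n R) L g).IsRegular) ∧
      (subgroupLanguage (letterVal n R) L H).IsRegular ∧
      (orbitLanguage (letterVal n R) L).IsRegular := by
  obtain ⟨L, hL, hsurj, hft, hH⟩ := exists_language_over_letters h
  obtain ⟨L', hL', hsub, huniq⟩ := exists_unique_representatives hL hsurj (hft 1)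
  have hft' := fun g => (hft g).mono hsub
  refine ⟨L', hL', huniq, fun g => (hft' g).isRegular hL', ?_, isRegular_orbitLanguage hL' hft'⟩
  refine (congrArg Language.IsRegular (Language.ext fun w => ?_)).mpr (hL'.inf hH)
  exact ⟨fun hw => ⟨hw.1, hsub w hw.1, hw.2⟩, fun hw => ⟨hw.1, hw.2.2⟩⟩

end Existence

/-! ### A certified output for every rational subgroup -/

section Completeness

variable {n : ℕ} {R V : List (List (Letter n))}

theorem padPair_mem_multiplierLanguage {α G : Type*} [Group G] {val : α → G} {L : Language α} {g : G}
    {u v : List α} : padPair u v ∈ multiplierLanguage val L g ↔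
      u ∈ L ∧ v ∈ L ∧ wordVal val u * g = wordVal val v := by
  constructor
  · rintro ⟨u', hu, v', hv, e, h⟩
    obtain ⟨rfl, rfl⟩ := padPair_injective h
    exact ⟨hu, hv, e⟩
  · rintro ⟨hu, hv, e⟩
    exact ⟨u, hu, v, hv, e, rfl⟩

theorem padPair_mem_orbitLanguage {α G : Type*} [Group G] {val : α → G} {L : Language α}
    {p v : List α} : padPair p v ∈ orbitLanguage val L ↔
      v ∈ L ∧ (p ∈ prefixLanguage L → wordVal val p = wordVal val v) := by
  constructor
  · rintro ⟨p', v', hv, e, h⟩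
    obtain ⟨rfl, rfl⟩ := padPair_injective h
    exact ⟨hv, e⟩
  · rintro ⟨hv, e⟩
    exact ⟨p, v, hv, e, rfl⟩

theorem exists_certified (h : IsRationalForSomeAutomaticStructure (genSubgroup n R V)) :
    ∃ o W Y w₀, Certified (codeInput n R V) o W Y w₀ := by
  obtain ⟨L, hL, huniq, hmul, hH, hY⟩ := exists_structure_with_uniqueness h
  set π := wordVal (letterVal n R) with hπ
  obtain ⟨M, hM⟩ : ∃ c, wordLanguage n c = L :=
    AutomatonCode.exists_accepts_eq (codeLetter_injective n) hL
  obtain ⟨MH, hMH⟩ : ∃ c, wordLanguage n c =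
      subgroupLanguage (letterVal n R) L (genSubgroup n R V) :=
    AutomatonCode.exists_accepts_eq (codeLetter_injective n) hH
  obtain ⟨Y, hY⟩ : ∃ c, pairLanguage n c = orbitLanguage (letterVal n R) L :=
    AutomatonCode.exists_accepts_eq (codePair_injective n) hY
  have hX : ∀ g, ∃ c, pairLanguage n c = multiplierLanguage (letterVal n R) L g := fun g =>
    AutomatonCode.exists_accepts_eq (codePair_injective n) (hmul g)
  choose X hX using hX
  obtain ⟨w₀, ⟨hw₀, hw₀π⟩, -⟩ := huniq 1
  have hinj : ∀ u ∈ L, ∀ v ∈ L, π u = π v → u = v := fun u hu v hv e =>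
    (huniq (π v)).unique ⟨hu, e⟩ ⟨hv, rfl⟩
  have hXmem : ∀ {g u v}, padPair u v ∈ pairLanguage n (X g) ↔ u ∈ L ∧ v ∈ L ∧ π u * g = π v := by
    intro g u v
    rw [hX, padPair_mem_multiplierLanguage]
  have hYmem : ∀ {p v}, padPair p v ∈ pairLanguage n Y ↔
      v ∈ L ∧ (p ∈ prefixLanguage L → π p = π v) := by
    intro p v
    rw [hY, padPair_mem_orbitLanguage]
  have hXpad : ∀ g, IsPadded n (X g) := fun g => isPadded_iff.2 fun z hz => by
    rw [hX] at hz
    obtain ⟨u, -, v, -, -, rfl⟩ := hz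
    exact ⟨u, v, rfl⟩
  have hcomp : ∀ g g', ComposesInto n none (X g) (X g') (X (g * g')) := fun g g' =>
    composesInto_iff (app := none).2 fun u v w h1 h2 => by
      rw [hXmem] at h1 h2
      rw [Option.toList_none, List.append_nil, hXmem]
      exact ⟨h1.1, h2.2.1, by rw [← mul_assoc, h1.2.2, h2.2.2]⟩
  let o : AlgOutput := (M, X 1, List.ofFn fun i : Fin n =>
    (X (letterVal n R (i, true)), X (letterVal n R (i, false))), MH)
  have ho : ∀ a, o.multiplier (codeLetter a) = X (letterVal n R a) := by
    rintro ⟨i, b⟩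
    cases b <;> simp [o, AlgOutput.multiplier, codeLetter, List.getD_eq_getElem?_getD]
  let W : List (List LetterCode × AutomatonCode PairCode) := (R ++ V).flatMap fun w =>
    w.inits.map fun p => (p.map codeLetter, X (π p))
  have hW : ∀ {x}, x ∈ W ↔ ∃ w ∈ R ++ V, ∃ p, p <+: w ∧ (p.map codeLetter, X (π p)) = x := by
    intro x
    simp only [W, List.mem_flatMap, List.mem_map, List.mem_inits]
  refine ⟨o, W, Y, w₀.map codeLetter, ?_⟩
  unfold Certified
  simp only [codeInput]
  refine ⟨⟨by simp [o], fun b hb => ?_⟩,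
    ⟨hXpad 1, isDiagonal_iff.2 fun u v => ?_⟩, ⟨fun x hx => ?_, fun r hr => ?_, fun v hv => ?_⟩,
    ⟨?_, ?_, ?_, ?_⟩, fixesWords_iff.2 fun u v huv hu => ?_, isSubautomaton_iff.2 fun u hu => ?_, ?_⟩
  · obtain ⟨a, rfl⟩ := mem_letterCodes.1 hb
    have ho' := ho (a.1, !a.2)
    unfold LetterCertified
    dsimp only
    rw [show (((codeLetter a).1, !(codeLetter a).2) : LetterCode) = codeLetter (a.1, !a.2) from rfl,
      ho, ho', letterVal_not]
    refine ⟨hXpad _, relatesWords_iff.2 fun u v huv => ?_,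
      exists_pair_labelling_iff (a := a).2 fun z hz => ?_, .of_exists fun u hu => ?_, ?_,
      composesInto_iff (app := some a).2 fun p v v' hp hv => ?_⟩
    · rw [hXmem] at huv
      change u ∈ wordLanguage n M ∧ v ∈ wordLanguage n M
      rw [hM]
      exact ⟨huv.1, huv.2.1⟩
    · rw [hX] at hz
      obtain ⟨u, hu, v, hv, e, rfl⟩ := hz
      rwa [filterMap_fst_padPair, filterMap_snd_padPair]
    · change u ∈ wordLanguage n M at hu
      rw [hM] at hu
      obtain ⟨v, ⟨hv, e⟩, -⟩ := huniq (π u * letterVal n R a)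
      exact ⟨v, hXmem.2 ⟨hu, hv, e.symm⟩⟩
    · have h1 := hcomp (letterVal n R a) (letterVal n R a)⁻¹
      rwa [mul_inv_cancel] at h1
    · rw [hYmem] at hp ⊢
      rw [hXmem] at hv
      refine ⟨hv.2.1, ?_⟩
      rintro ⟨y, hy⟩
      rw [← hv.2.2, ← hp.2 ⟨a :: y, by simpa using hy⟩]
      simp [hπ]
  · change padPair u v ∈ pairLanguage n (X 1) ↔ u ∈ wordLanguage n M ∧ u = v
    rw [hXmem, hM, mul_one]
    constructor
    · rintro ⟨hu, hv, e⟩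
      exact ⟨hu, hinj u hu v hv e⟩
    · rintro ⟨hu, rfl⟩
      exact ⟨hu, hu, rfl⟩
  · obtain ⟨w, hw, p, hp, rfl⟩ := hW.1 hx
    rcases List.eq_nil_or_concat' p with rfl | ⟨p, a, rfl⟩
    · exact Or.inl ⟨rfl, rfl⟩
    · refine Or.inr ⟨_, hW.2 ⟨w, hw, p, (List.prefix_append _ _).trans hp, rfl⟩, codeLetter a,
        mem_letterCodes.2 ⟨a, rfl⟩, by simp, ?_⟩
      have h1 := hcomp (π p) (letterVal n R a)
      have h2 : π (p ++ [a]) = π p * letterVal n R a := by simp [hπ]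
      simp only [ho, h2]
      exact h1
  · obtain ⟨r, hrR, rfl⟩ := List.mem_map.1 hr
    have hπr : π r = 1 := wordVal_relator (Or.inl hrR)
    refine ⟨_, hW.2 ⟨r, List.mem_append_left _ hrR, r, List.prefix_rfl, rfl⟩, rfl,
      fixesWords_iff.2 fun u v huv hu => ?_⟩
    rw [hXmem, hπr, mul_one] at huv
    exact hinj u huv.1 v huv.2.1 huv.2.2
  · obtain ⟨x, hx, rfl⟩ := List.mem_map.1 hv
    refine ⟨_, hW.2 ⟨x, List.mem_append_right _ hx, x, List.prefix_rfl, rfl⟩, rfl,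
      preservesWords_iff.2 fun u v huv => ?_⟩
    obtain ⟨hu, hv, e⟩ := hXmem.1 huv
    change u ∈ wordLanguage n MH ↔ v ∈ wordLanguage n MH
    rw [hMH]
    have hxH : π x ∈ genSubgroup n R V := Subgroup.subset_closure ⟨x, hx, rfl⟩
    refine and_congr (iff_of_true hu hv) ?_
    change π u ∈ _ ↔ π v ∈ _
    rw [← e, Subgroup.mul_mem_cancel_right _ hxH]
  · rw [← mem_wordLanguage, hM]
    exact hw₀
  · have h1 : padPair [] w₀ ∈ pairLanguage n Y := hYmem.2 ⟨hw₀, fun _ => hw₀π.symm⟩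
    rw [mem_pairLanguage, ← padPair_map_codeLetter] at h1
    exact h1
  · rw [← mem_wordLanguage, hMH]
    exact ⟨hw₀, (congrArg (· ∈ genSubgroup n R V) hw₀π).mpr (one_mem _)⟩
  · refine (memCode_iff (R := R) (V := [])).2 ?_
    exact (congrArg (· ∈ genSubgroup n R []) hw₀π).mpr (one_mem _)
  · change u ∈ wordLanguage n M at hu
    rw [hM] at hu
    rw [hYmem] at huv
    exact hinj u hu v huv.1 (huv.2 ⟨[], by simpa using hu⟩)
  · change u ∈ wordLanguage n MH at hu
    change u ∈ wordLanguage n M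
    rw [hMH] at hu
    rw [hM]
    exact hu.1
  · refine exists_word_labelling_iff.2 fun w hw => ?_
    change w ∈ wordLanguage n MH at hw
    rw [hMH] at hw
    exact hw.2

end Completeness

/-! ### Correct outputs give automatic structures -/

section Transport

variable {α β G : Type*} [Group G] {val : β → G} {L : Language β}

theorem isRegular_preimage_map {L : Language β} (hL : L.IsRegular) (f : α → β) :
    Language.IsRegular ({w | w.map f ∈ L} : Language α) := by
  simpa only [List.filterMap_eq_map'] using isRegular_preimage_filterMap hL fun a => some (f a)

theorem padPair_map (f : α → β) (u v : List α) : padPair (u.map f) (v.map f) =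
    (padPair u v).map (Prod.map (Option.map f) (Option.map f)) := by
  induction u, v using padPair_induction <;> simp_all

theorem wordVal_map (val : β → G) (f : α → β) (w : List α) :
    wordVal val (w.map f) = wordVal (val ∘ f) w := by
  simp [wordVal]

theorem isRegular_multiplierLanguage_preimage (e : α ≃ β) {g : G}
    (h : (multiplierLanguage val L g).IsRegular) :
    (multiplierLanguage (val ∘ e) ({w | w.map e ∈ L} : Language α) g).IsRegular := by
  refine (congrArg Language.IsRegular (Language.ext fun z => ?_)).mpr
    (isRegular_preimage_map h (Prod.map (Option.map e) (Option.map e)))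
  change _ ↔ z.map _ ∈ multiplierLanguage val L g
  constructor
  · rintro ⟨u, hu, v, hv, h, rfl⟩
    refine ⟨_, hu, _, hv, ?_, (padPair_map e u v).symm⟩
    rwa [wordVal_map, wordVal_map]
  · rintro ⟨u, hu, v, hv, h, hz⟩
    obtain ⟨u, rfl⟩ := (List.map_surjective_iff.2 e.surjective) u
    obtain ⟨v, rfl⟩ := (List.map_surjective_iff.2 e.surjective) v
    rw [padPair_map] at hz
    have hinj := Option.map_injective e.injective
    rw [wordVal_map, wordVal_map] at h
    exact ⟨u, hu, v, hv, h, List.map_injective_iff.2 (hinj.prodMap hinj) hz⟩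

/-- An automatic structure stays one when its letters are renamed. -/
theorem IsAutomaticStructure.comp_equiv [Finite α] [Finite β] (h : IsAutomaticStructure val L)
    (e : α ≃ β) : IsAutomaticStructure (val ∘ e) ({w | w.map e ∈ L} : Language α) where
  inv_closed a := by
    obtain ⟨b, hb⟩ := h.inv_closed (e a)
    exact ⟨e.symm b, by simpa using hb⟩
  regular := isRegular_preimage_map h.regular e
  surjective g := by
    obtain ⟨w, hw, rfl⟩ := h.surjective g
    obtain ⟨w, rfl⟩ := (List.map_surjective_iff.2 e.surjective) w
    exact ⟨w, hw, (wordVal_map val e w).symm⟩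
  regular_eq := isRegular_multiplierLanguage_preimage e h.regular_eq
  regular_mul a := isRegular_multiplierLanguage_preimage e (h.regular_mul (e a))

theorem IsAutomaticStructure.isRational [Finite β] (h : IsAutomaticStructure val L)
    {H : Subgroup G} (hH : (subgroupLanguage val L H).IsRegular) :
    IsRationalForSomeAutomaticStructure H := by
  obtain ⟨k, ⟨e⟩⟩ := Finite.exists_equiv_fin β
  refine ⟨k, _, _, h.comp_equiv e.symm, ?_⟩
  refine (congrArg Language.IsRegular (Language.ext fun w => ?_)).mpr
    (isRegular_preimage_map hH e.symm)
  exact and_congr_right fun _ => by rw [wordVal_map]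

end Transport

section Final

variable {n : ℕ} {R V : List (List (Letter n))}

theorem IsAutomaticStructureWithUniqueness.isAutomaticStructure {M : AutomatonCode LetterCode}
    {Meq : AutomatonCode PairCode} {Mx : List (AutomatonCode PairCode × AutomatonCode PairCode)}
    (h : IsAutomaticStructureWithUniqueness n R M Meq Mx) :
    IsAutomaticStructure (letterVal n R) (wordLanguage n M) where
  inv_closed a := ⟨_, letterVal_not a⟩
  regular := isRegular_wordLanguage n M
  surjective g := (h.existsUnique g).exists
  regular_eq := h.lang_eq ▸ isRegular_pairLanguage n Meq
  regular_mul := by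
    rintro ⟨i, _ | _⟩
    · exact (h.lang_mul i).2 ▸ isRegular_pairLanguage n _
    · exact (h.lang_mul i).1 ▸ isRegular_pairLanguage n _

theorem IsCorrectOutput.isRational {o : AlgOutput} (h : IsCorrectOutput n R V o) :
    IsRationalForSomeAutomaticStructure (genSubgroup n R V) :=
  h.1.isAutomaticStructure.isRational (h.2 ▸ isRegular_wordLanguage n o.2.2.2)

end Final

/-! ### The algorithm -/

theorem proposition2 :
    ∃ f : AlgInput →. AlgOutput, Partrec f ∧
      ∀ (n : ℕ) (R V : List (List (Letter n))),
        (IsRationalForSomeAutomaticStructure (genSubgroup n R V) →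
          ∃ o ∈ f (codeInput n R V), IsCorrectOutput n R V o) ∧
        (¬ IsRationalForSomeAutomaticStructure (genSubgroup n R V) →
          ¬ (f (codeInput n R V)).Dom) := by
  obtain ⟨f, hf, hcert, hdom⟩ := semiDec_exists_certified.exists_partrec_choice
  have hcorrect : ∀ (n : ℕ) (R V : List (List (Letter n))), ∀ o ∈ f (codeInput n R V),
      IsCorrectOutput n R V o := by
    intro n R V o ho
    obtain ⟨c, hc⟩ := hcert _ o ho
    exact hc.isCorrectOutput
  refine ⟨f, hf, fun n R V => ⟨fun h => ?_, fun h hd => ?_⟩⟩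
  · obtain ⟨o, W, Y, w₀, hc⟩ := exists_certified h
    have hd := hdom (codeInput n R V) ⟨o, (W, Y, w₀), hc⟩
    exact ⟨_, Part.get_mem hd, hcorrect n R V _ (Part.get_mem hd)⟩
  · exact h (hcorrect n R V _ (Part.get_mem hd)).isRational
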